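/- Let $p,m\ge 1$, $k\in\{1,\dots,p\}$, $s\in\{1,\dots,m\}$ and $r=k\wedge s$. One observes $Y=M+Z$, where $M\in\mathbb R^{p\times m}$ is unknown and $Z$ has i.i.d. $N(0,1)$ entries. Let $\mathcal F(k,s;p,m)$ be the set of all $M\in\mathbb R^{p\times m}$ with at most $k$ nonzero rows and at most $s$ nonzero columns. Let $\|\cdot\|_\tau$ be a unitarily invariant norm on $\mathbb R^{p\times m}$, that is, a norm with $\|UAV\|_\tau=\|A\|_\tau$ for all $A$ and all orthogonal $U\in O(p)$, $V\in O(m)$; let $\tau(x)=\|\mathrm{diag}(x)\|_\tau$, $x\in\mathbb R^{p\wedge m}$, be its symmetric gauge, $\tau|_r(x_1,\dots,x_r)=\tau(x_1,\dots,x_r,0,\dots,0)$ the restriction of the gauge to $\mathbb R^r$, $\mathbf 1\in\mathbb R^r$ the all-one vector, and $L_{\tau|_r}=\sup_{0\ne x\in\mathbb R^r}\tau|_r(x)/\|x\|_2$. Put $$R_0=(\tau|_r)^2(\mathbf 1)\,(k\vee s),\qquad R_1=L_{\tau|_r}^2\Big(k\log\frac{ep}{k}+s\log\frac{em}{s}\Big).$$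 There are absolute constants $0<c\le C<\infty$ such that for all $p,m,k,s$ and all unitarily invariant norms $\|\cdot\|_\tau$ as above the following hold, where $\inf_{\widetilde M}$ is over all measurable functions $\widetilde M=\widetilde M(Y)$. 1. (Minimax rate.) $$c\,(R_0+R_1)\ \le\ \inf_{\widetilde M}\ \sup_{M\in\mathcal F(k,s;p,m)}\mathbb E\|\widetilde M-M\|_\tau^2\ \le\ C\,(R_0+R_1).$$ 2. (The first term is the oracle risk.) For all $I\subset\{1,\dots,p\}$ with $|I|=k$ and all $J\subset\{1,\dots,m\}$ with $|J|=s$, $$c\,R_0\ \le\ \inf_{\widetilde M}\ \sup_{M}\mathbb E\|\widetilde M-M\|_\tau^2\ \le\ C\,R_0,$$ where the supremum is over all $M\in\mathbb R^{p\times m}$ whose entries outside $I\times J$ are zero. 3. (Attainment by subset selection.) For $c_1,\gamma>0$ let $$\psi(i,j)=c_1\,\tau|_r(\mathbf 1)\sqrt{i\vee j}+\sqrt{\gamma}\,L_{\tau|_r}\sqrt{i\log\tfrac{ep}{i}+j\log\tfrac{em}{j}}\qquad(0\log\tfrac{e p}{0}=0\log\tfrac{e m}{0}=0),$$ and let $\mathbb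 B(Y)$ be the set of all blocks $A\times B$ with $A\subset\{1,\dots,p\}$, $B\subset\{1,\dots,m\}$, $|A|=k$, $|B|=s$, such that $\|Y_{FG}\|_\tau\le\psi(|F|,|G|)$ for every block $F\times G$ disjoint from $A\times B$ with $|F|\le k$, $|G|\le s$; here $\|Y_{FG}\|_\tau$ is the norm of the $p\times m$ matrix that agrees with $Y$ on $F\times G$ and is zero elsewhere. For all $c_1\ge\sqrt{6+2\sqrt{2\pi}}$ and $\gamma\ge4$ there is a constant $C'=C'(c_1,\gamma)<\infty$ such that for all $p,m,k,s$ and all unitarily invariant norms $\|\cdot\|_\tau$ as above there is a measurable estimator of the form $\widehat M_{ij}=Y_{ij}\mathbf 1\{i\in\widehat I(Y)\}\mathbf 1\{j\in\widehat J(Y)\}$, with $|\widehat I(Y)|=k$ and $|\widehat J(Y)|=s$ for all $Y$ and $\widehat I(Y)\times\widehat J(Y)\in\mathbb B(Y)$ whenever $\mathbb B(Y)\neq\emptyset$, for which $$\sup_{M\in\mathcal F(k,s;p,m)}\mathbb E\|\widehat M-M\|_\tau^2\ \le\ C'\,(R_0+R_1).$$ -/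

import Mathlib

open MeasureTheory ProbabilityTheory
open scoped ENNReal

noncomputable section

namespace SubmatrixDenoising

/-- Real `p × m` matrices carry the product (equivalently Borel) σ-algebra of their entries. -/
instance matrixMeasurableSpace (p m : ℕ) : MeasurableSpace (Matrix (Fin p) (Fin m) ℝ) :=
  inferInstanceAs (MeasurableSpace (Fin p → Fin m → ℝ))

/-- A unitarily invariant norm on real `p × m` matrices: a seminorm that is definite and satisfies
`‖U A V‖ = ‖A‖` for all orthogonal `U`, `V`. -/
structure IsUnitarilyInvariantNorm {p m : ℕ} (N : Seminorm ℝ (Matrix (Fin p) (Fin m) ℝ)) :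
    Prop where
  definite : ∀ A, N A = 0 → A = 0
  invariant : ∀ U ∈ Matrix.orthogonalGroup (Fin p) ℝ, ∀ V ∈ Matrix.orthogonalGroup (Fin m) ℝ,
    ∀ A, N (U * A * V) = N A

/-- The `p × m` matrix with the vector `x` on its main diagonal and zeros elsewhere. -/
def rectDiag {p m : ℕ} (x : Fin (min p m) → ℝ) : Matrix (Fin p) (Fin m) ℝ :=
  Matrix.of fun i j =>
    if h : i.val = j.val then x ⟨i.val, lt_min i.isLt (h ▸ j.isLt)⟩ else 0

/-- The symmetric gauge `τ(x) = ‖diag(x)‖` of a matrix norm. -/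
def gauge {p m : ℕ} (N : Seminorm ℝ (Matrix (Fin p) (Fin m) ℝ)) (x : Fin (min p m) → ℝ) : ℝ :=
  N (rectDiag x)

/-- The restriction `τ|_r (x₁, …, x_r) = τ (x₁, …, x_r, 0, …, 0)` (used for `r ≤ d`). -/
def restrictGauge {d : ℕ} (τ : (Fin d → ℝ) → ℝ) (r : ℕ) (x : Fin r → ℝ) : ℝ :=
  τ fun i => if h : i.val < r then x ⟨i.val, h⟩ else 0

/-- The Lipschitz constant `sup_{x ≠ 0} τ(x) / ‖x‖₂` of a norm on `ℝ^r` with respect to the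
Euclidean norm. -/
def lipschitzConst {r : ℕ} (τ : (Fin r → ℝ) → ℝ) : ℝ :=
  ⨆ x : {x : Fin r → ℝ // x ≠ 0}, τ x.1 / √(∑ i, x.1 i ^ 2)

/-- The supremum defining the Lipschitz constant of a restricted gauge is over a bounded set. -/
theorem bddAbove_restrictGauge_div {p m : ℕ} (N : Seminorm ℝ (Matrix (Fin p) (Fin m) ℝ)) (r : ℕ) :
    BddAbove (Set.range fun x : {x : Fin r → ℝ // x ≠ 0} =>
      restrictGauge (gauge N) r x.1 / √(∑ i, x.1 i ^ 2)) := by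
  refine ⟨∑ i : Fin r, restrictGauge (gauge N) r (Pi.single i 1), ?_⟩
  rintro _ ⟨⟨x, hx⟩, rfl⟩
  let f : (Fin r → ℝ) →ₗ[ℝ] Matrix (Fin p) (Fin m) ℝ :=
    { toFun := fun x => rectDiag fun i => if h : i.val < r then x ⟨i.val, h⟩ else 0
      map_add' := fun x y => by
        ext i j
        simp only [rectDiag, Matrix.of_apply, Matrix.add_apply, Pi.add_apply]
        split_ifs <;> simp
      map_smul' := fun c x => by
        ext i j
        simp only [rectDiag, Matrix.of_apply, Matrix.smul_apply, Pi.smul_apply, RingHom.id_apply]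
        split_ifs <;> simp }
  have hf : ∀ y, restrictGauge (gauge N) r y = (N.comp f) y := fun y => rfl
  have hx0 : ∃ i, x i ≠ 0 := by
    by_contra h
    push Not at h
    exact hx (funext h)
  obtain ⟨i₀, hi₀⟩ := hx0
  have hpos : 0 < √(∑ i, x i ^ 2) := Real.sqrt_pos.2
    (Finset.sum_pos' (fun i _ => sq_nonneg _) ⟨i₀, Finset.mem_univ _, by positivity⟩)
  have hle : ∀ i, |x i| ≤ √(∑ i, x i ^ 2) := fun i => Real.abs_le_sqrt
    (Finset.single_le_sum (f := fun i => x i ^ 2) (fun i _ => sq_nonneg _) (Finset.mem_univ i))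
  simp only [hf]
  rw [div_le_iff₀ hpos, Finset.sum_mul]
  have hdec : x = ∑ i, x i • (Pi.single i (1 : ℝ) : Fin r → ℝ) := by
    ext j
    simp [Finset.sum_apply, Pi.single_apply]
  calc (N.comp f) x = (N.comp f) (∑ i, x i • (Pi.single i (1 : ℝ) : Fin r → ℝ)) := by rw [← hdec]
    _ ≤ ∑ i, (N.comp f) (x i • (Pi.single i (1 : ℝ) : Fin r → ℝ)) :=
        Finset.le_sum_of_subadditive _ (map_zero (N.comp f)).le (map_add_le_add _) _ _
    _ ≤ _ := by
        refine Finset.sum_le_sum fun i _ => ?_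
        rw [map_smul_eq_mul, Real.norm_eq_abs, mul_comm]
        exact mul_le_mul_of_nonneg_left (hle i) (apply_nonneg _ _)

/-- The class `F(k, s; p, m)` of `p × m` matrices with at most `k` nonzero rows and at most `s`
nonzero columns. -/
def sparseClass (p m k s : ℕ) : Set (Matrix (Fin p) (Fin m) ℝ) :=
  {M | {i | M.row i ≠ 0}.ncard ≤ k ∧ {j | M.col j ≠ 0}.ncard ≤ s}

/-- The matrices whose support lies in the known block `I × J`. -/
def supportedClass {p m : ℕ} (I : Finset (Fin p)) (J : Finset (Fin m)) :
    Set (Matrix (Fin p) (Fin m) ℝ) :=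
  {M | ∀ i j, M i j ≠ 0 → i ∈ I ∧ j ∈ J}

/-- The law of a `p × m` matrix with i.i.d. `N(0, 1)` entries. -/
def noise (p m : ℕ) : Measure (Matrix (Fin p) (Fin m) ℝ) :=
  Measure.pi fun _ : Fin p => Measure.pi fun _ : Fin m => gaussianReal 0 1

/-- The risk `E ‖est(Y) - M‖²` of the estimator `est` at `M`, where `Y = M + Z`. -/
def risk {p m : ℕ} (N : Seminorm ℝ (Matrix (Fin p) (Fin m) ℝ))
    (est : Matrix (Fin p) (Fin m) ℝ → Matrix (Fin p) (Fin m) ℝ)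
    (M : Matrix (Fin p) (Fin m) ℝ) : ℝ≥0∞ :=
  ∫⁻ Z, ENNReal.ofReal (N (est (M + Z) - M) ^ 2) ∂(noise p m)

/-- The minimax risk over the parameter set `Θ`: infimum over all measurable estimators of the
supremum over `M ∈ Θ` of the risk. -/
def minimaxRisk {p m : ℕ} (N : Seminorm ℝ (Matrix (Fin p) (Fin m) ℝ))
    (Θ : Set (Matrix (Fin p) (Fin m) ℝ)) : ℝ≥0∞ :=
  ⨅ est : {f : Matrix (Fin p) (Fin m) ℝ → Matrix (Fin p) (Fin m) ℝ // Measurable f},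
    ⨆ M ∈ Θ, risk N est.1 M

/-- `τ|_r (1)` with `r = k ∧ s`. -/
def gaugeOne {p m : ℕ} (N : Seminorm ℝ (Matrix (Fin p) (Fin m) ℝ)) (k s : ℕ) : ℝ :=
  restrictGauge (gauge N) (min k s) fun _ => 1

/-- `L_{τ|_r}` with `r = k ∧ s`. -/
def gaugeLip {p m : ℕ} (N : Seminorm ℝ (Matrix (Fin p) (Fin m) ℝ)) (k s : ℕ) : ℝ :=
  lipschitzConst (restrictGauge (gauge N) (min k s))

/-- `k log (e p / k) + s log (e m / s)`. -/
def supportEntropy (p m k s : ℕ) : ℝ :=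
  k * Real.log (Real.exp 1 * p / k) + s * Real.log (Real.exp 1 * m / s)

/-- The oracle rate `(τ|_r)²(1) (k ∨ s)`. -/
def oracleRate {p m : ℕ} (N : Seminorm ℝ (Matrix (Fin p) (Fin m) ℝ)) (k s : ℕ) : ℝ :=
  gaugeOne N k s ^ 2 * ((max k s : ℕ) : ℝ)

/-- The excess rate `L_{τ|_r}² (k log (e p / k) + s log (e m / s))`. -/
def excessRate {p m : ℕ} (N : Seminorm ℝ (Matrix (Fin p) (Fin m) ℝ)) (k s : ℕ) : ℝ :=
  gaugeLip N k s ^ 2 * supportEntropy p m k s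

/-- The matrix which agrees with `Y` on the block `F × G` and vanishes elsewhere. Its norm is the
norm of the block `Y_{FG}`. -/
def keepBlock {p m : ℕ} (F : Finset (Fin p)) (G : Finset (Fin m))
    (Y : Matrix (Fin p) (Fin m) ℝ) : Matrix (Fin p) (Fin m) ℝ :=
  Matrix.of fun i j => if i ∈ F ∧ j ∈ G then Y i j else 0

/-- The noise level
`ψ(i, j) = c₁ τ|_r(1) √(i ∨ j) + √γ L_{τ|_r} √(i log (e p / i) + j log (e m / j))`. -/
def noiseLevel {p m : ℕ} (N : Seminorm ℝ (Matrix (Fin p) (Fin m) ℝ)) (k s : ℕ) (c₁ γ : ℝ)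
    (i j : ℕ) : ℝ :=
  c₁ * gaugeOne N k s * √((max i j : ℕ) : ℝ) + √γ * gaugeLip N k s * √(supportEntropy p m i j)

/-- The `k × s` blocks `A × B` such that every block `F × G` disjoint from `A × B`, with `|F| ≤ k`
and `|G| ≤ s`, satisfies `‖Y_{FG}‖ ≤ ψ(|F|, |G|)`. -/
def admissibleBlocks {p m : ℕ} (N : Seminorm ℝ (Matrix (Fin p) (Fin m) ℝ)) (k s : ℕ) (c₁ γ : ℝ)
    (Y : Matrix (Fin p) (Fin m) ℝ) : Set (Finset (Fin p) × Finset (Fin m)) :=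
  {S | S.1.card = k ∧ S.2.card = s ∧
    ∀ (F : Finset (Fin p)) (G : Finset (Fin m)), F.card ≤ k → G.card ≤ s →
      Disjoint (F ×ˢ G) (S.1 ×ˢ S.2) →
      N (keepBlock F G Y) ≤ noiseLevel N k s c₁ γ F.card G.card}

/-- A subset-selection estimator: it keeps the observed entries on a `k × s` block chosen from the
data, and puts zeros elsewhere; the block is admissible whenever an admissible block exists. -/
def IsSubsetSelectionEstimator {p m : ℕ} (N : Seminorm ℝ (Matrix (Fin p) (Fin m) ℝ)) (k s : ℕ)
    (c₁ γ : ℝ) (est : Matrix (Fin p) (Fin m) ℝ → Matrix (Fin p) (Fin m) ℝ) : Prop :=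
  Measurable est ∧
    ∃ S : Matrix (Fin p) (Fin m) ℝ → Finset (Fin p) × Finset (Fin m),
      (∀ Y, (S Y).1.card = k ∧ (S Y).2.card = s) ∧
      (∀ Y, (admissibleBlocks N k s c₁ γ Y).Nonempty → S Y ∈ admissibleBlocks N k s c₁ γ Y) ∧
      ∀ Y, est Y = keepBlock (S Y).1 (S Y).2 Y

end SubmatrixDenoising

end

noncomputable section

namespace SubmatrixDenoising

/-! ### Cameron–Martin shifts of Gaussian product measures -/

/-! Everything rests on one estimate for the large singular values of a Gaussian block. Let the
block have sides at most n, and let S be the sum of the squares of its singular values that are at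
least 8√n. Average the likelihood ratio exp(t⟨Z,C⟩ - t²‖C‖²/2), with C = ∑ g_l ⊗ h_l, over
independent Gaussian g, h, with t = 1/√n. Its mean over Z is 1. Shifting g and h along the large
singular vectors of Z and applying Jensen bounds the average below by exp(S/5)
(`exp_le_blockWeight`). This replaces nets and concentration: a union bound is a sum of weights, and
exp(S/5) ≤ X gives S ≤ 5 log K + 5X/K for every K ≥ 1.

Upper bounds. Cutting singular values at a = 8√n gives ‖Z_FG‖ ≤ a τ(1) + L √S
(`gauge_le_threshold`). For one block this is the oracle upper bound, because L ≤ τ(1). Summed over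
all k × s blocks with log K of the order of the entropy, it bounds the expected square of w, the
largest norm of a noise block, by R₀ + R₁. The estimator selects a block minimizing the worst excess
over ψ. The true block has excess at most w, so the selected one does too, with no case distinction
on whether an admissible block exists. The part of M missed by the selection splits into two blocks
disjoint from it, and the loss is at most 2ψ(k,s) + 5w.

Oracle lower bound. Put a standard Gaussian prior X on the known block. Exchanging X with the noise
on the block preserves both the joint law and Y = X + Z, so no estimator tells them apart and E‖Z -
X‖² ≤ 4 · risk. Then E‖Z_IJ‖² is bounded below: averaging over cyclic shifts gives τ(1) ∑ x_i ≤
r‖Z_IJ‖, while ∑ x_i² ≤ (max x_i) ∑ x_i, the maximum is controlled by S, and the expected Frobenius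
energy is ks.

Excess lower bound. Hahn–Banach, followed by compression to an r × r corner, gives a functional of
rank at most r, dominated by the norm, with Hilbert–Schmidt norm at least L/2 (`exists_dual`). Its
left singular vectors are replaced by columns of a flat orthogonal k × k matrix (the Hartley
matrix), whose k rows are placed in k groups of q = ⌊p/k⌋ rows, one per group. Flatness makes the
overlap of two placements at most proportional to their number of agreements, and few placements
agree with a given one in a quarter of the groups. A second-moment testing argument
(`le_minimaxRisk_of_packing`) gives k log q · L²; transposition gives the column term. For small p/k
the entropy is of order k and is absorbed by R₀. -/

theorem lintegral_pi_prod {ι : Type*} [Fintype ι] {α : ι → Type*}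
    [∀ i, MeasurableSpace (α i)] (μ : ∀ i, Measure (α i)) [∀ i, IsProbabilityMeasure (μ i)]
    {f : ∀ i, α i → ℝ≥0∞} (hf : ∀ i, Measurable (f i)) :
    ∫⁻ x, ∏ i, f i (x i) ∂(Measure.pi μ) = ∏ i, ∫⁻ x, f i x ∂(μ i) := by
  have hind : iIndepFun (fun i (x : ∀ i, α i) => f i (x i)) (Measure.pi μ) :=
    iIndepFun_pi (fun i => (hf i).aemeasurable)
  have := lintegral_prod_eq_prod_lintegral_of_indepFun Finset.univ _ hind
    (fun i => (hf i).comp (measurable_pi_apply i))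
  rw [this]
  refine Finset.prod_congr rfl fun i _ => ?_
  rw [← (measurePreserving_eval μ i).lintegral_comp (hf i)]

/-- On a box both sides factor, because the indicator of the box times the product density is a
product of one-coordinate functions. -/
theorem pi_withDensity {ι : Type*} [Fintype ι] {α : ι → Type*}
    [∀ i, MeasurableSpace (α i)] (μ : ∀ i, Measure (α i)) [∀ i, IsProbabilityMeasure (μ i)]
    {d : ∀ i, α i → ℝ≥0∞} (hd : ∀ i, Measurable (d i))
    [∀ i, SigmaFinite ((μ i).withDensity (d i))] :
    Measure.pi (fun i => (μ i).withDensity (d i))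
      = (Measure.pi μ).withDensity fun x => ∏ i, d i (x i) := by
  refine Measure.pi_eq fun s hs => ?_
  rw [withDensity_apply _ (MeasurableSet.univ_pi hs), ← lintegral_indicator
    (MeasurableSet.univ_pi hs)]
  have : ∀ x : ∀ i, α i, (Set.univ.pi s).indicator (fun x => ∏ i, d i (x i)) x
      = ∏ i, (s i).indicator (d i) (x i) := by
    intro x
    by_cases hx : x ∈ Set.univ.pi s
    · rw [Set.indicator_of_mem hx]
      exact Finset.prod_congr rfl fun i _ => (Set.indicator_of_mem (hx i trivial) _).symm
    · rw [Set.indicator_of_notMem hx]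
      obtain ⟨i, hi⟩ : ∃ i, x i ∉ s i := by simpa [Set.mem_pi] using hx
      exact (Finset.prod_eq_zero (Finset.mem_univ i) (Set.indicator_of_notMem hi _)).symm
  simp_rw [this]
  rw [lintegral_pi_prod μ fun i => (hd i).indicator (hs i)]
  refine Finset.prod_congr rfl fun i _ => ?_
  rw [lintegral_indicator (hs i), withDensity_apply _ (hs i)]

/-- The density of a shifted measure with respect to the original one tensorizes. -/
theorem lintegral_pi_shift {ι : Type*} [Fintype ι] {α : ι → Type*}
    [∀ i, MeasurableSpace (α i)] (μ : ∀ i, Measure (α i)) [∀ i, IsProbabilityMeasure (μ i)]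
    {T : ∀ i, α i → α i} (hT : ∀ i, Measurable (T i)) {d : ∀ i, α i → ℝ≥0∞}
    (hd : ∀ i, Measurable (d i))
    (h : ∀ i (f : α i → ℝ≥0∞), Measurable f → ∫⁻ x, f (T i x) ∂(μ i) = ∫⁻ x, d i x * f x ∂(μ i))
    (f : (∀ i, α i) → ℝ≥0∞) (hf : Measurable f) :
    ∫⁻ x, f (fun i => T i (x i)) ∂(Measure.pi μ)
      = ∫⁻ x, (∏ i, d i (x i)) * f x ∂(Measure.pi μ) := by
  have hm : ∀ i, (μ i).map (T i) = (μ i).withDensity (d i) := by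
    intro i
    ext s hs
    have := h i (s.indicator 1) (measurable_one.indicator hs)
    rw [← lintegral_indicator_one hs, lintegral_map (measurable_one.indicator hs) (hT i), this,
      withDensity_apply _ hs, ← lintegral_indicator hs]
    refine lintegral_congr fun x => ?_
    by_cases hx : x ∈ s <;> simp [hx]
  have hp : ∀ i, IsProbabilityMeasure ((μ i).map (T i)) := fun i =>
    Measure.isProbabilityMeasure_map (hT i).aemeasurable
  have hp' : ∀ i, IsProbabilityMeasure ((μ i).withDensity (d i)) := fun i => hm i ▸ hp i
  have hTm : Measurable fun (x : ∀ i, α i) i => T i (x i) :=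
    measurable_pi_lambda _ fun i => (hT i).comp (measurable_pi_apply i)
  have hD : Measurable fun x : ∀ i, α i => ∏ i, d i (x i) :=
    Finset.measurable_prod _ fun i _ => (hd i).comp (measurable_pi_apply i)
  rw [← lintegral_map hf hTm, Measure.pi_map_pi (fun i => (hT i).aemeasurable)]
  simp_rw [hm]
  rw [pi_withDensity μ hd, lintegral_withDensity_eq_lintegral_mul _ hD hf]
  rfl

/-- The ratio of the N(a,1) and N(0,1) densities is exp(ax - a²/2). -/
theorem lintegral_gaussianReal_shift (a : ℝ) (f : ℝ → ℝ≥0∞) (hf : Measurable f) :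
    ∫⁻ x, f (a + x) ∂(gaussianReal 0 1)
      = ∫⁻ x, ENNReal.ofReal (Real.exp (a * x - a ^ 2 / 2)) * f x ∂(gaussianReal 0 1) := by
  have h1 : ∫⁻ x, f (a + x) ∂(gaussianReal 0 1) = ∫⁻ x, f x ∂(gaussianReal a 1) := by
    have := gaussianReal_map_const_add (μ := 0) (v := 1) a
    rw [zero_add] at this
    rw [← this, lintegral_map hf (measurable_const_add a)]
  rw [h1, gaussianReal_of_var_ne_zero _ one_ne_zero, gaussianReal_of_var_ne_zero _ one_ne_zero,
    lintegral_withDensity_eq_lintegral_mul _ (measurable_gaussianPDF _ _) hf,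
    lintegral_withDensity_eq_lintegral_mul _ (measurable_gaussianPDF _ _) (by fun_prop)]
  refine lintegral_congr fun x => ?_
  simp only [Pi.mul_apply, gaussianPDF]
  rw [← mul_assoc, ← ENNReal.ofReal_mul (gaussianPDFReal_nonneg _ _ _)]
  congr 1
  simp only [gaussianPDFReal]
  rw [mul_assoc _ (Real.exp _), ← Real.exp_add]
  congr 3
  simp only [NNReal.coe_one]
  ring

/-- The standard Gaussian measure on `ι → ℝ`. -/
def stdGauss (ι : Type*) [Fintype ι] : Measure (ι → ℝ) := Measure.pi fun _ => gaussianReal 0 1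

instance (ι : Type*) [Fintype ι] : IsProbabilityMeasure (stdGauss ι) := by
  unfold stdGauss; infer_instance

instance (p m : ℕ) : IsProbabilityMeasure (noise p m) := by
  unfold noise
  exact inferInstanceAs (IsProbabilityMeasure
    (Measure.pi fun _ : Fin p => Measure.pi fun _ : Fin m => gaussianReal 0 1))

theorem lintegral_stdGauss_shift {ι : Type*} [Fintype ι] (a : ι → ℝ) (f : (ι → ℝ) → ℝ≥0∞)
    (hf : Measurable f) :
    ∫⁻ x, f (a + x) ∂(stdGauss ι)
      = ∫⁻ x, ENNReal.ofReal (Real.exp (∑ i, a i * x i - (∑ i, a i ^ 2) / 2)) * f x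
          ∂(stdGauss ι) := by
  have := lintegral_pi_shift (fun _ : ι => gaussianReal 0 1) (T := fun i x => a i + x)
    (fun i => by fun_prop) (d := fun i x => ENNReal.ofReal (Real.exp (a i * x - a i ^ 2 / 2)))
    (fun i => by fun_prop) (fun i f hf => lintegral_gaussianReal_shift (a i) f hf) f hf
  refine this.trans (lintegral_congr fun x => ?_)
  rw [← ENNReal.ofReal_prod_of_nonneg (fun i _ => (Real.exp_pos _).le), ← Real.exp_sum,
    Finset.sum_sub_distrib, Finset.sum_div]

/-- Second tensorization: the factors are now the rows, each already handled as a Gaussian vector.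
-/
theorem lintegral_noise_shift {p m : ℕ} (M : Matrix (Fin p) (Fin m) ℝ)
    (f : Matrix (Fin p) (Fin m) ℝ → ℝ≥0∞) (hf : Measurable f) :
    ∫⁻ Z, f (M + Z) ∂(noise p m)
      = ∫⁻ Z, ENNReal.ofReal (Real.exp (∑ i, ∑ j, M i j * Z i j - (∑ i, ∑ j, M i j ^ 2) / 2))
          * f Z ∂(noise p m) := by
  have := lintegral_pi_shift (fun _ : Fin p => stdGauss (Fin m)) (T := fun i x => M i + x)
    (fun i => by fun_prop)
    (d := fun i x =>
      ENNReal.ofReal (Real.exp (∑ j, M i j * x j - (∑ j, M i j ^ 2) / 2)))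
    (fun i => by fun_prop) (fun i f hf => lintegral_stdGauss_shift (M i) f hf) f hf
  refine this.trans (lintegral_congr fun x => ?_)
  rw [← ENNReal.ofReal_prod_of_nonneg (fun i _ => (Real.exp_pos _).le), ← Real.exp_sum,
    Finset.sum_sub_distrib, Finset.sum_div]

/-- Jensen's inequality for the exponential, as a lower bound for a Lebesgue integral. -/
theorem ofReal_exp_integral_le {Ω : Type*} [MeasurableSpace Ω] (μ : Measure Ω)
    [IsProbabilityMeasure μ] {f : Ω → ℝ} (hf : Integrable f μ) :
    ENNReal.ofReal (Real.exp (∫ ω, f ω ∂μ)) ≤ ∫⁻ ω, ENNReal.ofReal (Real.exp (f ω)) ∂μ := by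
  set c := ∫ ω, f ω ∂μ with hc
  -- The tangent line of exp at the mean c. It is integrable even where exp ∘ f need not be, so the
  -- inequality survives in [0, ∞].
  have hint : Integrable (fun ω => Real.exp c * (1 + (f ω - c))) μ :=
    (((integrable_const (1 : ℝ)).add (hf.sub (integrable_const c)))).const_mul _
  have hval : ∫ ω, Real.exp c * (1 + (f ω - c)) ∂μ = Real.exp c := by
    have h1 : ∫ ω, (1 + (f ω - c)) ∂μ = 1 := by
      have h2 : ∫ ω, (f ω - c) ∂μ = 0 := by
        rw [show (∫ ω, (f ω - c) ∂μ) = _ from integral_sub hf (integrable_const c)]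
        simp [hc]
      rw [show (∫ ω, (1 + (f ω - c)) ∂μ) = _ from
        integral_add (integrable_const (1 : ℝ)) (hf.sub (integrable_const c))]
      simp only [h2]
      simp
    rw [integral_const_mul, h1, mul_one]
  calc ENNReal.ofReal (Real.exp c)
      = ENNReal.ofReal (∫ ω, Real.exp c * (1 + (f ω - c)) ∂μ) := by rw [hval]
    _ ≤ ∫⁻ ω, ENNReal.ofReal (Real.exp c * (1 + (f ω - c))) ∂μ := by
        rw [integral_eq_lintegral_pos_part_sub_lintegral_neg_part hint]
        refine (ENNReal.ofReal_le_ofReal (sub_le_self _ ENNReal.toReal_nonneg)).trans ?_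
        exact ENNReal.ofReal_toReal_le
    _ ≤ _ := by
        refine lintegral_mono fun ω => ENNReal.ofReal_le_ofReal ?_
        have h := Real.add_one_le_exp (f ω - c)
        calc Real.exp c * (1 + (f ω - c)) ≤ Real.exp c * Real.exp (f ω - c) :=
              mul_le_mul_of_nonneg_left (by linarith) (Real.exp_pos c).le
          _ = Real.exp (f ω) := by rw [← Real.exp_add]; congr 1; ring

theorem memLp_stdGauss_eval {ι : Type*} [Fintype ι] (i : ι) :
    MemLp (fun x : ι → ℝ => x i) 2 (stdGauss ι) :=
  (memLp_id_gaussianReal 2).comp_measurePreserving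
    (measurePreserving_eval (fun _ : ι => gaussianReal 0 1) i)

theorem integrable_stdGauss_eval {ι : Type*} [Fintype ι] (i : ι) :
    Integrable (fun x : ι → ℝ => x i) (stdGauss ι) :=
  (memLp_stdGauss_eval i).integrable (by norm_num)

theorem integral_stdGauss_eval {ι : Type*} [Fintype ι] (i : ι) :
    ∫ x : ι → ℝ, x i ∂(stdGauss ι) = 0 := by
  have hp := measurePreserving_eval (fun _ : ι => gaussianReal 0 1) i
  have h := integral_map (μ := stdGauss ι) (φ := Function.eval i) (f := fun y : ℝ => y)
    hp.measurable.aemeasurable (by fun_prop)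
  rw [stdGauss, hp.map_eq, integral_id_gaussianReal] at h
  exact h.symm

theorem memLp_stdGauss_affine {ι : Type*} [Fintype ι] (c : ℝ) (w : ι → ℝ) :
    MemLp (fun x : ι → ℝ => c + ∑ i, w i * x i) 2 (stdGauss ι) :=
  (memLp_const c).add (memLp_finsetSum _ fun i _ => (memLp_stdGauss_eval i).const_mul (w i))

theorem integral_stdGauss_affine {ι : Type*} [Fintype ι] (c : ℝ) (w : ι → ℝ) :
    ∫ x : ι → ℝ, (c + ∑ i, w i * x i) ∂(stdGauss ι) = c := by
  have hl : Integrable (fun x : ι → ℝ => ∑ i, w i * x i) (stdGauss ι) :=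
    integrable_finsetSum _ fun i _ => (integrable_stdGauss_eval i).const_mul _
  rw [show (∫ x : ι → ℝ, (c + ∑ i, w i * x i) ∂(stdGauss ι)) = _ from
    integral_add (integrable_const c) hl,
    integral_finsetSum _ fun i _ => (integrable_stdGauss_eval i).const_mul _]
  simp [integral_const_mul, integral_stdGauss_eval]

theorem integral_stdGauss_affine_sq {ι : Type*} [Fintype ι] (c : ℝ) (w : ι → ℝ) :
    ∫ x : ι → ℝ, (c + ∑ i, w i * x i) ^ 2 ∂(stdGauss ι) = c ^ 2 + ∑ i, w i ^ 2 := by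
  have hm := memLp_stdGauss_affine c w
  have h1 := variance_eq_sub hm
  have h2 : Var[fun x : ι → ℝ => c + ∑ i, w i * x i; stdGauss ι] = ∑ i, w i ^ 2 := by
    rw [variance_const_add
      (Finset.measurable_sum _ fun i _ => by fun_prop).aestronglyMeasurable]
    have h3 := variance_sum_pi (μ := fun _ : ι => gaussianReal 0 1) (X := fun i x => w i * x)
      (fun i => (memLp_id_gaussianReal 2).const_mul (w i))
    have h4 : ∀ i, Var[fun x : ℝ => w i * x; gaussianReal 0 1] = w i ^ 2 := by
      intro i
      have h5 := variance_const_mul (w i) (fun x : ℝ => x) (gaussianReal 0 1)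
      have h6 := variance_fun_id_gaussianReal (μ := 0) (v := 1)
      rw [h6] at h5
      simpa using h5
    simp_rw [h4] at h3
    rw [← h3, stdGauss]
    congr 1
    ext x
    simp
  rw [h2, integral_stdGauss_affine] at h1
  simp only [Pi.pow_apply] at h1
  linarith

/-- Lower bound for exponential integrals by a Gaussian shift and Jensen's inequality. -/
theorem le_lintegral_exp_stdGauss {ι : Type*} [Fintype ι] (a : ι → ℝ) {f : (ι → ℝ) → ℝ}
    (hfm : Measurable f) (hf : Integrable (fun x => f (a + x)) (stdGauss ι)) :
    ENNReal.ofReal (Real.exp (∫ x, f (a + x) ∂(stdGauss ι) - (∑ i, a i ^ 2) / 2))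
      ≤ ∫⁻ x, ENNReal.ofReal (Real.exp (f x)) ∂(stdGauss ι) := by
  have hlin : Integrable (fun x : ι → ℝ => ∑ i, a i * x i) (stdGauss ι) :=
    integrable_finsetSum _ fun i _ => (integrable_stdGauss_eval i).const_mul _
  have hint : Integrable (fun x => f (a + x) - (∑ i, a i * x i) - (∑ i, a i ^ 2) / 2)
      (stdGauss ι) := (hf.sub hlin).sub (integrable_const _)
  have h := ofReal_exp_integral_le (stdGauss ι) hint
  have hval : ∫ x, (f (a + x) - (∑ i, a i * x i) - (∑ i, a i ^ 2) / 2) ∂(stdGauss ι)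
      = ∫ x, f (a + x) ∂(stdGauss ι) - (∑ i, a i ^ 2) / 2 := by
    have h0 : ∫ x : ι → ℝ, (∑ i, a i * x i) ∂(stdGauss ι) = 0 := by
      simpa using integral_stdGauss_affine 0 a
    have h1 : ∫ x, (f (a + x) - ∑ i, a i * x i) ∂(stdGauss ι) = ∫ x, f (a + x) ∂(stdGauss ι) := by
      rw [show (∫ x, (f (a + x) - ∑ i, a i * x i) ∂(stdGauss ι)) = _ from integral_sub hf hlin,
        h0, sub_zero]
    rw [show (∫ x, (f (a + x) - (∑ i, a i * x i) - (∑ i, a i ^ 2) / 2) ∂(stdGauss ι)) = _ from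
      integral_sub (hf.sub hlin) (integrable_const _)]
    simp only [h1]
    simp
  rw [hval] at h
  refine h.trans (le_of_eq ?_)
  -- The function is chosen so that the Cameron–Martin density cancels against it and leaves exp f.
  have hs := lintegral_stdGauss_shift a
    (fun x => ENNReal.ofReal (Real.exp (f x - (∑ i, a i * x i) + (∑ i, a i ^ 2) / 2)))
    (by fun_prop)
  have e1 : ∀ x : ι → ℝ, f (a + x) - (∑ i, a i * (a + x) i) + (∑ i, a i ^ 2) / 2
      = f (a + x) - (∑ i, a i * x i) - (∑ i, a i ^ 2) / 2 := by
    intro x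
    simp only [Pi.add_apply, mul_add, Finset.sum_add_distrib, ← pow_two]
    ring
  simp_rw [e1] at hs
  rw [hs]
  refine lintegral_congr fun x => ?_
  rw [← ENNReal.ofReal_mul (Real.exp_pos _).le, ← Real.exp_add]
  congr 2
  ring

/-! ### Gaussian smoothing of bilinear forms -/

theorem measurable_matrix_entry {p m : ℕ} (a : Fin p) (b : Fin m) :
    Measurable fun Z : Matrix (Fin p) (Fin m) ℝ => Z a b :=
  (measurable_pi_apply b).comp (measurable_pi_apply (X := fun _ : Fin p => Fin m → ℝ) a)

theorem integrable_stdGauss_quadratic {ι κ : Type*} [Fintype ι] (s : Finset κ) (α β c : κ → ℝ)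
    (w : κ → ι → ℝ) :
    Integrable (fun x : ι → ℝ => ∑ k ∈ s, (α k * (c k + ∑ i, w k i * x i)
      - β k * (c k + ∑ i, w k i * x i) ^ 2)) (stdGauss ι) :=
  integrable_finsetSum _ fun k _ =>
    (((memLp_stdGauss_affine (c k) (w k)).integrable (by norm_num)).const_mul _).sub
      ((memLp_stdGauss_affine (c k) (w k)).integrable_sq.const_mul _)

/-- With one of the two Gaussian factors frozen, the compensated bilinear exponent has this shape in
the other; the sum of squared weights is the variance of the affine form. -/
theorem integral_stdGauss_quadratic {ι κ : Type*} [Fintype ι] (s : Finset κ) (α β c : κ → ℝ)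
    (w : κ → ι → ℝ) :
    ∫ x : ι → ℝ, ∑ k ∈ s, (α k * (c k + ∑ i, w k i * x i)
      - β k * (c k + ∑ i, w k i * x i) ^ 2) ∂(stdGauss ι)
      = ∑ k ∈ s, (α k * c k - β k * (c k ^ 2 + ∑ i, w k i ^ 2)) := by
  have h1 : ∀ k, Integrable (fun x : ι → ℝ => α k * (c k + ∑ i, w k i * x i)) (stdGauss ι) :=
    fun k => ((memLp_stdGauss_affine (c k) (w k)).integrable (by norm_num)).const_mul _
  have h2 : ∀ k, Integrable (fun x : ι → ℝ => β k * (c k + ∑ i, w k i * x i) ^ 2)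
      (stdGauss ι) :=
    fun k => (memLp_stdGauss_affine (c k) (w k)).integrable_sq.const_mul _
  rw [show (∫ x : ι → ℝ, ∑ k ∈ s, (α k * (c k + ∑ i, w k i * x i)
      - β k * (c k + ∑ i, w k i * x i) ^ 2) ∂(stdGauss ι)) = _ from
    integral_finsetSum _ fun k _ => (h1 k).sub (h2 k)]
  refine Finset.sum_congr rfl fun k _ => ?_
  rw [show (∫ x : ι → ℝ, (α k * (c k + ∑ i, w k i * x i)
      - β k * (c k + ∑ i, w k i * x i) ^ 2) ∂(stdGauss ι)) = _ from integral_sub (h1 k) (h2 k),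
    integral_const_mul, integral_const_mul, integral_stdGauss_affine,
    integral_stdGauss_affine_sq]

/-- The entry `(a, b)` of the matrix `∑ l, g l ⊗ h l`. -/
def crossEntry {j p m : ℕ} (g : Fin j × Fin p → ℝ) (h : Fin j × Fin m → ℝ)
    (x : Fin p × Fin m) : ℝ :=
  ∑ l, g (l, x.1) * h (l, x.2)

@[fun_prop]
theorem measurable_crossEntry {j p m : ℕ} (x : Fin p × Fin m) :
    Measurable fun y : (Fin j × Fin p → ℝ) × (Fin j × Fin m → ℝ) => crossEntry y.1 y.2 x := by
  unfold crossEntry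
  fun_prop

/-- The compensated bilinear form `t ⟨Z, g ⊗ h⟩ - t² ‖g ⊗ h‖² / 2` on the block `s`. -/
def smoothExponent {j p m : ℕ} (s : Finset (Fin p × Fin m)) (t : ℝ)
    (Z : Matrix (Fin p) (Fin m) ℝ) (g : Fin j × Fin p → ℝ) (h : Fin j × Fin m → ℝ) : ℝ :=
  ∑ x ∈ s, (t * Z x.1 x.2 * crossEntry g h x - t ^ 2 / 2 * crossEntry g h x ^ 2)

theorem measurable_smoothExponent {j p m : ℕ} (s : Finset (Fin p × Fin m)) (t : ℝ) :
    Measurable fun y : (Matrix (Fin p) (Fin m) ℝ × (Fin j × Fin p → ℝ)) × (Fin j × Fin m → ℝ) =>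
      smoothExponent s t y.1.1 y.1.2 y.2 := by
  unfold smoothExponent
  refine Finset.measurable_sum _ fun x _ => ?_
  have h1 : Measurable fun y : (Matrix (Fin p) (Fin m) ℝ × (Fin j × Fin p → ℝ)) ×
      (Fin j × Fin m → ℝ) => crossEntry y.1.2 y.2 x :=
    (measurable_crossEntry x).comp (by fun_prop : Measurable fun y : (Matrix (Fin p) (Fin m) ℝ ×
      (Fin j × Fin p → ℝ)) × (Fin j × Fin m → ℝ) => (y.1.2, y.2))
  have h2 : Measurable fun y : (Matrix (Fin p) (Fin m) ℝ × (Fin j × Fin p → ℝ)) ×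
      (Fin j × Fin m → ℝ) => y.1.1 x.1 x.2 :=
    (measurable_matrix_entry x.1 x.2).comp (measurable_fst.comp measurable_fst)
  fun_prop

/-- The exponential of the compensated form averaged over Gaussian `g` and `h`. -/
def smoothWeight {p m : ℕ} (j : ℕ) (s : Finset (Fin p × Fin m)) (t : ℝ)
    (Z : Matrix (Fin p) (Fin m) ℝ) : ℝ≥0∞ :=
  ∫⁻ g, ∫⁻ h, ENNReal.ofReal (Real.exp (smoothExponent s t Z g h))
    ∂(stdGauss (Fin j × Fin m)) ∂(stdGauss (Fin j × Fin p))

theorem measurable_smoothWeight {p m : ℕ} (j : ℕ) (s : Finset (Fin p × Fin m)) (t : ℝ) :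
    Measurable (smoothWeight j s t) := by
  have h := (measurable_smoothExponent (j := j) s t).exp.ennreal_ofReal
  exact (h.lintegral_prod_right' (ν := stdGauss (Fin j × Fin m))).lintegral_prod_right'

/-- This is the total mass of the noise measure translated by c on `s`. -/
theorem lintegral_exp_compensated {p m : ℕ} (s : Finset (Fin p × Fin m))
    (c : Fin p × Fin m → ℝ) :
    ∫⁻ Z, ENNReal.ofReal (Real.exp (∑ x ∈ s, (c x * Z x.1 x.2 - c x ^ 2 / 2))) ∂(noise p m)
      = 1 := by
  have h := lintegral_noise_shift (Matrix.of fun a b => if (a, b) ∈ s then c (a, b) else 0)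
    (fun _ => 1) measurable_const
  simp only [lintegral_const, measure_univ, mul_one] at h
  rw [h]
  refine lintegral_congr fun Z => ?_
  congr 2
  rw [← Fintype.sum_prod_type', ← Fintype.sum_prod_type', Finset.sum_div,
    ← Finset.sum_sub_distrib]
  rw [← Finset.sum_subset (Finset.subset_univ s)]
  · exact Finset.sum_congr rfl fun x hx => by simp [hx]
  · intro x _ hx
    simp [hx]

/-- By Tonelli: for fixed g and h the compensated exponential is a likelihood ratio, so the weight
is a mixture of likelihood ratios. -/
theorem lintegral_smoothWeight {p m : ℕ} (j : ℕ) (s : Finset (Fin p × Fin m)) (t : ℝ) :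
    ∫⁻ Z, smoothWeight j s t Z ∂(noise p m) = 1 := by
  have hm := (measurable_smoothExponent (j := j) s t).exp.ennreal_ofReal
  unfold smoothWeight
  rw [lintegral_lintegral_swap
    (hm.lintegral_prod_right' (ν := stdGauss (Fin j × Fin m))).aemeasurable]
  have : ∀ g : Fin j × Fin p → ℝ, ∫⁻ Z, ∫⁻ h, ENNReal.ofReal (Real.exp (smoothExponent s t Z g h))
      ∂(stdGauss (Fin j × Fin m)) ∂(noise p m) = 1 := by
    intro g
    rw [lintegral_lintegral_swap]
    · have : ∀ h : Fin j × Fin m → ℝ, ∫⁻ Z, ENNReal.ofReal (Real.exp (smoothExponent s t Z g h))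
          ∂(noise p m) = 1 := by
        intro h
        rw [← lintegral_exp_compensated s fun x => t * crossEntry g h x]
        refine lintegral_congr fun Z => ?_
        congr 2
        refine Finset.sum_congr rfl fun x _ => ?_
        ring
      simp [this]
    · exact (hm.comp (by fun_prop : Measurable fun y : Matrix (Fin p) (Fin m) ℝ ×
        (Fin j × Fin m → ℝ) => ((y.1, g), y.2))).aemeasurable
  simp [this]

/-- Puts the shifted entry in the form constant plus linear form in h that the quadratic integral
expects. -/
theorem crossEntry_add_right {j p m : ℕ} (g : Fin j × Fin p → ℝ) (q h : Fin j × Fin m → ℝ)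
    (x : Fin p × Fin m) :
    crossEntry g (q + h) x
      = crossEntry g q x + ∑ i, (if i.2 = x.2 then g (i.1, x.1) else 0) * h i := by
  simp only [crossEntry, Pi.add_apply, mul_add, Finset.sum_add_distrib, Fintype.sum_prod_type]
  simp

theorem crossEntry_add_left {j p m : ℕ} (u g : Fin j × Fin p → ℝ) (q : Fin j × Fin m → ℝ)
    (x : Fin p × Fin m) :
    crossEntry (u + g) q x
      = crossEntry u q x + ∑ i, (if i.2 = x.1 then q (i.1, x.2) else 0) * g i := by
  simp only [crossEntry, Pi.add_apply, add_mul, Finset.sum_add_distrib, Fintype.sum_prod_type]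
  simp [mul_comm]

theorem sum_ite_snd_sq {j n : ℕ} (b : Fin n) (f : Fin j → ℝ) :
    ∑ i : Fin j × Fin n, (if i.2 = b then f i.1 else 0) ^ 2 = ∑ l, f l ^ 2 := by
  simp [Fintype.sum_prod_type, ite_pow]

/-- Lower bound for the smoothed weight by shifting the two Gaussian factors. -/
theorem le_smoothWeight {p m j : ℕ} (s : Finset (Fin p × Fin m)) (t : ℝ)
    (Z : Matrix (Fin p) (Fin m) ℝ) (u : Fin j × Fin p → ℝ) (q : Fin j × Fin m → ℝ) :
    ENNReal.ofReal (Real.exp (∑ x ∈ s, (t * Z x.1 x.2 * crossEntry u q x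
        - t ^ 2 / 2 * (crossEntry u q x ^ 2 + ∑ l, q (l, x.2) ^ 2
          + ∑ l, (u (l, x.1) ^ 2 + 1))) - (∑ i, u i ^ 2) / 2 - (∑ i, q i ^ 2) / 2))
      ≤ smoothWeight j s t Z := by
  have hm := measurable_smoothExponent (j := j) s t
  -- First shift, in h by q with g frozen. The variance of the entry at x produces the penalty ∑
  -- g(l, x.1)².
  have inner : ∀ g : Fin j × Fin p → ℝ,
      ENNReal.ofReal (Real.exp (∑ x ∈ s, (t * Z x.1 x.2 * crossEntry g q x
        - t ^ 2 / 2 * (crossEntry g q x ^ 2 + ∑ l, g (l, x.1) ^ 2)) - (∑ i, q i ^ 2) / 2))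
      ≤ ∫⁻ h, ENNReal.ofReal (Real.exp (smoothExponent s t Z g h))
        ∂(stdGauss (Fin j × Fin m)) := by
    intro g
    have e : ∀ h, smoothExponent s t Z g (q + h) = ∑ x ∈ s, (t * Z x.1 x.2 *
        (crossEntry g q x + ∑ i, (if i.2 = x.2 then g (i.1, x.1) else 0) * h i)
        - t ^ 2 / 2 *
          (crossEntry g q x + ∑ i, (if i.2 = x.2 then g (i.1, x.1) else 0) * h i) ^ 2) := by
      intro h
      simp only [smoothExponent, crossEntry_add_right]
    have hint := integrable_stdGauss_quadratic s (fun x : Fin p × Fin m => t * Z x.1 x.2)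
      (fun _ => t ^ 2 / 2) (fun x => crossEntry g q x)
      (fun x (i : Fin j × Fin m) => if i.2 = x.2 then g (i.1, x.1) else 0)
    have hval := integral_stdGauss_quadratic s (fun x : Fin p × Fin m => t * Z x.1 x.2)
      (fun _ => t ^ 2 / 2) (fun x => crossEntry g q x)
      (fun x (i : Fin j × Fin m) => if i.2 = x.2 then g (i.1, x.1) else 0)
    simp_rw [← e] at hint hval
    have h := le_lintegral_exp_stdGauss q (f := smoothExponent s t Z g)
      (hm.comp (by fun_prop : Measurable fun y : Fin j × Fin m → ℝ => ((Z, g), y))) hint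
    rw [hval] at h
    have hs : ∀ x : Fin p × Fin m, ∑ i : Fin j × Fin m,
        (if i.2 = x.2 then g (i.1, x.1) else 0) ^ 2 = ∑ l, g (l, x.1) ^ 2 :=
      fun x => sum_ite_snd_sq x.2 fun l => g (l, x.1)
    simpa only [hs] using h
  refine le_trans ?_ (lintegral_mono inner)
  set f : (Fin j × Fin p → ℝ) → ℝ := fun g => ∑ x ∈ s, (t * Z x.1 x.2 * crossEntry g q x
        - t ^ 2 / 2 * (crossEntry g q x ^ 2 + ∑ l, g (l, x.1) ^ 2)) - (∑ i, q i ^ 2) / 2 with hf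
  have hfm : Measurable f := by
    have : ∀ x : Fin p × Fin m, Measurable fun g : Fin j × Fin p → ℝ => crossEntry g q x := by
      intro x
      unfold crossEntry
      fun_prop
    fun_prop
  -- The penalty left by the first shift is rewritten as affine forms without linear term, each a
  -- single coordinate of u + g. Their unit variance is the source of the +1 in the statement.
  have e : ∀ g, f (u + g) = ∑ x ∈ s, (t * Z x.1 x.2 *
        (crossEntry u q x + ∑ i, (if i.2 = x.1 then q (i.1, x.2) else 0) * g i)
        - t ^ 2 / 2 *
          (crossEntry u q x + ∑ i, (if i.2 = x.1 then q (i.1, x.2) else 0) * g i) ^ 2)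
        + ∑ y ∈ s ×ˢ (Finset.univ : Finset (Fin j)), (0 * (u (y.2, y.1.1)
            + ∑ i, (if i = (y.2, y.1.1) then 1 else 0) * g i) - t ^ 2 / 2 * (u (y.2, y.1.1)
            + ∑ i, (if i = (y.2, y.1.1) then 1 else 0) * g i) ^ 2) - (∑ i, q i ^ 2) / 2 := by
    intro g
    simp only [hf, crossEntry_add_left]
    rw [Finset.sum_product, ← Finset.sum_add_distrib]
    congr 1
    refine Finset.sum_congr rfl fun x _ => ?_
    simp only [Pi.add_apply, zero_mul, zero_sub, ite_mul, one_mul, Finset.sum_ite_eq',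
      Finset.mem_univ, if_true, Finset.sum_neg_distrib, ← Finset.mul_sum]
    ring
  have hi1 := integrable_stdGauss_quadratic s (fun x : Fin p × Fin m => t * Z x.1 x.2)
    (fun _ => t ^ 2 / 2) (fun x => crossEntry u q x)
    (fun x (i : Fin j × Fin p) => if i.2 = x.1 then q (i.1, x.2) else 0)
  have hv1 := integral_stdGauss_quadratic s (fun x : Fin p × Fin m => t * Z x.1 x.2)
    (fun _ => t ^ 2 / 2) (fun x => crossEntry u q x)
    (fun x (i : Fin j × Fin p) => if i.2 = x.1 then q (i.1, x.2) else 0)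
  have hi2 := integrable_stdGauss_quadratic (s ×ˢ (Finset.univ : Finset (Fin j))) (fun _ => 0)
    (fun _ => t ^ 2 / 2) (fun y => u (y.2, y.1.1))
    (fun y (i : Fin j × Fin p) => if i = (y.2, y.1.1) then 1 else 0)
  have hv2 := integral_stdGauss_quadratic (s ×ˢ (Finset.univ : Finset (Fin j))) (fun _ => 0)
    (fun _ => t ^ 2 / 2) (fun y => u (y.2, y.1.1))
    (fun y (i : Fin j × Fin p) => if i = (y.2, y.1.1) then 1 else 0)
  have hint : Integrable (fun g => f (u + g)) (stdGauss (Fin j × Fin p)) := by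
    simp_rw [e]
    exact (hi1.add hi2).sub (integrable_const _)
  have hval : ∫ g, f (u + g) ∂(stdGauss (Fin j × Fin p))
      = ∑ x ∈ s, (t * Z x.1 x.2 * crossEntry u q x
        - t ^ 2 / 2 * (crossEntry u q x ^ 2 + ∑ l, q (l, x.2) ^ 2
          + ∑ l, (u (l, x.1) ^ 2 + 1))) - (∑ i, q i ^ 2) / 2 := by
    simp_rw [e]
    rw [show ∀ A B : (Fin j × Fin p → ℝ) → ℝ, ∀ c : ℝ, Integrable A (stdGauss (Fin j × Fin p)) →
        Integrable B (stdGauss (Fin j × Fin p)) →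
        ∫ g, (A g + B g - c) ∂(stdGauss (Fin j × Fin p))
          = ∫ g, A g ∂(stdGauss (Fin j × Fin p)) + ∫ g, B g ∂(stdGauss (Fin j × Fin p)) - c from ?_]
    · rw [hv1, hv2, Finset.sum_product, ← Finset.sum_add_distrib]
      congr 1
      refine Finset.sum_congr rfl fun x _ => ?_
      rw [sum_ite_snd_sq x.1 fun l => q (l, x.2)]
      simp only [zero_mul, zero_sub, ite_pow, one_pow, ne_eq, OfNat.ofNat_ne_zero,
        not_false_eq_true, zero_pow, Finset.sum_ite_eq', Finset.mem_univ, if_true,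
        Finset.sum_neg_distrib, ← Finset.mul_sum]
      ring
    · exact hi1
    · exact hi2
    · intro A B c hA hB
      rw [show (∫ g, (A g + B g - c) ∂(stdGauss (Fin j × Fin p))) = _ from
        integral_sub (hA.add hB) (integrable_const _),
        show (∫ g, (A g + B g) ∂(stdGauss (Fin j × Fin p))) = _ from integral_add hA hB]
      simp
  have h := le_lintegral_exp_stdGauss u hfm hint
  rw [hval] at h
  refine le_trans (le_of_eq ?_) h
  congr 2
  ring

/-! ### Orthonormal families and the singular value decomposition -/

/-- A family of vectors in `ℝ^n` which is orthonormal for the dot product. -/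
def OrthonormalRows {d n : ℕ} (u : Fin d → Fin n → ℝ) : Prop :=
  ∀ i j, ∑ a, u i a * u j a = if i = j then 1 else 0

/-- The matrix `∑ i, x i u i (v i)ᵀ`. -/
def dyadSum {d p m : ℕ} (x : Fin d → ℝ) (u : Fin d → Fin p → ℝ) (v : Fin d → Fin m → ℝ) :
    Matrix (Fin p) (Fin m) ℝ :=
  Matrix.of fun a b => ∑ i, x i * u i a * v i b

/-- Extension of a vector by zeros. -/
def pad {d n : ℕ} (x : Fin d → ℝ) (i : Fin n) : ℝ :=
  if h : i.val < d then x ⟨i.val, h⟩ else 0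

theorem orthonormal_toLp_iff {ι : Type*} {n : ℕ} [DecidableEq ι] (u : ι → Fin n → ℝ) :
    Orthonormal ℝ (fun i => WithLp.toLp 2 (u i)) ↔
      ∀ i j, ∑ a, u i a * u j a = if i = j then 1 else 0 := by
  rw [orthonormal_iff_ite]
  refine forall_congr' fun i => forall_congr' fun j => ?_
  rw [EuclideanSpace.inner_toLp_toLp]
  simp [dotProduct, mul_comm]

/-- Orthonormal vectors are independent, and they stay so after restriction to a set of coordinates
carrying all of them. -/
theorem OrthonormalRows.card_le_of_support {d n : ℕ} {u : Fin d → Fin n → ℝ}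
    (hu : OrthonormalRows u) (F : Finset (Fin n)) (hF : ∀ i a, u i a ≠ 0 → a ∈ F) :
    d ≤ F.card := by
  have h := (orthonormal_toLp_iff u).2 hu
  have h2 := h.linearIndependent
  have h3 : LinearIndependent ℝ fun i (a : F) => u i a := by
    rw [Fintype.linearIndependent_iff] at h2 ⊢
    intro g hg
    refine h2 g ?_
    ext a
    by_cases ha : a ∈ F
    · have := congrFun hg ⟨a, ha⟩
      simpa [Finset.sum_apply] using this
    · have h0 : ∀ i, u i a = 0 := fun i => by_contra fun h => ha (hF i a h)
      simp [h0]
  simpa using h3.fintype_card_le_finrank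

theorem OrthonormalRows.le {d n : ℕ} {u : Fin d → Fin n → ℝ} (hu : OrthonormalRows u) :
    d ≤ n := by
  simpa using hu.card_le_of_support Finset.univ (by simp)

/-- Completion to an orthonormal basis. The zero vectors at indices ≥ d are placeholders which the
extension does not look at. -/
theorem OrthonormalRows.exists_orthogonal {d n : ℕ} {u : Fin d → Fin n → ℝ}
    (hu : OrthonormalRows u) :
    ∃ U ∈ Matrix.orthogonalGroup (Fin n) ℝ, ∀ i a, U a (Fin.castLE hu.le i) = u i a := by
  classical
  set w : Fin n → EuclideanSpace ℝ (Fin n) := fun i => WithLp.toLp 2 fun a =>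
    if h : i.val < d then u ⟨i.val, h⟩ a else 0 with hw
  set s : Set (Fin n) := {i | i.val < d} with hs
  have ho : Orthonormal ℝ (s.domRestrict w) := by
    have := (orthonormal_toLp_iff (fun (i : s) a => u ⟨i.1.val, i.2⟩ a)).2 (by
      rintro ⟨i, hi⟩ ⟨j, hj⟩
      have := hu ⟨i.val, hi⟩ ⟨j.val, hj⟩
      simpa [Fin.ext_iff] using this)
    convert this using 1
    ext i a
    have hi : i.1.val < d := i.2
    simp [hw, hi]
  obtain ⟨b, hb⟩ := ho.exists_orthonormalBasis_extension_of_card_eq (by simp)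
  refine ⟨Matrix.of fun a i => b i a, ?_, ?_⟩
  · rw [Matrix.mem_orthogonalGroup_iff']
    ext i j
    have := (orthonormal_toLp_iff (fun i a => b i a)).1 b.orthonormal i j
    simpa [Matrix.mul_apply, Matrix.one_apply, Matrix.star_apply] using this
  · intro i a
    have := hb (Fin.castLE hu.le i) (by simp [hs])
    simp [this, hw]

theorem sum_fin_pad {d n : ℕ} (h : d ≤ n) (f : Fin n → ℝ) (hf : ∀ i : Fin n, d ≤ i.val → f i = 0) :
    ∑ i, f i = ∑ i : Fin d, f (Fin.castLE h i) := by
  symm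
  refine Finset.sum_of_injOn (Fin.castLE h) ((Fin.castLE_injective h).injOn) (by simp) ?_ (by simp)
  intro i _ hi
  refine hf i ?_
  by_contra hlt
  exact hi ⟨⟨i.val, by omega⟩, by simp, by ext; simp⟩

theorem mul_rectDiag_mul_apply {d p m : ℕ} (hp : d ≤ p) (hm : d ≤ m) (x : Fin d → ℝ)
    (U : Matrix (Fin p) (Fin p) ℝ) (V : Matrix (Fin m) (Fin m) ℝ) :
    U * (rectDiag (pad x) : Matrix (Fin p) (Fin m) ℝ) * V
      = dyadSum x (fun i a => U a (Fin.castLE hp i)) (fun i b => V (Fin.castLE hm i) b) := by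
  ext a b
  have h1 : ∀ c : Fin m, (U * (rectDiag (pad x) : Matrix (Fin p) (Fin m) ℝ)) a c
      = if h : c.val < d then U a (Fin.castLE hp ⟨c.val, h⟩) * x ⟨c.val, h⟩ else 0 := by
    intro c
    rw [Matrix.mul_apply]
    split_ifs with h
    · rw [Finset.sum_eq_single (Fin.castLE hp ⟨c.val, h⟩)]
      · simp [rectDiag, pad, h]
      · intro e _ he
        have : e.val ≠ c.val := fun h' => he (by ext; simp [h'])
        simp [rectDiag, this]
      · simp
    · refine Finset.sum_eq_zero fun e _ => ?_
      by_cases he : e.val = c.val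
      · simp [rectDiag, pad, he, h]
      · simp [rectDiag, he]
  rw [Matrix.mul_apply, sum_fin_pad hm]
  · simp only [h1, dyadSum, Matrix.of_apply]
    refine Finset.sum_congr rfl fun i _ => ?_
    simp only [Fin.val_castLE, Fin.is_lt, dite_true, Fin.eta]
    ring
  · intro i hi
    rw [h1, dif_neg (by omega), zero_mul]

theorem transpose_mem_orthogonalGroup {n : ℕ} {U : Matrix (Fin n) (Fin n) ℝ}
    (hU : U ∈ Matrix.orthogonalGroup (Fin n) ℝ) :
    U.transpose ∈ Matrix.orthogonalGroup (Fin n) ℝ := by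
  rw [Matrix.mem_orthogonalGroup_iff'] at hU
  rw [Matrix.mem_orthogonalGroup_iff]
  simpa [Matrix.star_eq_conjTranspose, Matrix.conjTranspose] using hU

/-- A sum of dyads over orthonormal families is an orthogonal conjugate of a diagonal matrix. -/
theorem dyadSum_eq_mul {d p m : ℕ} {u : Fin d → Fin p → ℝ} {v : Fin d → Fin m → ℝ}
    (hu : OrthonormalRows u) (hv : OrthonormalRows v) :
    ∃ U ∈ Matrix.orthogonalGroup (Fin p) ℝ, ∃ V ∈ Matrix.orthogonalGroup (Fin m) ℝ,
      ∀ x : Fin d → ℝ, dyadSum x u v = U * (rectDiag (pad x) : Matrix (Fin p) (Fin m) ℝ) * V := by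
  obtain ⟨U, hU, hU'⟩ := hu.exists_orthogonal
  obtain ⟨V, hV, hV'⟩ := hv.exists_orthogonal
  refine ⟨U, hU, V.transpose, transpose_mem_orthogonalGroup hV, fun x => ?_⟩
  rw [mul_rectDiag_mul_apply hu.le hv.le]
  simp [hU', hV']

/-- The singular value decomposition of a matrix supported on a block. -/
theorem exists_svd {p m : ℕ} (A : Matrix (Fin p) (Fin m) ℝ) (F : Finset (Fin p))
    (G : Finset (Fin m)) (hA : ∀ a b, A a b ≠ 0 → a ∈ F ∧ b ∈ G) :
    ∃ (d : ℕ) (x : Fin d → ℝ) (u : Fin d → Fin p → ℝ) (v : Fin d → Fin m → ℝ),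
      d ≤ min F.card G.card ∧ (∀ i, 0 < x i) ∧ OrthonormalRows u ∧ OrthonormalRows v ∧
      (∀ i a, u i a ≠ 0 → a ∈ F) ∧ (∀ i b, v i b ≠ 0 → b ∈ G) ∧ A = dyadSum x u v := by
  classical
  have hH : (A.transpose * A).IsHermitian := by
    ext i j
    simp [Matrix.mul_apply, mul_comm]
  -- Right singular vectors are eigenvectors of AᵀA with nonzero eigenvalue; left ones are their
  -- normalized images under A.
  set w : Fin m → Fin m → ℝ := fun j b => hH.eigenvectorBasis j b with hw
  set lam := hH.eigenvalues with hlam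
  have hon : ∀ i j, ∑ b, w i b * w j b = if i = j then 1 else 0 :=
    (orthonormal_toLp_iff w).1 hH.eigenvectorBasis.orthonormal
  have heig : ∀ j, (A.transpose * A).mulVec (w j) = lam j • w j := fun j =>
    hH.mulVec_eigenvectorBasis j
  have hin : ∀ i j, ∑ a, (A.mulVec (w i)) a * (A.mulVec (w j)) a
      = if i = j then lam j else 0 := by
    intro i j
    have h1 : ∑ a, (A.mulVec (w i)) a * (A.mulVec (w j)) a
        = w i ⬝ᵥ ((A.transpose * A).mulVec (w j)) := by
      rw [← Matrix.mulVec_mulVec, Matrix.dotProduct_mulVec, Matrix.vecMul_transpose]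
      rfl
    rw [h1, heig, dotProduct_smul]
    have := hon i j
    simp only [dotProduct, this]
    split_ifs <;> simp
  have hlam0 : ∀ j, 0 ≤ lam j := by
    intro j
    have := hin j j
    rw [if_pos rfl] at this
    rw [← this]
    exact Finset.sum_nonneg fun a _ => mul_self_nonneg _
  set J : Finset (Fin m) := Finset.univ.filter fun j => lam j ≠ 0 with hJ
  let e : Fin J.card ≃ J := J.equivFin.symm
  have hpos : ∀ i, 0 < lam (e i) := fun i =>
    lt_of_le_of_ne (hlam0 _) (Ne.symm (Finset.mem_filter.1 (e i).2).2)
  have hsp : ∀ i, 0 < √(lam (e i)) := fun i => Real.sqrt_pos.2 (hpos i)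
  have heq : ∀ i j, ((e i : Fin m) = e j) ↔ i = j := fun i j => by
    rw [← Subtype.ext_iff, e.injective.eq_iff]
  have hu : OrthonormalRows fun i a => (√(lam (e i)))⁻¹ * (A.mulVec (w (e i))) a := by
    intro i j
    have : ∀ a, (√(lam (e i)))⁻¹ * (A.mulVec (w (e i))) a
        * ((√(lam (e j)))⁻¹ * (A.mulVec (w (e j))) a)
        = (√(lam (e i)))⁻¹ * (√(lam (e j)))⁻¹ * ((A.mulVec (w (e i))) a
          * (A.mulVec (w (e j))) a) := fun a => by ring
    simp_rw [this]
    rw [← Finset.mul_sum, hin]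
    simp only [heq]
    split_ifs with h
    · subst h
      rw [← mul_inv, Real.mul_self_sqrt (hpos i).le, inv_mul_cancel₀ (hpos i).ne']
    · simp
  have hv : OrthonormalRows fun i b => w (e i) b := by
    intro i j
    rw [hon]
    simp only [heq]
  have hdec : A = dyadSum (fun i => √(lam (e i)))
      (fun i a => (√(lam (e i)))⁻¹ * (A.mulVec (w (e i))) a) (fun i b => w (e i) b) := by
    have hcomp : ∀ b c, ∑ j, w j b * w j c = if b = c then 1 else 0 := by
      have h1 : (Matrix.of w) * (Matrix.of w).transpose = 1 := by
        ext i j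
        simpa [Matrix.mul_apply, Matrix.one_apply] using hon i j
      have h2 := mul_eq_one_comm.1 h1
      intro b c
      have := congrFun (congrFun h2 b) c
      simpa [Matrix.mul_apply, Matrix.one_apply] using this
    ext a b
    have h3 : A a b = ∑ j, (A.mulVec (w j)) a * w j b := by
      simp only [Matrix.mulVec, dotProduct, Finset.sum_mul]
      rw [Finset.sum_comm]
      simp_rw [mul_assoc, ← Finset.mul_sum, hcomp]
      simp
    rw [h3]
    simp only [dyadSum, Matrix.of_apply]
    have h4 : ∀ i, √(lam (e i)) * ((√(lam (e i)))⁻¹ * (A.mulVec (w (e i))) a) * w (e i) b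
        = (fun j : J => (A.mulVec (w j)) a * w j b) (e i) := fun i => by
      simp only
      rw [← mul_assoc, mul_inv_cancel₀ (hsp i).ne', one_mul]
    simp_rw [h4]
    rw [e.sum_comp (fun j : J => (A.mulVec (w j)) a * w j b),
      Finset.sum_coe_sort J (fun j => (A.mulVec (w j)) a * w j b)]
    symm
    refine Finset.sum_subset (Finset.subset_univ J) fun j _ hj => ?_
    have hz : lam j = 0 := by simpa [hJ] using hj
    have h5 := hin j j
    rw [if_pos rfl, hz, Finset.sum_eq_zero_iff_of_nonneg fun a _ => mul_self_nonneg _] at h5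
    have := h5 a (Finset.mem_univ a)
    rw [mul_self_eq_zero.1 this, zero_mul]
  have hsu : ∀ i a, (√(lam (e i)))⁻¹ * (A.mulVec (w (e i))) a ≠ 0 → a ∈ F := by
    intro i a h
    have h1 : ∑ b, A a b * w (e i) b ≠ 0 := right_ne_zero_of_mul h
    obtain ⟨b, -, hb⟩ := Finset.exists_ne_zero_of_sum_ne_zero h1
    exact (hA a b (left_ne_zero_of_mul hb)).1
  -- Where the eigenvalue is nonzero the eigenvector lies in the range of Aᵀ, hence is carried by G.
  have hsv : ∀ i b, w (e i) b ≠ 0 → b ∈ G := by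
    intro i b h
    have h1 := congrFun (heig (e i)) b
    have h2 : (A.transpose * A).mulVec (w (e i)) b ≠ 0 := by
      rw [h1]
      exact mul_ne_zero (hpos i).ne' h
    rw [← Matrix.mulVec_mulVec] at h2
    have h3 : ∑ a, A.transpose b a * (A.mulVec (w (e i))) a ≠ 0 := h2
    obtain ⟨a, -, ha⟩ := Finset.exists_ne_zero_of_sum_ne_zero h3
    exact (hA a b (left_ne_zero_of_mul ha)).2
  exact ⟨J.card, _, _, _, le_min (hu.card_le_of_support F hsu) (hv.card_le_of_support G hsv),
    hsp, hu, hv, hsu, hsv, hdec⟩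

/-- The dyads u_i ⊗ v_i are orthonormal for the Hilbert–Schmidt inner product. -/
theorem sum_sq_dyadSum {d p m : ℕ} (x y : Fin d → ℝ) {u : Fin d → Fin p → ℝ}
    {v : Fin d → Fin m → ℝ} (hu : OrthonormalRows u) (hv : OrthonormalRows v) :
    ∑ a, ∑ b, dyadSum x u v a b * dyadSum y u v a b = ∑ i, x i * y i := by
  simp only [dyadSum, Matrix.of_apply, Finset.sum_mul_sum]
  have : ∀ a b i j, x i * u i a * v i b * (y j * u j a * v j b)
      = x i * y j * ((u i a * u j a) * (v i b * v j b)) := fun a b i j => by ring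
  simp_rw [this]
  have h2 : ∑ a, ∑ b, ∑ i, ∑ j, x i * y j * ((u i a * u j a) * (v i b * v j b))
      = ∑ i, ∑ j, x i * y j * ((∑ a, u i a * u j a) * (∑ b, v i b * v j b)) := by
    simp_rw [Finset.sum_mul_sum, Finset.mul_sum]
    rw [Finset.sum_congr rfl fun a _ => Finset.sum_comm, Finset.sum_comm]
    refine Finset.sum_congr rfl fun i _ => ?_
    rw [Finset.sum_congr rfl fun a _ => Finset.sum_comm, Finset.sum_comm]
  rw [h2]
  simp [hu _ _, hv _ _]

/-! ### Symmetric gauges -/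

/-- The linear embedding of `ℝ^d` as the leading diagonal of `p × m` matrices. -/
def padDiag (d p m : ℕ) : (Fin d → ℝ) →ₗ[ℝ] Matrix (Fin p) (Fin m) ℝ where
  toFun x := rectDiag (pad x)
  map_add' x y := by
    ext i j
    simp only [rectDiag, pad, Matrix.of_apply, Matrix.add_apply, Pi.add_apply]
    split_ifs <;> simp
  map_smul' c x := by
    ext i j
    simp only [rectDiag, pad, Matrix.of_apply, Matrix.smul_apply, Pi.smul_apply, RingHom.id_apply]
    split_ifs <;> simp

/-- The restricted gauge as a seminorm on `ℝ^d`. -/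
def gaugeSeminorm {p m : ℕ} (N : Seminorm ℝ (Matrix (Fin p) (Fin m) ℝ)) (d : ℕ) :
    Seminorm ℝ (Fin d → ℝ) :=
  N.comp (padDiag d p m)

theorem gaugeSeminorm_pad {p m : ℕ} (N : Seminorm ℝ (Matrix (Fin p) (Fin m) ℝ)) {d r : ℕ}
    (h : d ≤ r) (x : Fin d → ℝ) :
    gaugeSeminorm N r (pad x) = gaugeSeminorm N d x := by
  change N (rectDiag (pad (pad x : Fin r → ℝ))) = N (rectDiag (pad x))
  congr 2
  ext i
  simp only [pad]
  split_ifs with h1 h2 <;> first | rfl | omega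

/-- The first `d` standard basis vectors of `ℝ^n`. -/
def stdRows (d n : ℕ) (i : Fin d) (a : Fin n) : ℝ := if i.val = a.val then 1 else 0

theorem orthonormalRows_stdRows {d n : ℕ} (h : d ≤ n) : OrthonormalRows (stdRows d n) := by
  intro i j
  rw [Finset.sum_eq_single (Fin.castLE h i)]
  · simp [stdRows, Fin.ext_iff, eq_comm]
  · intro b _ hb
    have : i.val ≠ b.val := fun h' => hb (by ext; simp [h'])
    simp [stdRows, this]
  · simp

theorem OrthonormalRows.comp_injective {d e n : ℕ} {u : Fin d → Fin n → ℝ} (hu : OrthonormalRows u)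
    {f : Fin e → Fin d} (hf : Function.Injective f) : OrthonormalRows fun i => u (f i) := by
  intro i j
  rw [hu]
  simp [hf.eq_iff]

theorem OrthonormalRows.sign_smul {d n : ℕ} {u : Fin d → Fin n → ℝ} (hu : OrthonormalRows u)
    {ε : Fin d → ℝ} (hε : ∀ i, ε i ^ 2 = 1) : OrthonormalRows fun i a => ε i * u i a := by
  intro i j
  have : ∀ a, ε i * u i a * (ε j * u j a) = ε i * ε j * (u i a * u j a) := fun a => by ring
  simp_rw [this, ← Finset.mul_sum, hu i j]
  split_ifs with h
  · subst h
    rw [← pow_two, hε, one_mul]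
  · simp

namespace IsUnitarilyInvariantNorm

variable {p m : ℕ} {N : Seminorm ℝ (Matrix (Fin p) (Fin m) ℝ)}

theorem apply_dyadSum (hN : IsUnitarilyInvariantNorm N) {d : ℕ} (x : Fin d → ℝ)
    {u : Fin d → Fin p → ℝ} {v : Fin d → Fin m → ℝ} (hu : OrthonormalRows u)
    (hv : OrthonormalRows v) : N (dyadSum x u v) = gaugeSeminorm N d x := by
  obtain ⟨U, hU, V, hV, h⟩ := dyadSum_eq_mul hu hv
  rw [h, hN.invariant U hU V hV]
  rfl

/-- Permuting both orthonormal families simultaneously leaves the matrix unchanged. -/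
theorem gauge_perm (hN : IsUnitarilyInvariantNorm N) {d : ℕ} (hp : d ≤ p) (hm : d ≤ m)
    (x : Fin d → ℝ) (e : Equiv.Perm (Fin d)) :
    gaugeSeminorm N d (fun i => x (e i)) = gaugeSeminorm N d x := by
  have h1 := orthonormalRows_stdRows hp
  have h2 := orthonormalRows_stdRows hm
  rw [← hN.apply_dyadSum _ h1 h2, ← hN.apply_dyadSum x (h1.comp_injective e.symm.injective)
    (h2.comp_injective e.symm.injective)]
  congr 1
  ext a b
  simp only [dyadSum, Matrix.of_apply]
  rw [← Equiv.sum_comp e fun i => x i * stdRows d p (e.symm i) a * stdRows d m (e.symm i) b]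
  simp

theorem gauge_sign (hN : IsUnitarilyInvariantNorm N) {d : ℕ} (hp : d ≤ p) (hm : d ≤ m)
    (x : Fin d → ℝ) {ε : Fin d → ℝ} (hε : ∀ i, ε i ^ 2 = 1) :
    gaugeSeminorm N d (fun i => ε i * x i) = gaugeSeminorm N d x := by
  have h1 := orthonormalRows_stdRows hp
  have h2 := orthonormalRows_stdRows hm
  rw [← hN.apply_dyadSum _ h1 h2, ← hN.apply_dyadSum x (h1.sign_smul hε) h2]
  congr 1
  ext a b
  simp only [dyadSum, Matrix.of_apply]
  exact Finset.sum_congr rfl fun i _ => by ring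

/-- The cube is the convex hull of the sign vectors, a convex function is dominated by its value at
some vertex, and all vertices have the same gauge. -/
theorem gauge_le_of_abs_le_one (hN : IsUnitarilyInvariantNorm N) {d : ℕ} (hp : d ≤ p) (hm : d ≤ m)
    {x : Fin d → ℝ} (hx : ∀ i, |x i| ≤ 1) :
    gaugeSeminorm N d x ≤ gaugeSeminorm N d fun _ => 1 := by
  have hmem : x ∈ convexHull ℝ (Set.univ.pi fun _ : Fin d => ({-1, 1} : Set ℝ)) := by
    rw [convexHull_pi]
    intro i _
    rw [convexHull_pair, segment_eq_Icc (by norm_num)]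
    exact abs_le.1 (hx i)
  obtain ⟨ε, hε, hle⟩ := (gaugeSeminorm N d).convexOn.exists_ge_of_mem_convexHull
    (Set.subset_univ _) hmem
  refine hle.trans (le_of_eq ?_)
  have hε' : ∀ i, ε i ^ 2 = 1 := by
    intro i
    rcases hε i trivial with h | h
    · rw [h]; norm_num
    · rw [Set.mem_singleton_iff.1 h]; norm_num
  simpa using hN.gauge_sign hp hm (fun _ => 1) hε'

theorem gauge_le_of_abs_le (hN : IsUnitarilyInvariantNorm N) {d r : ℕ} (hd : d ≤ r) (hp : r ≤ p)
    (hm : r ≤ m) {x : Fin d → ℝ} {c : ℝ} (hc : 0 < c) (hx : ∀ i, |x i| ≤ c) :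
    gaugeSeminorm N d x ≤ c * gaugeSeminorm N r fun _ => 1 := by
  rw [← gaugeSeminorm_pad N hd]
  have h1 : ∀ i, |(c⁻¹ • (pad x : Fin r → ℝ)) i| ≤ 1 := by
    intro i
    have : |(pad x : Fin r → ℝ) i| ≤ c := by
      simp only [pad]
      split_ifs
      · exact hx _
      · simpa using hc.le
    rw [Pi.smul_apply, smul_eq_mul, abs_mul, abs_of_pos (inv_pos.2 hc), inv_mul_le_iff₀ hc]
    simpa using this
  have h2 := hN.gauge_le_of_abs_le_one hp hm h1
  rw [map_smul_eq_mul, Real.norm_eq_abs, abs_of_pos (inv_pos.2 hc), inv_mul_le_iff₀ hc] at h2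
  exact h2

/-- The r cyclic shifts of the padded vector sum to (∑ x_i) times the all-one vector, and each has
the gauge of x. -/
theorem gauge_one_mul_sum_le (hN : IsUnitarilyInvariantNorm N) {d r : ℕ} (hd : d ≤ r) (hp : r ≤ p)
    (hm : r ≤ m) {x : Fin d → ℝ} (hx : ∀ i, 0 ≤ x i) :
    (gaugeSeminorm N r fun _ => 1) * ∑ i, x i ≤ r * gaugeSeminorm N d x := by
  rcases Nat.eq_zero_or_pos r with rfl | hr
  · obtain rfl : d = 0 := by omega
    simp
  have : NeZero r := ⟨hr.ne'⟩
  rw [← gaugeSeminorm_pad N hd]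
  set y : Fin r → ℝ := pad x with hy
  have hsum : ∑ i, y i = ∑ i, x i := by
    rw [sum_fin_pad hd]
    · refine Finset.sum_congr rfl fun i _ => ?_
      simp [hy, pad]
    · intro i hi
      simp [hy, pad, hi]
  have hy0 : 0 ≤ ∑ i, y i := hsum ▸ Finset.sum_nonneg fun i _ => hx i
  have h1 : (∑ c : Fin r, fun i => y (i + c)) = (∑ i, y i) • (fun _ : Fin r => (1 : ℝ)) := by
    ext i
    simp only [Finset.sum_apply, Pi.smul_apply, smul_eq_mul, mul_one]
    exact Equiv.sum_comp (Equiv.addLeft i) y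
  have h2 : gaugeSeminorm N r (∑ c : Fin r, fun i => y (i + c))
      ≤ ∑ c : Fin r, gaugeSeminorm N r fun i => y (i + c) :=
    Finset.le_sum_of_subadditive _ (map_zero _).le (map_add_le_add _) _ _
  have h3 : ∀ c : Fin r, gaugeSeminorm N r (fun i => y (i + c)) = gaugeSeminorm N r y :=
    fun c => hN.gauge_perm hp hm y (Equiv.addRight c)
  rw [h1, map_smul_eq_mul, Real.norm_eq_abs, abs_of_nonneg hy0] at h2
  simp only [h3, Finset.sum_const, Finset.card_univ, Fintype.card_fin, nsmul_eq_mul] at h2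
  rw [← hsum, mul_comm]
  exact h2

end IsUnitarilyInvariantNorm

theorem lipschitzConst_nonneg {p m : ℕ} (N : Seminorm ℝ (Matrix (Fin p) (Fin m) ℝ)) (r : ℕ) :
    0 ≤ lipschitzConst (restrictGauge (gauge N) r) :=
  Real.iSup_nonneg fun x => div_nonneg (apply_nonneg (gaugeSeminorm N r) x.1) (Real.sqrt_nonneg _)

theorem gauge_le_lipschitzConst_mul {p m : ℕ} (N : Seminorm ℝ (Matrix (Fin p) (Fin m) ℝ))
    {d r : ℕ} (hd : d ≤ r) (x : Fin d → ℝ) :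
    gaugeSeminorm N d x ≤ lipschitzConst (restrictGauge (gauge N) r) * √(∑ i, x i ^ 2) := by
  rw [← gaugeSeminorm_pad N hd]
  set y : Fin r → ℝ := pad x with hy
  have hsum : ∑ i, y i ^ 2 = ∑ i, x i ^ 2 := by
    rw [sum_fin_pad hd]
    · refine Finset.sum_congr rfl fun i _ => ?_
      simp [hy, pad]
    · intro i hi
      simp [hy, pad, hi]
  rw [← hsum]
  by_cases hy0 : y = 0
  · rw [hy0, map_zero]
    exact mul_nonneg (lipschitzConst_nonneg N r) (Real.sqrt_nonneg _)
  · have hpos : 0 < √(∑ i, y i ^ 2) := by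
      obtain ⟨i, hi⟩ := Function.ne_iff.1 hy0
      simp only [Pi.zero_apply] at hi
      exact Real.sqrt_pos.2 (Finset.sum_pos' (fun i _ => sq_nonneg _)
        ⟨i, Finset.mem_univ _, by positivity⟩)
    rw [← div_le_iff₀ hpos]
    exact le_ciSup (bddAbove_restrictGauge_div N r) ⟨y, hy0⟩

/-- Every coordinate is at most the Euclidean norm. This lets terms L²k and L²s be absorbed by the
oracle rate. -/
theorem IsUnitarilyInvariantNorm.lipschitzConst_le {p m : ℕ}
    {N : Seminorm ℝ (Matrix (Fin p) (Fin m) ℝ)} (hN : IsUnitarilyInvariantNorm N) {r : ℕ}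
    (hp : r ≤ p) (hm : r ≤ m) :
    lipschitzConst (restrictGauge (gauge N) r) ≤ gaugeSeminorm N r fun _ => 1 := by
  refine Real.iSup_le (fun ⟨x, hx⟩ => ?_) (apply_nonneg _ _)
  have hpos : 0 < √(∑ i, x i ^ 2) := by
    obtain ⟨i, hi⟩ := Function.ne_iff.1 hx
    simp only [Pi.zero_apply] at hi
    exact Real.sqrt_pos.2 (Finset.sum_pos' (fun i _ => sq_nonneg _)
      ⟨i, Finset.mem_univ _, by positivity⟩)
  rw [div_le_iff₀ hpos, mul_comm]
  refine hN.gauge_le_of_abs_le le_rfl hp hm hpos fun i => Real.abs_le_sqrt ?_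
  exact Finset.single_le_sum (f := fun i => x i ^ 2) (fun i _ => sq_nonneg _) (Finset.mem_univ i)

/-! ### Restriction to blocks -/

theorem diagonal_sign_mem_orthogonalGroup {n : ℕ} {ε : Fin n → ℝ} (hε : ∀ i, ε i * ε i = 1) :
    Matrix.diagonal ε ∈ Matrix.orthogonalGroup (Fin n) ℝ := by
  rw [Matrix.mem_orthogonalGroup_iff]
  simp [hε]

/-- Compression to a block is the average of four sign conjugations, each of which preserves the
norm. -/
theorem IsUnitarilyInvariantNorm.keepBlock_le {p m : ℕ}
    {N : Seminorm ℝ (Matrix (Fin p) (Fin m) ℝ)} (hN : IsUnitarilyInvariantNorm N)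
    (F : Finset (Fin p)) (G : Finset (Fin m)) (A : Matrix (Fin p) (Fin m) ℝ) :
    N (keepBlock F G A) ≤ N A := by
  set εF : Fin p → ℝ := fun i => if i ∈ F then 1 else -1 with hF
  set εG : Fin m → ℝ := fun i => if i ∈ G then 1 else -1 with hG
  have oF := diagonal_sign_mem_orthogonalGroup (ε := εF) fun i => by
    simp only [hF]; split_ifs <;> norm_num
  have oG := diagonal_sign_mem_orthogonalGroup (ε := εG) fun i => by
    simp only [hG]; split_ifs <;> norm_num
  have o1 : (1 : Matrix (Fin p) (Fin p) ℝ) ∈ Matrix.orthogonalGroup (Fin p) ℝ := one_mem _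
  have o2 : (1 : Matrix (Fin m) (Fin m) ℝ) ∈ Matrix.orthogonalGroup (Fin m) ℝ := one_mem _
  have e : keepBlock F G A = (1 / 4 : ℝ) • (A
      + Matrix.diagonal εF * A * (1 : Matrix (Fin m) (Fin m) ℝ)
      + ((1 : Matrix (Fin p) (Fin p) ℝ) * A * Matrix.diagonal εG + Matrix.diagonal εF * A * Matrix.diagonal εG)) := by
    ext i j
    simp only [keepBlock, Matrix.of_apply, Matrix.smul_apply, Matrix.add_apply, Matrix.mul_one,
      Matrix.one_mul, Matrix.diagonal_mul, Matrix.mul_diagonal, smul_eq_mul, hF, hG]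
    by_cases h1 : i ∈ F <;> by_cases h2 : j ∈ G <;> simp [h1, h2]
    ring
  rw [e, map_smul_eq_mul]
  have h1 := map_add_le_add N (A + Matrix.diagonal εF * A * (1 : Matrix (Fin m) (Fin m) ℝ))
    ((1 : Matrix (Fin p) (Fin p) ℝ) * A * Matrix.diagonal εG + Matrix.diagonal εF * A * Matrix.diagonal εG)
  have h2 := map_add_le_add N A (Matrix.diagonal εF * A * (1 : Matrix (Fin m) (Fin m) ℝ))
  have h3 := map_add_le_add N ((1 : Matrix (Fin p) (Fin p) ℝ) * A * Matrix.diagonal εG)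
    (Matrix.diagonal εF * A * Matrix.diagonal εG)
  rw [hN.invariant _ oF _ o2] at h2
  rw [hN.invariant _ o1 _ oG, hN.invariant _ oF _ oG] at h3
  rw [Real.norm_of_nonneg (by norm_num)]
  linarith

theorem keepBlock_keepBlock_of_subset {p m : ℕ} {F F' : Finset (Fin p)} {G G' : Finset (Fin m)}
    (hF : F ⊆ F') (hG : G ⊆ G') (A : Matrix (Fin p) (Fin m) ℝ) :
    keepBlock F G (keepBlock F' G' A) = keepBlock F G A := by
  ext i j
  simp only [keepBlock, Matrix.of_apply]
  by_cases h1 : i ∈ F <;> by_cases h2 : j ∈ G <;> simp [h1, h2]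
  exact fun h => absurd (hG h2) (h (hF h1))

theorem keepBlock_support {p m : ℕ} (F : Finset (Fin p)) (G : Finset (Fin m))
    (A : Matrix (Fin p) (Fin m) ℝ) (a : Fin p) (b : Fin m) (h : keepBlock F G A a b ≠ 0) :
    a ∈ F ∧ b ∈ G := by
  by_contra h'
  exact h (by simp [keepBlock, h'])

theorem keepBlock_add {p m : ℕ} (F : Finset (Fin p)) (G : Finset (Fin m))
    (A B : Matrix (Fin p) (Fin m) ℝ) :
    keepBlock F G (A + B) = keepBlock F G A + keepBlock F G B := by
  ext i j
  simp only [keepBlock, Matrix.of_apply, Matrix.add_apply]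
  split_ifs <;> simp

/-! ### Norms and large singular values -/

/-- Split x = min(x, a) + (x - a)₊. Monotonicity bounds the first part by a τ(1); the second is
bounded in Euclidean norm and only sees coordinates ≥ a. -/
theorem IsUnitarilyInvariantNorm.gauge_le_threshold {p m : ℕ}
    {N : Seminorm ℝ (Matrix (Fin p) (Fin m) ℝ)} (hN : IsUnitarilyInvariantNorm N) {d r : ℕ}
    (hd : d ≤ r) (hp : r ≤ p) (hm : r ≤ m) {x : Fin d → ℝ} (hx : ∀ i, 0 ≤ x i) {a : ℝ}
    (ha : 0 < a) :
    gaugeSeminorm N d x ≤ a * (gaugeSeminorm N r fun _ => 1)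
      + lipschitzConst (restrictGauge (gauge N) r) * √(∑ i with a ≤ x i, x i ^ 2) := by
  have e : x = (fun i => min (x i) a) + fun i => max (x i - a) 0 := by
    ext i
    simp only [Pi.add_apply]
    rcases le_total (x i) a with h | h
    · rw [min_eq_left h, max_eq_right (by linarith), add_zero]
    · rw [min_eq_right h, max_eq_left (by linarith)]; ring
  have h1 := map_add_le_add (gaugeSeminorm N d) (fun i => min (x i) a) fun i => max (x i - a) 0
  rw [← e] at h1
  refine h1.trans (add_le_add ?_ ?_)
  · refine hN.gauge_le_of_abs_le hd hp hm ha fun i => ?_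
    rw [abs_of_nonneg (le_min (hx i) ha.le)]
    exact min_le_right _ _
  · refine (gauge_le_lipschitzConst_mul N hd _).trans
      (mul_le_mul_of_nonneg_left (Real.sqrt_le_sqrt ?_) (lipschitzConst_nonneg N r))
    rw [Finset.sum_filter]
    refine Finset.sum_le_sum fun i _ => ?_
    split_ifs with h
    · rw [max_eq_left (by linarith)]
      have := hx i
      nlinarith
    · rw [max_eq_right (by linarith)]
      norm_num

/-! ### Exponential control of the large singular values of a noise block -/

theorem sum_product_snd_le {p m j : ℕ} (F : Finset (Fin p)) (G : Finset (Fin m))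
    (q : Fin j × Fin m → ℝ) :
    ∑ x ∈ F ×ˢ G, ∑ l, q (l, x.2) ^ 2 ≤ F.card * ∑ i, q i ^ 2 := by
  rw [Finset.sum_product]
  simp only
  rw [Finset.sum_const, nsmul_eq_mul, Fintype.sum_prod_type_right]
  refine mul_le_mul_of_nonneg_left ?_ (Nat.cast_nonneg _)
  exact Finset.sum_le_sum_of_subset_of_nonneg (Finset.subset_univ _) fun b _ _ =>
    Finset.sum_nonneg fun l _ => sq_nonneg _

theorem sum_product_fst_le {p m j : ℕ} (F : Finset (Fin p)) (G : Finset (Fin m))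
    (u : Fin j × Fin p → ℝ) :
    ∑ x ∈ F ×ˢ G, ∑ l, (u (l, x.1) ^ 2 + 1)
      ≤ G.card * ∑ i, u i ^ 2 + F.card * G.card * j := by
  simp_rw [Finset.sum_add_distrib]
  refine add_le_add ?_ (le_of_eq ?_)
  · rw [Finset.sum_product_right]
    simp only
    rw [Finset.sum_const, nsmul_eq_mul, Fintype.sum_prod_type_right]
    refine mul_le_mul_of_nonneg_left ?_ (Nat.cast_nonneg _)
    exact Finset.sum_le_sum_of_subset_of_nonneg (Finset.subset_univ _) fun b _ _ =>
      Finset.sum_nonneg fun l _ => sq_nonneg _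
  · simp [Finset.card_product]

/-- The smoothed weights of a block, summed over all possible ranks. -/
def blockWeight {p m : ℕ} (F : Finset (Fin p)) (G : Finset (Fin m))
    (Z : Matrix (Fin p) (Fin m) ℝ) : ℝ≥0∞ :=
  ∑ j ∈ Finset.range (min F.card G.card + 1),
    smoothWeight j (F ×ˢ G) (√((max F.card G.card : ℕ) : ℝ))⁻¹ Z

theorem measurable_blockWeight {p m : ℕ} (F : Finset (Fin p)) (G : Finset (Fin m)) :
    Measurable (blockWeight F G) := by
  unfold blockWeight
  exact Finset.measurable_sum _ fun j _ => measurable_smoothWeight _ _ _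

theorem lintegral_blockWeight {p m : ℕ} (F : Finset (Fin p)) (G : Finset (Fin m)) :
    ∫⁻ Z, blockWeight F G Z ∂(noise p m) = ((min F.card G.card + 1 : ℕ) : ℝ≥0∞) := by
  unfold blockWeight
  rw [lintegral_finsetSum _ fun j _ => measurable_smoothWeight _ _ _]
  simp [lintegral_smoothWeight]

/-- Here w = √n, S and T are the sums of x² and x over the j singular values ≥ 8w, A and B are the
variance penalties, and the last two terms are the costs of the Gaussian shifts. Together they are
at most wT + nj/2 ≤ S/8 + S/128, which leaves 31/128 > 1/5 of S. -/
theorem exponent_arith {S T w n j A B : ℝ} (hS : 0 ≤ S) (hT : 8 * w * T ≤ S)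
    (hj : 64 * n * j ≤ S) (hA : A ≤ w / 4 * T) (hB : B ≤ w / 4 * T + n * j / 2) :
    S / 5 ≤ 1 / 2 * S - 1 / 8 * S - A - B - w / 2 * T / 2 - w / 2 * T / 2 := by
  linarith

set_option maxHeartbeats 400000 in
-- The number j of singular values ≥ 8√n depends on Z, which is why `blockWeight` sums over all
-- ranks. The two Gaussian factors are shifted towards the corresponding singular vectors.
theorem exp_le_blockWeight {p m d : ℕ} (F : Finset (Fin p)) (G : Finset (Fin m))
    (Z : Matrix (Fin p) (Fin m) ℝ) {x : Fin d → ℝ} {u : Fin d → Fin p → ℝ}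
    {v : Fin d → Fin m → ℝ} (hd : d ≤ min F.card G.card) (hx : ∀ i, 0 < x i)
    (hu : OrthonormalRows u) (hv : OrthonormalRows v) (hZ : keepBlock F G Z = dyadSum x u v)
    (huF : ∀ i a, u i a ≠ 0 → a ∈ F) (hvG : ∀ i b, v i b ≠ 0 → b ∈ G)
    (hn : 0 < max F.card G.card) :
    ENNReal.ofReal (Real.exp
        ((∑ i with 8 * √((max F.card G.card : ℕ) : ℝ) ≤ x i, x i ^ 2) / 5))
      ≤ blockWeight F G Z := by
  classical
  set n : ℝ := ((max F.card G.card : ℕ) : ℝ) with hn'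
  have hn0 : 0 < n := Nat.cast_pos.2 hn
  have hF : (F.card : ℝ) ≤ n := Nat.cast_le.2 (le_max_left _ _)
  have hG : (G.card : ℝ) ≤ n := Nat.cast_le.2 (le_max_right _ _)
  have hle : ∀ j ≤ min F.card G.card,
      smoothWeight j (F ×ˢ G) (√n)⁻¹ Z ≤ blockWeight F G Z := by
    intro j hj
    unfold blockWeight
    exact Finset.single_le_sum (f := fun j => smoothWeight j (F ×ˢ G) (√n)⁻¹ Z)
      (fun _ _ => zero_le) (Finset.mem_range.2 (by omega))
  clear_value n
  have hsn : 0 < √n := Real.sqrt_pos.2 hn0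
  have hsn2 : √n * √n = n := Real.mul_self_sqrt hn0.le
  set I : Finset (Fin d) := Finset.univ.filter fun i => 8 * √n ≤ x i with hI
  set S : ℝ := ∑ i ∈ I, x i ^ 2 with hS
  set T : ℝ := ∑ i ∈ I, x i with hT
  have hIx : ∀ i ∈ I, 8 * √n ≤ x i := fun i hi => (Finset.mem_filter.1 hi).2
  have hTS : 8 * √n * T ≤ S := by
    rw [hS, hT, Finset.mul_sum]
    exact Finset.sum_le_sum fun i hi => by nlinarith [hIx i hi, hx i]
  have hjS : 64 * n * I.card ≤ S := by
    have : ∑ i ∈ I, (64 * n) ≤ S := Finset.sum_le_sum fun i hi => by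
      nlinarith [hIx i hi, hx i]
    rw [Finset.sum_const, nsmul_eq_mul] at this
    linarith
  clear_value S T
  have hjd : I.card ≤ min F.card G.card :=
    ((Finset.card_le_univ I).trans (by simp)).trans hd
  set j := I.card with hj
  obtain ⟨e⟩ : Nonempty (Fin j ≃ I) := ⟨I.equivFin.symm⟩
  have hsum : ∀ f : Fin d → ℝ, ∑ l, f (e l) = ∑ i ∈ I, f i := fun f => by
    rw [Equiv.sum_comp e (fun i : I => f i), Finset.sum_coe_sort I f]
  -- The scaling makes g ⊗ h equal to √n/2 times the part of Z with large singular values, split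
  -- evenly between the factors. With t = 1/√n the gain is S/2 and the quadratic cost S/8.
  set g : Fin j × Fin p → ℝ := fun y => √(√n * x (e y.1) / 2) * u (e y.1) y.2 with hg
  set q : Fin j × Fin m → ℝ := fun y => √(√n * x (e y.1) / 2) * v (e y.1) y.2 with hq
  have hnn : ∀ l, 0 ≤ √n * x (e l) / 2 := fun l => by have := hx (e l); positivity
  have hgs : ∑ i, g i ^ 2 = √n / 2 * T := by
    rw [Fintype.sum_prod_type]
    have : ∀ l, ∑ a, g (l, a) ^ 2 = √n * x (e l) / 2 := by
      intro l
      simp only [hg, mul_pow, Real.sq_sqrt (hnn l), ← Finset.mul_sum]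
      have := hu (e l) (e l)
      simp only [if_true, ← pow_two] at this
      rw [this, mul_one]
    simp_rw [this]
    rw [hsum fun i => √n * x i / 2, hT, Finset.mul_sum]
    exact Finset.sum_congr rfl fun i _ => by ring
  have hqs : ∑ i, q i ^ 2 = √n / 2 * T := by
    rw [Fintype.sum_prod_type]
    have : ∀ l, ∑ a, q (l, a) ^ 2 = √n * x (e l) / 2 := by
      intro l
      simp only [hq, mul_pow, Real.sq_sqrt (hnn l), ← Finset.mul_sum]
      have := hv (e l) (e l)
      simp only [if_true, ← pow_two] at this
      rw [this, mul_one]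
    simp_rw [this]
    rw [hsum fun i => √n * x i / 2, hT, Finset.mul_sum]
    exact Finset.sum_congr rfl fun i _ => by ring
  clear_value j
  set y : Fin d → ℝ := fun i => if i ∈ I then x i else 0 with hy
  have hC : ∀ z, crossEntry g q z = √n / 2 * dyadSum y u v z.1 z.2 := by
    intro z
    simp only [crossEntry, hg, hq, dyadSum, Matrix.of_apply]
    have : ∀ l, √(√n * x (e l) / 2) * u (e l) z.1 * (√(√n * x (e l) / 2) * v (e l) z.2)
        = (fun i => √n * x i / 2 * u i z.1 * v i z.2) (e l) := fun l => by
      have := Real.mul_self_sqrt (hnn l)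
      simp only
      linear_combination (u (e l) z.1 * v (e l) z.2) * this
    rw [Finset.sum_congr rfl fun l _ => this l,
      hsum fun i => √n * x i / 2 * u i z.1 * v i z.2, Finset.mul_sum, ← Finset.sum_subset (Finset.subset_univ I)]
    · exact Finset.sum_congr rfl fun i hi => by simp only [hy, if_pos hi]; ring
    · intro i _ hi
      simp [hy, hi]
  have hDsupp : ∀ z : Fin p × Fin m, z ∉ F ×ˢ G → dyadSum y u v z.1 z.2 = 0 := by
    intro z hz
    simp only [dyadSum, Matrix.of_apply]
    refine Finset.sum_eq_zero fun i _ => ?_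
    by_contra h
    have h1 := huF i z.1 (right_ne_zero_of_mul (left_ne_zero_of_mul h))
    have h2 := hvG i z.2 (right_ne_zero_of_mul h)
    exact hz (Finset.mem_product.2 ⟨h1, h2⟩)
  have hZD : ∑ z ∈ F ×ˢ G, Z z.1 z.2 * dyadSum y u v z.1 z.2 = S := by
    have h1 : ∑ z ∈ F ×ˢ G, Z z.1 z.2 * dyadSum y u v z.1 z.2
        = ∑ z : Fin p × Fin m, keepBlock F G Z z.1 z.2 * dyadSum y u v z.1 z.2 := by
      rw [← Finset.sum_subset (Finset.subset_univ (F ×ˢ G))]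
      · refine Finset.sum_congr rfl fun z hz => ?_
        rw [Finset.mem_product] at hz
        simp [keepBlock, hz]
      · intro z _ hz
        rw [hDsupp z hz, mul_zero]
    rw [h1, hZ, Fintype.sum_prod_type, sum_sq_dyadSum x y hu hv, hS,
      ← Finset.sum_subset (Finset.subset_univ I)]
    · exact Finset.sum_congr rfl fun i hi => by simp only [hy, if_pos hi]; ring
    · intro i _ hi
      simp [hy, hi]
  have hDD : ∑ z ∈ F ×ˢ G, dyadSum y u v z.1 z.2 ^ 2 = S := by
    have h1 : ∑ z ∈ F ×ˢ G, dyadSum y u v z.1 z.2 ^ 2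
        = ∑ z : Fin p × Fin m, dyadSum y u v z.1 z.2 * dyadSum y u v z.1 z.2 := by
      rw [← Finset.sum_subset (Finset.subset_univ (F ×ˢ G))]
      · exact Finset.sum_congr rfl fun z hz => pow_two _
      · intro z _ hz
        rw [hDsupp z hz, mul_zero]
    rw [h1, Fintype.sum_prod_type, sum_sq_dyadSum y y hu hv, hS,
      ← Finset.sum_subset (Finset.subset_univ I)]
    · exact Finset.sum_congr rfl fun i hi => by simp only [hy, if_pos hi]; ring
    · intro i _ hi
      simp [hy, hi]
  have hmain := le_smoothWeight (F ×ˢ G) (√n)⁻¹ Z g q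
  refine le_trans (ENNReal.ofReal_le_ofReal (Real.exp_le_exp.2 ?_)) (hmain.trans (hle j hjd))
  have ht2 : ((√n)⁻¹) ^ 2 = n⁻¹ := by rw [inv_pow, Real.sq_sqrt hn0.le]
  have hexp : ∑ z ∈ F ×ˢ G, ((√n)⁻¹ * Z z.1 z.2 * crossEntry g q z
        - ((√n)⁻¹) ^ 2 / 2 * (crossEntry g q z ^ 2 + ∑ l, q (l, z.2) ^ 2
          + ∑ l, (g (l, z.1) ^ 2 + 1)))
      = 1 / 2 * S - 1 / 8 * S - n⁻¹ / 2 * (∑ z ∈ F ×ˢ G, ∑ l, q (l, z.2) ^ 2)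
        - n⁻¹ / 2 * ∑ z ∈ F ×ˢ G, ∑ l, (g (l, z.1) ^ 2 + 1) := by
    have h1 : ∀ z, (√n)⁻¹ * Z z.1 z.2 * crossEntry g q z
        - ((√n)⁻¹) ^ 2 / 2 * (crossEntry g q z ^ 2 + ∑ l, q (l, z.2) ^ 2
          + ∑ l, (g (l, z.1) ^ 2 + 1))
        = 1 / 2 * (Z z.1 z.2 * dyadSum y u v z.1 z.2) - 1 / 8 * dyadSum y u v z.1 z.2 ^ 2
          - n⁻¹ / 2 * (∑ l, q (l, z.2) ^ 2) - n⁻¹ / 2 * ∑ l, (g (l, z.1) ^ 2 + 1) := by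
      intro z
      rw [hC, ht2]
      have e1 : (√n)⁻¹ * √n = 1 := inv_mul_cancel₀ hsn.ne'
      have e2 : n⁻¹ * √n ^ 2 = 1 := by
        rw [Real.sq_sqrt hn0.le]; exact inv_mul_cancel₀ hn0.ne'
      linear_combination (Z z.1 z.2 * dyadSum y u v z.1 z.2 / 2) * e1
        - (dyadSum y u v z.1 z.2 ^ 2 / 8) * e2
    simp_rw [h1]
    rw [Finset.sum_sub_distrib, Finset.sum_sub_distrib, Finset.sum_sub_distrib,
      ← Finset.mul_sum, ← Finset.mul_sum, ← Finset.mul_sum, ← Finset.mul_sum, hZD, hDD]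
  rw [hexp, hgs, hqs]
  have hb1 := sum_product_snd_le F G q
  have hb2 := sum_product_fst_le F G g
  rw [hqs] at hb1
  rw [hgs] at hb2
  have hT0 : 0 ≤ T := hT ▸ Finset.sum_nonneg fun i _ => (hx i).le
  have hA : ∑ z ∈ F ×ˢ G, ∑ l, q (l, z.2) ^ 2 ≤ n * (√n / 2 * T) :=
    hb1.trans (mul_le_mul_of_nonneg_right hF (by positivity))
  have hB : ∑ z ∈ F ×ˢ G, ∑ l, (g (l, z.1) ^ 2 + 1) ≤ n * (√n / 2 * T) + n * (n * j) := by
    refine hb2.trans (add_le_add (mul_le_mul_of_nonneg_right hG (by positivity)) ?_)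
    rw [mul_assoc]
    exact mul_le_mul hF (mul_le_mul_of_nonneg_right hG (Nat.cast_nonneg _)) (by positivity) hn0.le
  have hnin : n⁻¹ * n = 1 := inv_mul_cancel₀ hn0.ne'
  have hA' : n⁻¹ / 2 * ∑ z ∈ F ×ˢ G, ∑ l, q (l, z.2) ^ 2 ≤ √n / 4 * T := by
    calc _ ≤ n⁻¹ / 2 * (n * (√n / 2 * T)) := mul_le_mul_of_nonneg_left hA (by positivity)
      _ = √n / 4 * T := by linear_combination (√n / 4 * T) * hnin
  have hB' : n⁻¹ / 2 * ∑ z ∈ F ×ˢ G, ∑ l, (g (l, z.1) ^ 2 + 1) ≤ √n / 4 * T + n * j / 2 := by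
    calc _ ≤ n⁻¹ / 2 * (n * (√n / 2 * T) + n * (n * j)) :=
          mul_le_mul_of_nonneg_left hB (by positivity)
      _ = √n / 4 * T + n * j / 2 := by linear_combination (√n / 4 * T + n * j / 2) * hnin
  exact exponent_arith (hS ▸ Finset.sum_nonneg fun i _ => sq_nonneg _) hTS hjS hA' hB'

/-- A linear upper bound for the logarithm of a weight, valid in `[0, ∞]`. -/
theorem ofReal_le_log_add {y K : ℝ} (hK : 1 ≤ K) {X : ℝ≥0∞}
    (h : ENNReal.ofReal (Real.exp (y / 5)) ≤ X) :
    ENNReal.ofReal y ≤ ENNReal.ofReal (5 * Real.log K) + ENNReal.ofReal (5 / K) * X := by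
  have hK0 : 0 < K := by linarith
  have h1 : y ≤ 5 * Real.log K + 5 / K * Real.exp (y / 5) := by
    have := Real.add_one_le_exp (y / 5 - Real.log K)
    rw [Real.exp_sub, Real.exp_log hK0] at this
    have e : 5 / K * Real.exp (y / 5) = 5 * (Real.exp (y / 5) / K) := by ring
    rw [e]
    linarith
  calc ENNReal.ofReal y ≤ ENNReal.ofReal (5 * Real.log K + 5 / K * Real.exp (y / 5)) :=
        ENNReal.ofReal_le_ofReal h1
    _ = ENNReal.ofReal (5 * Real.log K) + ENNReal.ofReal (5 / K) *
        ENNReal.ofReal (Real.exp (y / 5)) := by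
        rw [ENNReal.ofReal_add (by have := Real.log_nonneg hK; positivity) (by positivity),
          ENNReal.ofReal_mul (p := 5 / K) (by positivity)]
    _ ≤ _ := by gcongr

/-- The norm of a noise block is controlled by the gauge constants and the weight of the block. -/
theorem IsUnitarilyInvariantNorm.ofReal_keepBlock_sq_le {p m k s : ℕ} (hk : 1 ≤ k)
    {N : Seminorm ℝ (Matrix (Fin p) (Fin m) ℝ)} (hN : IsUnitarilyInvariantNorm N)
    {F : Finset (Fin p)} {G : Finset (Fin m)} (hF : F.card = k) (hG : G.card = s)
    (Z : Matrix (Fin p) (Fin m) ℝ) {K : ℝ} (hK : 1 ≤ K) :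
    ENNReal.ofReal (N (keepBlock F G Z) ^ 2)
      ≤ ENNReal.ofReal (128 * oracleRate N k s + 10 * gaugeLip N k s ^ 2 * Real.log K)
        + ENNReal.ofReal (10 * gaugeLip N k s ^ 2 / K) * blockWeight F G Z := by
  obtain ⟨d, x, u, v, hd, hx, hu, hv, huF, hvG, hZ⟩ :=
    exists_svd (keepBlock F G Z) F G (keepBlock_support F G Z)
  have hp : k ≤ p := by simpa [hF] using F.card_le_univ
  have hm : s ≤ m := by simpa [hG] using G.card_le_univ
  have hn : 0 < max F.card G.card := by omega
  have hexp := exp_le_blockWeight F G Z hd hx hu hv hZ huF hvG hn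
  rw [hF, hG] at hexp hd
  -- Since a² = 64 (k ∨ s), squaring the threshold bound yields 128 R₀ + 2L²S.
  set a : ℝ := 8 * √((max k s : ℕ) : ℝ) with ha
  have hn0 : (0 : ℝ) < ((max k s : ℕ) : ℝ) := by rw [hF, hG] at hn; exact_mod_cast hn
  have ha0 : 0 < a := by positivity
  set S : ℝ := ∑ i with a ≤ x i, x i ^ 2 with hS
  have hS0 : 0 ≤ S := Finset.sum_nonneg fun i _ => sq_nonneg _
  have hnorm := hN.gauge_le_threshold hd (by omega) (by omega) (fun i => (hx i).le) ha0
  rw [← hN.apply_dyadSum x hu hv, ← hZ] at hnorm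
  change N (keepBlock F G Z) ≤ a * gaugeOne N k s + gaugeLip N k s * √S at hnorm
  have hL0 : 0 ≤ gaugeLip N k s := lipschitzConst_nonneg N _
  have hsq : N (keepBlock F G Z) ^ 2 ≤ 128 * oracleRate N k s + 2 * gaugeLip N k s ^ 2 * S := by
    have h0 : 0 ≤ N (keepBlock F G Z) := apply_nonneg _ _
    have h1 : (√S) ^ 2 = S := Real.sq_sqrt hS0
    have h2 : a ^ 2 = 64 * ((max k s : ℕ) : ℝ) := by
      rw [ha, mul_pow, Real.sq_sqrt hn0.le]; norm_num
    have h3 : N (keepBlock F G Z) ^ 2 ≤ (a * gaugeOne N k s + gaugeLip N k s * √S) ^ 2 :=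
      pow_le_pow_left₀ h0 hnorm 2
    have h4 : (a * gaugeOne N k s + gaugeLip N k s * √S) ^ 2
        ≤ 2 * (a ^ 2 * gaugeOne N k s ^ 2) + 2 * (gaugeLip N k s ^ 2 * (√S) ^ 2) := by
      nlinarith [sq_nonneg (a * gaugeOne N k s - gaugeLip N k s * √S)]
    rw [h1, h2] at h4
    unfold oracleRate
    linarith
  have hlog := ofReal_le_log_add hK hexp
  have hlogK := Real.log_nonneg hK
  have hR0 : 0 ≤ oracleRate N k s := mul_nonneg (sq_nonneg _) (Nat.cast_nonneg _)
  calc ENNReal.ofReal (N (keepBlock F G Z) ^ 2)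
      ≤ ENNReal.ofReal (128 * oracleRate N k s + 2 * gaugeLip N k s ^ 2 * S) :=
        ENNReal.ofReal_le_ofReal hsq
    _ = ENNReal.ofReal (128 * oracleRate N k s)
        + ENNReal.ofReal (2 * gaugeLip N k s ^ 2) * ENNReal.ofReal S := by
        rw [ENNReal.ofReal_add (by positivity) (by positivity),
          ENNReal.ofReal_mul (p := 2 * gaugeLip N k s ^ 2) (by positivity)]
    _ ≤ ENNReal.ofReal (128 * oracleRate N k s) + ENNReal.ofReal (2 * gaugeLip N k s ^ 2)
        * (ENNReal.ofReal (5 * Real.log K) + ENNReal.ofReal (5 / K) * blockWeight F G Z) := by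
        gcongr
    _ = _ := by
        rw [mul_add, ← add_assoc, ← mul_assoc, ← ENNReal.ofReal_mul (by positivity),
          ← ENNReal.ofReal_mul (by positivity),
          ← ENNReal.ofReal_add (by positivity) (by positivity)]
        congr 2
        · congr 1
          ring
        · congr 1
          ring

/-! ### Entropy of supports -/

theorem one_le_log_exp_mul_div {p k : ℕ} (hk : 1 ≤ k) (hkp : k ≤ p) :
    1 ≤ Real.log (Real.exp 1 * p / k) := by
  have hk0 : (0 : ℝ) < k := by exact_mod_cast hk
  have hkp' : (k : ℝ) ≤ p := by exact_mod_cast hkp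
  have hp0 : (0 : ℝ) < p := hk0.trans_le hkp'
  rw [Real.le_log_iff_exp_le (by positivity), le_div_iff₀ hk0]
  exact mul_le_mul_of_nonneg_left hkp' (Real.exp_pos 1).le

/-- With ℓ = log(ep/k) ≥ 1 and i log(k/i) ≤ k - i, the difference of the two sides is at least (k -
i)(ℓ - 1). -/
theorem mul_log_mono {p i k : ℕ} (hik : i ≤ k) (hkp : k ≤ p) :
    (i : ℝ) * Real.log (Real.exp 1 * p / i) ≤ k * Real.log (Real.exp 1 * p / k) := by
  rcases Nat.eq_zero_or_pos i with rfl | hi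
  · rcases Nat.eq_zero_or_pos k with rfl | hk
    · simp
    · have := one_le_log_exp_mul_div hk hkp
      simp only [Nat.cast_zero, zero_mul]
      positivity
  have hk : 1 ≤ k := by omega
  have hl := one_le_log_exp_mul_div hk hkp
  have hi0 : (0 : ℝ) < i := by exact_mod_cast hi
  have hk0 : (0 : ℝ) < k := by exact_mod_cast hk
  have hp0 : (0 : ℝ) < p := by exact_mod_cast (by omega : 0 < p)
  have hik' : (i : ℝ) ≤ k := by exact_mod_cast hik
  have e : Real.log (Real.exp 1 * p / i) = Real.log (Real.exp 1 * p / k) + Real.log (k / i) := by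
    rw [← Real.log_mul (by positivity) (by positivity)]
    congr 1
    field_simp
  have h2 := Real.log_le_sub_one_of_pos (show (0 : ℝ) < k / i by positivity)
  have h3 : (i : ℝ) * Real.log (k / i) ≤ k - i := by
    calc (i : ℝ) * Real.log (k / i) ≤ i * (k / i - 1) := mul_le_mul_of_nonneg_left h2 hi0.le
      _ = k - i := by field_simp
  rw [e, mul_add]
  nlinarith

theorem supportEntropy_mono {p m k s i j : ℕ} (hik : i ≤ k) (hkp : k ≤ p) (hjs : j ≤ s)
    (hsm : s ≤ m) : supportEntropy p m i j ≤ supportEntropy p m k s :=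
  add_le_add (mul_log_mono hik hkp) (mul_log_mono hjs hsm)

theorem add_le_supportEntropy {p m k s : ℕ} (hk : 1 ≤ k) (hkp : k ≤ p) (hs : 1 ≤ s)
    (hsm : s ≤ m) : (k : ℝ) + s ≤ supportEntropy p m k s := by
  have h1 := one_le_log_exp_mul_div hk hkp
  have h2 := one_le_log_exp_mul_div hs hsm
  unfold supportEntropy
  have hk0 : (0 : ℝ) ≤ k := Nat.cast_nonneg _
  have hs0 : (0 : ℝ) ≤ s := Nat.cast_nonneg _
  nlinarith

/-- Combines C(p,k) ≤ p^k / k! with k^k / k! ≤ e^k. -/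
theorem choose_le_exp {p k : ℕ} (hk : 1 ≤ k) (hkp : k ≤ p) :
    (p.choose k : ℝ) ≤ Real.exp (k * Real.log (Real.exp 1 * p / k)) := by
  have hk0 : (0 : ℝ) < k := by exact_mod_cast hk
  have hp0 : (0 : ℝ) < p := by exact_mod_cast (by omega : 0 < p)
  have h1 : (p.choose k : ℝ) ≤ (p : ℝ) ^ k / k.factorial := Nat.choose_le_pow_div k p
  have h2 : (k : ℝ) ^ k / k.factorial ≤ Real.exp k := Real.pow_div_factorial_le_exp k hk0.le k
  have h3 : Real.exp (k * Real.log (Real.exp 1 * p / k)) = (Real.exp 1 * p / k) ^ k := by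
    rw [mul_comm, ← Real.rpow_def_of_pos (by positivity), Real.rpow_natCast]
  rw [h3]
  refine h1.trans ?_
  have h4 : (Real.exp 1 * p / k) ^ k = Real.exp k * (p ^ k / k ^ k) := by
    rw [div_pow, mul_pow, ← Real.exp_nat_mul, mul_one, mul_div_assoc]
  rw [h4]
  calc (p : ℝ) ^ k / k.factorial = (k : ℝ) ^ k / k.factorial * (p ^ k / k ^ k) := by field_simp
    _ ≤ _ := mul_le_mul_of_nonneg_right h2 (by positivity)

/-! ### The largest noise block -/

/-- The blocks with exactly `k` rows and `s` columns. -/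
def fullBlocks (p m k s : ℕ) : Finset (Finset (Fin p) × Finset (Fin m)) :=
  Finset.powersetCard k Finset.univ ×ˢ Finset.powersetCard s Finset.univ

theorem mem_fullBlocks {p m k s : ℕ} {S : Finset (Fin p) × Finset (Fin m)} :
    S ∈ fullBlocks p m k s ↔ S.1.card = k ∧ S.2.card = s := by
  simp [fullBlocks, Finset.mem_powersetCard]

theorem fullBlocks_nonempty {p m k s : ℕ} (hkp : k ≤ p) (hsm : s ≤ m) :
    (fullBlocks p m k s).Nonempty :=
  (Finset.powersetCard_nonempty.2 (by simpa)).product (Finset.powersetCard_nonempty.2 (by simpa))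

/-- The sum of the weights of all `k × s` blocks. -/
def totalWeight {p m : ℕ} (k s : ℕ) (Z : Matrix (Fin p) (Fin m) ℝ) : ℝ≥0∞ :=
  ∑ S ∈ fullBlocks p m k s, blockWeight S.1 S.2 Z

theorem measurable_totalWeight {p m : ℕ} (k s : ℕ) :
    Measurable (totalWeight (p := p) (m := m) k s) := by
  unfold totalWeight
  exact Finset.measurable_sum _ fun S _ => measurable_blockWeight _ _

theorem blockWeight_le_totalWeight {p m k s : ℕ} {S : Finset (Fin p) × Finset (Fin m)}
    (hS : S ∈ fullBlocks p m k s) (Z : Matrix (Fin p) (Fin m) ℝ) :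
    blockWeight S.1 S.2 Z ≤ totalWeight k s Z := by
  have h : ∀ T ∈ fullBlocks p m k s, 0 ≤ blockWeight T.1 T.2 Z := fun _ _ => zero_le
  exact Finset.single_le_sum h hS

/-- One factor e^H, with H the support entropy, counts the blocks; the other absorbs the k ∧ s + 1
ranks of each block. -/
theorem lintegral_totalWeight_le {p m k s : ℕ} (hk : 1 ≤ k) (hkp : k ≤ p) (hs : 1 ≤ s)
    (hsm : s ≤ m) :
    ∫⁻ Z, totalWeight (p := p) (m := m) k s Z ∂(noise p m)
      ≤ ENNReal.ofReal (Real.exp (2 * supportEntropy p m k s)) := by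
  unfold totalWeight
  rw [lintegral_finsetSum _ fun S _ => measurable_blockWeight _ _]
  have h1 : ∀ S ∈ fullBlocks p m k s, ∫⁻ Z, blockWeight S.1 S.2 Z ∂(noise p m)
      = ((min k s + 1 : ℕ) : ℝ≥0∞) := by
    intro S hS
    rw [lintegral_blockWeight, (mem_fullBlocks.1 hS).1, (mem_fullBlocks.1 hS).2]
  rw [Finset.sum_congr rfl h1, Finset.sum_const, nsmul_eq_mul]
  have hcard : (fullBlocks p m k s).card = p.choose k * m.choose s := by
    simp [fullBlocks, Finset.card_product]
  rw [hcard, ← Nat.cast_mul, ← ENNReal.ofReal_natCast]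
  refine ENNReal.ofReal_le_ofReal ?_
  push_cast
  have hH := add_le_supportEntropy hk hkp hs hsm
  have h2 : ((min k s : ℕ) : ℝ) + 1 ≤ Real.exp (supportEntropy p m k s) := by
    refine (Real.add_one_le_exp _).trans (Real.exp_le_exp.2 (le_trans ?_ hH))
    have : ((min k s : ℕ) : ℝ) ≤ k := by exact_mod_cast min_le_left k s
    have hs0 : (0 : ℝ) ≤ s := Nat.cast_nonneg _
    linarith
  have h3 : (p.choose k : ℝ) * m.choose s ≤ Real.exp (supportEntropy p m k s) := by
    unfold supportEntropy
    rw [Real.exp_add]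
    exact mul_le_mul (choose_le_exp hk hkp) (choose_le_exp hs hsm) (Nat.cast_nonneg _)
      (Real.exp_pos _).le
  rw [two_mul, Real.exp_add]
  push_cast at h2
  exact mul_le_mul h3 h2 (by positivity) (Real.exp_pos _).le

/-- A measurable upper bound for the squared norms of all noise blocks of size at most `k × s`. -/
def noiseEnvelope {p m : ℕ} (N : Seminorm ℝ (Matrix (Fin p) (Fin m) ℝ)) (k s : ℕ)
    (Z : Matrix (Fin p) (Fin m) ℝ) : ℝ≥0∞ :=
  ENNReal.ofReal (128 * oracleRate N k s + 20 * excessRate N k s)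
    + ENNReal.ofReal (10 * gaugeLip N k s ^ 2 / Real.exp (2 * supportEntropy p m k s))
      * totalWeight k s Z

theorem measurable_noiseEnvelope {p m : ℕ} (N : Seminorm ℝ (Matrix (Fin p) (Fin m) ℝ))
    (k s : ℕ) : Measurable (noiseEnvelope N k s) :=
  ((measurable_totalWeight k s).const_mul _).const_add _

theorem oracleRate_nonneg {p m : ℕ} (N : Seminorm ℝ (Matrix (Fin p) (Fin m) ℝ)) (k s : ℕ) :
    0 ≤ oracleRate N k s := mul_nonneg (sq_nonneg _) (Nat.cast_nonneg _)

theorem gaugeLip_sq_le_excessRate {p m k s : ℕ} (N : Seminorm ℝ (Matrix (Fin p) (Fin m) ℝ))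
    (hk : 1 ≤ k) (hkp : k ≤ p) (hs : 1 ≤ s) (hsm : s ≤ m) :
    gaugeLip N k s ^ 2 ≤ excessRate N k s := by
  have h := add_le_supportEntropy hk hkp hs hsm
  have h1 : (1 : ℝ) ≤ k := by exact_mod_cast hk
  have h2 : (1 : ℝ) ≤ s := by exact_mod_cast hs
  exact le_mul_of_one_le_right (sq_nonneg _) (by linarith)

theorem excessRate_nonneg {p m k s : ℕ} (N : Seminorm ℝ (Matrix (Fin p) (Fin m) ℝ))
    (hk : 1 ≤ k) (hkp : k ≤ p) (hs : 1 ≤ s) (hsm : s ≤ m) : 0 ≤ excessRate N k s :=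
  (sq_nonneg _).trans (gaugeLip_sq_le_excessRate N hk hkp hs hsm)

/-- The random part has mean at most 10 L², which is at most 10 R₁ because the entropy is at least
1. -/
theorem lintegral_noiseEnvelope_le {p m k s : ℕ} (N : Seminorm ℝ (Matrix (Fin p) (Fin m) ℝ))
    (hk : 1 ≤ k) (hkp : k ≤ p) (hs : 1 ≤ s) (hsm : s ≤ m) :
    ∫⁻ Z, noiseEnvelope N k s Z ∂(noise p m)
      ≤ ENNReal.ofReal (128 * (oracleRate N k s + excessRate N k s)) := by
  have hR := oracleRate_nonneg N k s
  have hE := excessRate_nonneg N hk hkp hs hsm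
  have hL := gaugeLip_sq_le_excessRate N hk hkp hs hsm
  have hT := lintegral_totalWeight_le hk hkp hs hsm
  have hX := Real.exp_pos (2 * supportEntropy p m k s)
  unfold noiseEnvelope
  rw [lintegral_add_left measurable_const, lintegral_const, measure_univ, mul_one,
    lintegral_const_mul _ (measurable_totalWeight k s)]
  generalize Real.exp (2 * supportEntropy p m k s) = X at hT hX ⊢
  generalize oracleRate N k s = R at hR ⊢
  generalize excessRate N k s = E at hE hL ⊢
  generalize gaugeLip N k s = L at hL ⊢
  refine (add_le_add_right (mul_le_mul_right hT _) _).trans ?_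
  rw [← ENNReal.ofReal_mul (by positivity), div_mul_cancel₀ _ hX.ne',
    ← ENNReal.ofReal_add (by positivity) (by positivity)]
  exact ENNReal.ofReal_le_ofReal (by linarith)

/-- A smaller block extends to a full k × s block without decreasing its norm. The linearized
logarithm is then used with K = exp(2H), so 10 L² log K becomes 20 R₁. -/
theorem IsUnitarilyInvariantNorm.keepBlock_sq_le_noiseEnvelope {p m k s : ℕ}
    {N : Seminorm ℝ (Matrix (Fin p) (Fin m) ℝ)} (hN : IsUnitarilyInvariantNorm N)
    (hk : 1 ≤ k) (hkp : k ≤ p) (hs : 1 ≤ s) (hsm : s ≤ m) {F : Finset (Fin p)}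
    {G : Finset (Fin m)} (hF : F.card ≤ k) (hG : G.card ≤ s) (Z : Matrix (Fin p) (Fin m) ℝ) :
    ENNReal.ofReal (N (keepBlock F G Z) ^ 2) ≤ noiseEnvelope N k s Z := by
  obtain ⟨F', hFF', hF'⟩ := Finset.exists_superset_card_eq hF (by simpa using hkp)
  obtain ⟨G', hGG', hG'⟩ := Finset.exists_superset_card_eq hG (by simpa using hsm)
  have hH := add_le_supportEntropy hk hkp hs hsm
  have hK : 1 ≤ Real.exp (2 * supportEntropy p m k s) := by
    rw [Real.one_le_exp_iff]
    have h1 : (0 : ℝ) ≤ k := Nat.cast_nonneg _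
    have h2 : (0 : ℝ) ≤ s := Nat.cast_nonneg _
    linarith
  have h1 : N (keepBlock F G Z) ≤ N (keepBlock F' G' Z) := by
    rw [← keepBlock_keepBlock_of_subset hFF' hGG']
    exact hN.keepBlock_le F G _
  have h2 := hN.ofReal_keepBlock_sq_le hk hF' hG' Z hK
  have h3 : 10 * gaugeLip N k s ^ 2 * Real.log (Real.exp (2 * supportEntropy p m k s))
      = 20 * excessRate N k s := by
    rw [Real.log_exp, excessRate]; ring
  rw [h3] at h2
  have hmem : (F', G') ∈ fullBlocks p m k s := mem_fullBlocks.2 ⟨hF', hG'⟩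
  have h4 : blockWeight F' G' Z ≤ totalWeight k s Z :=
    blockWeight_le_totalWeight hmem Z
  have h5 := ENNReal.ofReal_le_ofReal (pow_le_pow_left₀ (apply_nonneg N (keepBlock F G Z)) h1 2)
  exact h5.trans (h2.trans (add_le_add_right (mul_le_mul_right h4 _) _))

/-- A seminorm is convex, hence continuous in finite dimension. -/
theorem measurable_seminorm {p m : ℕ} (N : Seminorm ℝ (Matrix (Fin p) (Fin m) ℝ)) :
    Measurable N := by
  have h1 : ConvexOn ℝ Set.univ (fun A : Fin p → Fin m → ℝ => N A) := N.convexOn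
  have h2 := h1.continuousOn isOpen_univ
  exact (continuousOn_univ.1 h2).measurable

theorem measurable_matrix_of_entries {p m : ℕ} {X : Type*} [MeasurableSpace X]
    {f : X → Matrix (Fin p) (Fin m) ℝ} (hf : ∀ a b, Measurable fun x => f x a b) :
    Measurable f :=
  measurable_pi_lambda (X := fun _ : Fin p => Fin m → ℝ) _ fun a =>
    measurable_pi_lambda _ fun b => hf a b

theorem measurable_keepBlock {p m : ℕ} (F : Finset (Fin p)) (G : Finset (Fin m)) :
    Measurable fun Y : Matrix (Fin p) (Fin m) ℝ => keepBlock F G Y := by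
  refine measurable_matrix_of_entries fun a b => ?_
  simp only [keepBlock, Matrix.of_apply]
  split_ifs
  · exact measurable_matrix_entry a b
  · exact measurable_const

/-! ### The subset-selection estimator -/

/-- The largest excess of a block disjoint from `S` over the noise level, or `0`. -/
def violation {p m : ℕ} (N : Seminorm ℝ (Matrix (Fin p) (Fin m) ℝ)) (k s : ℕ) (c₁ γ : ℝ)
    (S : Finset (Fin p) × Finset (Fin m)) (Y : Matrix (Fin p) (Fin m) ℝ) : ℝ :=
  Finset.univ.sup' Finset.univ_nonempty fun B : Finset (Fin p) × Finset (Fin m) =>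
    if B.1.card ≤ k ∧ B.2.card ≤ s ∧ Disjoint (B.1 ×ˢ B.2) (S.1 ×ˢ S.2) then
      max 0 (N (keepBlock B.1 B.2 Y) - noiseLevel N k s c₁ γ B.1.card B.2.card) else 0

theorem violation_le_iff {p m : ℕ} {N : Seminorm ℝ (Matrix (Fin p) (Fin m) ℝ)} {k s : ℕ}
    {c₁ γ : ℝ} {S : Finset (Fin p) × Finset (Fin m)} {Y : Matrix (Fin p) (Fin m) ℝ} {w : ℝ}
    (hw : 0 ≤ w) :
    violation N k s c₁ γ S Y ≤ w ↔
      ∀ (F : Finset (Fin p)) (G : Finset (Fin m)), F.card ≤ k → G.card ≤ s →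
        Disjoint (F ×ˢ G) (S.1 ×ˢ S.2) →
        N (keepBlock F G Y) ≤ noiseLevel N k s c₁ γ F.card G.card + w := by
  unfold violation
  rw [Finset.sup'_le_iff]
  constructor
  · intro h F G hF hG hd
    have := h (F, G) (Finset.mem_univ _)
    rw [if_pos ⟨hF, hG, hd⟩] at this
    linarith [(le_max_right _ _).trans this]
  · rintro h ⟨F, G⟩ -
    split_ifs with hc
    · refine max_le hw ?_
      linarith [h F G hc.1 hc.2.1 hc.2.2]
    · exact hw

theorem measurable_violation {p m : ℕ} (N : Seminorm ℝ (Matrix (Fin p) (Fin m) ℝ)) (k s : ℕ)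
    (c₁ γ : ℝ) (S : Finset (Fin p) × Finset (Fin m)) :
    Measurable fun Y => violation N k s c₁ γ S Y := by
  unfold violation
  have : ∀ B ∈ (Finset.univ : Finset (Finset (Fin p) × Finset (Fin m))),
      Measurable fun Y : Matrix (Fin p) (Fin m) ℝ =>
        if B.1.card ≤ k ∧ B.2.card ≤ s ∧ Disjoint (B.1 ×ˢ B.2) (S.1 ×ˢ S.2) then
          max 0 (N (keepBlock B.1 B.2 Y) - noiseLevel N k s c₁ γ B.1.card B.2.card) else 0 := by
    intro B _
    split_ifs
    · exact measurable_const.max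
        (((measurable_seminorm N).comp (measurable_keepBlock B.1 B.2)).sub_const _)
    · exact measurable_const
  have h := Finset.measurable_sup' Finset.univ_nonempty this
  convert h using 2
  rw [Finset.sup'_apply]

/-- The `k × s` blocks with minimal violation. -/
def minimizers {p m : ℕ} (N : Seminorm ℝ (Matrix (Fin p) (Fin m) ℝ)) (k s : ℕ) (c₁ γ : ℝ)
    (Y : Matrix (Fin p) (Fin m) ℝ) : Finset (Finset (Fin p) × Finset (Fin m)) :=
  {S ∈ fullBlocks p m k s | ∀ T ∈ fullBlocks p m k s,
    violation N k s c₁ γ S Y ≤ violation N k s c₁ γ T Y}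

/-- A choice of an element of a finite set. -/
def pick {α : Type*} [Inhabited α] (A : Finset α) : α :=
  open Classical in if h : A.Nonempty then h.choose else default

theorem pick_mem {α : Type*} [Inhabited α] {A : Finset α} (h : A.Nonempty) : pick A ∈ A := by
  rw [pick, dif_pos h]
  exact h.choose_spec

/-- The selected block. -/
def selectedBlock {p m : ℕ} (N : Seminorm ℝ (Matrix (Fin p) (Fin m) ℝ)) (k s : ℕ) (c₁ γ : ℝ)
    (Y : Matrix (Fin p) (Fin m) ℝ) : Finset (Fin p) × Finset (Fin m) :=
  pick (minimizers N k s c₁ γ Y)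

theorem selectedBlock_mem {p m k s : ℕ} (hkp : k ≤ p) (hsm : s ≤ m)
    (N : Seminorm ℝ (Matrix (Fin p) (Fin m) ℝ)) (c₁ γ : ℝ) (Y : Matrix (Fin p) (Fin m) ℝ) :
    selectedBlock N k s c₁ γ Y ∈ minimizers N k s c₁ γ Y := by
  refine pick_mem ?_
  obtain ⟨S, hS, hmin⟩ := Finset.exists_min_image (fullBlocks p m k s)
    (fun S => violation N k s c₁ γ S Y) (fullBlocks_nonempty hkp hsm)
  exact ⟨S, Finset.mem_filter.2 ⟨hS, hmin⟩⟩

theorem measurableSet_mem_minimizers {p m : ℕ} (N : Seminorm ℝ (Matrix (Fin p) (Fin m) ℝ))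
    (k s : ℕ) (c₁ γ : ℝ) (S : Finset (Fin p) × Finset (Fin m)) :
    MeasurableSet {Y | S ∈ minimizers N k s c₁ γ Y} := by
  by_cases hS : S ∈ fullBlocks p m k s
  · have e : {Y | S ∈ minimizers N k s c₁ γ Y} = ⋂ T ∈ fullBlocks p m k s,
        {Y | violation N k s c₁ γ S Y ≤ violation N k s c₁ γ T Y} := by
      ext Y
      simp [minimizers, hS]
    rw [e]
    exact Finset.measurableSet_biInter _ fun T _ =>
      measurableSet_le (measurable_violation N k s c₁ γ S) (measurable_violation N k s c₁ γ T)
  · have e : {Y | S ∈ minimizers N k s c₁ γ Y} = ∅ := by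
      ext Y
      simp [minimizers, hS]
    rw [e]
    exact MeasurableSet.empty

/-- Evaluating a family of measurable functions at an index chosen from a measurable finite set is
measurable. -/
theorem measurable_pick {X Y α : Type*} [MeasurableSpace X] [MeasurableSpace Y] [Fintype α]
    [Inhabited α] (A : X → Finset α) (hA : ∀ a, MeasurableSet {x | a ∈ A x}) (g : α → X → Y)
    (hg : ∀ a, Measurable (g a)) : Measurable fun x => g (pick (A x)) x := by
  classical
  -- The arbitrary choice depends only on the finite set, which takes finitely many values, so the
  -- discrete σ-algebra suffices.
  let _ : MeasurableSpace (Finset α) := ⊤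
  have h1 : Measurable A := by
    refine measurable_to_countable' fun B => ?_
    have e : A ⁻¹' {B} = ⋂ a, if a ∈ B then {x | a ∈ A x} else {x | a ∈ A x}ᶜ := by
      ext x
      simp only [Set.mem_preimage, Set.mem_singleton_iff, Finset.ext_iff, Set.mem_iInter]
      refine forall_congr' fun a => ?_
      by_cases h : a ∈ B <;> simp [h]
    rw [e]
    refine MeasurableSet.iInter fun a => ?_
    split_ifs
    · exact hA a
    · exact (hA a).compl
  have h2 : Measurable fun y : Finset α × X => g (pick y.1) y.2 :=
    measurable_from_prod_countable_right fun B => hg (pick B)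
  exact h2.comp (h1.prodMk measurable_id)

/-- The subset-selection estimator. -/
def selectionEstimator {p m : ℕ} (N : Seminorm ℝ (Matrix (Fin p) (Fin m) ℝ)) (k s : ℕ)
    (c₁ γ : ℝ) (Y : Matrix (Fin p) (Fin m) ℝ) : Matrix (Fin p) (Fin m) ℝ :=
  keepBlock (selectedBlock N k s c₁ γ Y).1 (selectedBlock N k s c₁ γ Y).2 Y

theorem measurable_selectionEstimator {p m : ℕ} (N : Seminorm ℝ (Matrix (Fin p) (Fin m) ℝ))
    (k s : ℕ) (c₁ γ : ℝ) : Measurable (selectionEstimator N k s c₁ γ) := by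
  exact measurable_pick (fun Y => minimizers N k s c₁ γ Y)
    (measurableSet_mem_minimizers N k s c₁ γ)
    (fun S Y => keepBlock S.1 S.2 Y) (fun S => measurable_keepBlock S.1 S.2)

theorem isSubsetSelectionEstimator_selectionEstimator {p m k s : ℕ} (hkp : k ≤ p) (hsm : s ≤ m)
    (N : Seminorm ℝ (Matrix (Fin p) (Fin m) ℝ)) (c₁ γ : ℝ) :
    IsSubsetSelectionEstimator N k s c₁ γ (selectionEstimator N k s c₁ γ) := by
  refine ⟨measurable_selectionEstimator N k s c₁ γ, selectedBlock N k s c₁ γ, fun Y => ?_,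
    fun Y hY => ?_, fun Y => rfl⟩
  · exact mem_fullBlocks.1 (Finset.mem_filter.1 (selectedBlock_mem hkp hsm N c₁ γ Y)).1
  · obtain ⟨T, hT1, hT2, hT⟩ := hY
    have hmem := Finset.mem_filter.1 (selectedBlock_mem hkp hsm N c₁ γ Y)
    have hcard := mem_fullBlocks.1 hmem.1
    refine ⟨hcard.1, hcard.2, ?_⟩
    -- Admissibility of a k × s block means violation at most 0, so a minimizer inherits it.
    have hv : violation N k s c₁ γ T Y ≤ 0 := (violation_le_iff le_rfl).2 (by simpa using hT)
    have := (violation_le_iff le_rfl).1 ((hmem.2 T (mem_fullBlocks.2 ⟨hT1, hT2⟩)).trans hv)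
    simpa using this

theorem gaugeOne_nonneg {p m : ℕ} (N : Seminorm ℝ (Matrix (Fin p) (Fin m) ℝ)) (k s : ℕ) :
    0 ≤ gaugeOne N k s := apply_nonneg (gaugeSeminorm N (min k s)) fun _ => (1 : ℝ)

theorem gaugeLip_nonneg {p m : ℕ} (N : Seminorm ℝ (Matrix (Fin p) (Fin m) ℝ)) (k s : ℕ) :
    0 ≤ gaugeLip N k s := lipschitzConst_nonneg N _

theorem noiseLevel_mono {p m k s i j : ℕ} (N : Seminorm ℝ (Matrix (Fin p) (Fin m) ℝ)) {c₁ γ : ℝ}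
    (hc : 0 ≤ c₁) (hik : i ≤ k) (hkp : k ≤ p) (hjs : j ≤ s) (hsm : s ≤ m) :
    noiseLevel N k s c₁ γ i j ≤ noiseLevel N k s c₁ γ k s := by
  unfold noiseLevel
  refine add_le_add (mul_le_mul_of_nonneg_left (Real.sqrt_le_sqrt ?_)
    (mul_nonneg hc (gaugeOne_nonneg N k s))) (mul_le_mul_of_nonneg_left
      (Real.sqrt_le_sqrt (supportEntropy_mono hik hkp hjs hsm))
      (mul_nonneg (Real.sqrt_nonneg _) (gaugeLip_nonneg N k s)))
  exact_mod_cast max_le_max hik hjs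

theorem noiseLevel_nonneg {p m k s i j : ℕ} (N : Seminorm ℝ (Matrix (Fin p) (Fin m) ℝ))
    {c₁ γ : ℝ} (hc : 0 ≤ c₁) : 0 ≤ noiseLevel N k s c₁ γ i j :=
  add_nonneg (mul_nonneg (mul_nonneg hc (gaugeOne_nonneg N k s)) (Real.sqrt_nonneg _))
    (mul_nonneg (mul_nonneg (Real.sqrt_nonneg _) (gaugeLip_nonneg N k s)) (Real.sqrt_nonneg _))

theorem noiseLevel_sq_le {p m k s : ℕ} (N : Seminorm ℝ (Matrix (Fin p) (Fin m) ℝ))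
    {c₁ γ : ℝ} (hγ : 0 ≤ γ) (hk : 1 ≤ k) (hkp : k ≤ p) (hs : 1 ≤ s) (hsm : s ≤ m) :
    noiseLevel N k s c₁ γ k s ^ 2 ≤ 2 * c₁ ^ 2 * oracleRate N k s + 2 * γ * excessRate N k s := by
  have hH : 0 ≤ supportEntropy p m k s := by
    have := add_le_supportEntropy hk hkp hs hsm
    have h1 : (0 : ℝ) ≤ k := Nat.cast_nonneg _
    have h2 : (0 : ℝ) ≤ s := Nat.cast_nonneg _
    linarith
  unfold noiseLevel oracleRate excessRate
  have e1 := Real.sq_sqrt (Nat.cast_nonneg (α := ℝ) (max k s))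
  have e2 := Real.sq_sqrt hγ
  have e3 := Real.sq_sqrt hH
  set A := c₁ * gaugeOne N k s * √((max k s : ℕ) : ℝ)
  set B := √γ * gaugeLip N k s * √(supportEntropy p m k s)
  have hA : A ^ 2 = c₁ ^ 2 * (gaugeOne N k s ^ 2 * ((max k s : ℕ) : ℝ)) := by
    rw [← e1]; ring
  have hB : B ^ 2 = γ * (gaugeLip N k s ^ 2 * supportEntropy p m k s) := by
    calc B ^ 2 = √γ ^ 2 * (gaugeLip N k s ^ 2 * √(supportEntropy p m k s) ^ 2) := by
          simp only [B]; ring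
      _ = _ := by rw [e2, e3]
  nlinarith [sq_nonneg (A - B)]

/-- Every matrix of the sparse class is supported on a `k × s` block. -/
theorem exists_block_of_mem_sparseClass {p m k s : ℕ} (hkp : k ≤ p) (hsm : s ≤ m)
    {M : Matrix (Fin p) (Fin m) ℝ} (hM : M ∈ sparseClass p m k s) :
    ∃ (A : Finset (Fin p)) (B : Finset (Fin m)), A.card = k ∧ B.card = s ∧
      ∀ i j, M i j ≠ 0 → i ∈ A ∧ j ∈ B := by
  classical
  obtain ⟨h1, h2⟩ := hM
  rw [Set.ncard_eq_toFinset_card'] at h1 h2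
  obtain ⟨A, hA, hAk⟩ := Finset.exists_superset_card_eq h1 (by simpa using hkp)
  obtain ⟨B, hB, hBs⟩ := Finset.exists_superset_card_eq h2 (by simpa using hsm)
  refine ⟨A, B, hAk, hBs, fun i j hij => ⟨hA ?_, hB ?_⟩⟩
  · rw [Set.mem_toFinset]
    exact fun h => hij (congrFun h j)
  · rw [Set.mem_toFinset]
    exact fun h => hij (congrFun h i)

/-- The loss of the selection estimator is controlled by the noise blocks. -/
theorem IsUnitarilyInvariantNorm.selectionEstimator_loss_le {p m k s : ℕ} (hkp : k ≤ p)
    (hsm : s ≤ m) {N : Seminorm ℝ (Matrix (Fin p) (Fin m) ℝ)}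
    {c₁ γ : ℝ} (hc : 0 ≤ c₁) {M Z : Matrix (Fin p) (Fin m) ℝ} (hM : M ∈ sparseClass p m k s)
    {w : ℝ} (hw : ∀ (F : Finset (Fin p)) (G : Finset (Fin m)), F.card ≤ k → G.card ≤ s →
      N (keepBlock F G Z) ≤ w) :
    N (selectionEstimator N k s c₁ γ (M + Z) - M) ≤ 2 * noiseLevel N k s c₁ γ k s + 5 * w := by
  classical
  obtain ⟨A, B, hA, hB, hsupp⟩ := exists_block_of_mem_sparseClass hkp hsm hM
  have hw0 : 0 ≤ w := (apply_nonneg N _).trans (hw ∅ ∅ (by simp) (by simp))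
  have hmem := Finset.mem_filter.1 (selectedBlock_mem hkp hsm N c₁ γ (M + Z))
  have hcard := mem_fullBlocks.1 hmem.1
  have hM0 : ∀ (F : Finset (Fin p)) (G : Finset (Fin m)), Disjoint (F ×ˢ G) (A ×ˢ B) →
      keepBlock F G M = 0 := by
    intro F G hd
    ext i j
    simp only [keepBlock, Matrix.of_apply, Matrix.zero_apply, ite_eq_right_iff]
    intro hij
    by_contra h
    have h1 := hsupp i j h
    exact Finset.disjoint_left.1 hd (Finset.mk_mem_product hij.1 hij.2)
      (Finset.mk_mem_product h1.1 h1.2)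
  -- A block disjoint from the true support contains pure noise, so its excess over the nonnegative
  -- level ψ is at most w. Minimality passes this bound to the selected block.
  have hvAB : violation N k s c₁ γ (A, B) (M + Z) ≤ w := by
    rw [violation_le_iff hw0]
    intro F G hF hG hd
    rw [keepBlock_add, hM0 F G hd, zero_add]
    linarith [hw F G hF hG, noiseLevel_nonneg (i := F.card) (j := G.card) (γ := γ) (k := k)
      (s := s) N hc]
  have hsel := (violation_le_iff hw0).1
    ((hmem.2 (A, B) (mem_fullBlocks.2 ⟨hA, hB⟩)).trans hvAB)
  set S := selectedBlock N k s c₁ γ (M + Z) with hS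
  have hblock : ∀ (F : Finset (Fin p)) (G : Finset (Fin m)), F.card ≤ k → G.card ≤ s →
      Disjoint (F ×ˢ G) (S.1 ×ˢ S.2) →
      N (keepBlock F G M) ≤ noiseLevel N k s c₁ γ k s + 2 * w := by
    intro F G hF hG hd
    have h1 := hsel F G hF hG hd
    have h2 := noiseLevel_mono (γ := γ) N hc hF hkp hG hsm
    have h3 : keepBlock F G M = keepBlock F G (M + Z) - keepBlock F G Z := by
      rw [keepBlock_add, add_sub_cancel_right]
    rw [h3]
    linarith [map_sub_le_add N (keepBlock F G (M + Z)) (keepBlock F G Z), hw F G hF hG]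
  -- The missed part of M is (A × B) minus the selected block, split into the rows not selected and,
  -- within selected rows, the columns not selected. Both pieces are blocks disjoint from the
  -- selection.
  have e : selectionEstimator N k s c₁ γ (M + Z) - M
      = keepBlock S.1 S.2 Z - (keepBlock (A \ S.1) B M + keepBlock (A ∩ S.1) (B \ S.2) M) := by
    ext i j
    simp only [selectionEstimator, ← hS, keepBlock, Matrix.of_apply, Matrix.sub_apply,
      Matrix.add_apply, Finset.mem_sdiff, Finset.mem_inter]
    by_cases hij : M i j = 0
    · simp [hij]
    · obtain ⟨h1, h2⟩ := hsupp i j hij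
      by_cases h3 : i ∈ S.1 <;> by_cases h4 : j ∈ S.2 <;> simp [h1, h2, h3, h4]
  have b1 := hblock (A \ S.1) B ((Finset.card_le_card Finset.sdiff_subset).trans hA.le) hB.le
    (Finset.disjoint_left.2 fun x hx hx' =>
      (Finset.mem_sdiff.1 (Finset.mem_product.1 hx).1).2 (Finset.mem_product.1 hx').1)
  have b2 := hblock (A ∩ S.1) (B \ S.2) ((Finset.card_le_card Finset.inter_subset_left).trans hA.le)
    ((Finset.card_le_card Finset.sdiff_subset).trans hB.le)
    (Finset.disjoint_left.2 fun x hx hx' =>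
      (Finset.mem_sdiff.1 (Finset.mem_product.1 hx).2).2 (Finset.mem_product.1 hx').2)
  have b3 := hw S.1 S.2 hcard.1.le hcard.2.le
  rw [e]
  linarith [map_sub_le_add N (keepBlock S.1 S.2 Z)
    (keepBlock (A \ S.1) B M + keepBlock (A ∩ S.1) (B \ S.2) M),
    map_add_le_add N (keepBlock (A \ S.1) B M) (keepBlock (A ∩ S.1) (B \ S.2) M)]

theorem IsUnitarilyInvariantNorm.risk_selectionEstimator_le {p m k s : ℕ} (hk : 1 ≤ k)
    (hkp : k ≤ p) (hs : 1 ≤ s) (hsm : s ≤ m) {N : Seminorm ℝ (Matrix (Fin p) (Fin m) ℝ)}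
    (hN : IsUnitarilyInvariantNorm N) {c₁ γ : ℝ} (hc : 0 ≤ c₁) (hγ : 0 ≤ γ)
    {M : Matrix (Fin p) (Fin m) ℝ} (hM : M ∈ sparseClass p m k s) :
    risk N (selectionEstimator N k s c₁ γ) M
      ≤ ENNReal.ofReal ((16 * c₁ ^ 2 + 16 * γ + 6400) * (oracleRate N k s + excessRate N k s)) := by
  classical
  have hpt : ∀ Z, ENNReal.ofReal (N (selectionEstimator N k s c₁ γ (M + Z) - M) ^ 2)
      ≤ ENNReal.ofReal (8 * noiseLevel N k s c₁ γ k s ^ 2)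
        + ENNReal.ofReal 50 * noiseEnvelope N k s Z := by
    intro Z
    set blocks : Finset (Finset (Fin p) × Finset (Fin m)) :=
      {B | B.1.card ≤ k ∧ B.2.card ≤ s} with hblocks
    have hne : blocks.Nonempty := ⟨(∅, ∅), by simp [hblocks]⟩
    obtain ⟨B, hB, hmax⟩ := Finset.exists_max_image blocks (fun B => N (keepBlock B.1 B.2 Z)) hne
    have hB' := (Finset.mem_filter.1 hB).2
    have hloss := IsUnitarilyInvariantNorm.selectionEstimator_loss_le hkp hsm (γ := γ) hc hM
      (w := N (keepBlock B.1 B.2 Z))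
      (fun F G hF hG => hmax (F, G) (Finset.mem_filter.2 ⟨Finset.mem_univ _, hF, hG⟩))
    have henv := hN.keepBlock_sq_le_noiseEnvelope hk hkp hs hsm hB'.1 hB'.2 Z
    set w := N (keepBlock B.1 B.2 Z) with hw
    set ψ := noiseLevel N k s c₁ γ k s with hψ
    have h0 : 0 ≤ N (selectionEstimator N k s c₁ γ (M + Z) - M) := apply_nonneg _ _
    have h1 : N (selectionEstimator N k s c₁ γ (M + Z) - M) ^ 2 ≤ 8 * ψ ^ 2 + 50 * w ^ 2 := by
      have := pow_le_pow_left₀ h0 hloss 2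
      nlinarith [sq_nonneg (2 * ψ - 5 * w)]
    refine (ENNReal.ofReal_le_ofReal h1).trans ?_
    rw [ENNReal.ofReal_add (by positivity) (by positivity),
      ENNReal.ofReal_mul (p := 50) (by norm_num)]
    gcongr
  have hψ := noiseLevel_sq_le (c₁ := c₁) N hγ hk hkp hs hsm
  have hR := oracleRate_nonneg N k s
  have hE := excessRate_nonneg N hk hkp hs hsm
  unfold risk
  refine (lintegral_mono hpt).trans ?_
  rw [lintegral_add_left measurable_const, lintegral_const, measure_univ, mul_one,
    lintegral_const_mul _ (measurable_noiseEnvelope N k s)]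
  refine (add_le_add_right (mul_le_mul_right (lintegral_noiseEnvelope_le N hk hkp hs hsm) _)
    _).trans ?_
  rw [← ENNReal.ofReal_mul (by norm_num), ← ENNReal.ofReal_add (by positivity) (by positivity)]
  refine ENNReal.ofReal_le_ofReal ?_
  -- Here 8ψ² ≤ 16 c₁² R₀ + 16 γ R₁, and the envelope contributes 50 · 128 = 6400.
  nlinarith [mul_nonneg (sq_nonneg c₁) hE, mul_nonneg hγ hR]

/-! ### The oracle estimator -/

/-- The error of the projection Y ↦ Y_IJ is the noise block. With K = k ∧ s + 1, the mean of the
block weight, the remaining terms are L² log K and L², both absorbed by R₀ because L ≤ τ(1). -/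
theorem IsUnitarilyInvariantNorm.minimaxRisk_supportedClass_le {p m k s : ℕ} (hk : 1 ≤ k)
    (hs : 1 ≤ s) {N : Seminorm ℝ (Matrix (Fin p) (Fin m) ℝ)}
    (hN : IsUnitarilyInvariantNorm N) {I : Finset (Fin p)} {J : Finset (Fin m)}
    (hI : I.card = k) (hJ : J.card = s) :
    minimaxRisk N (supportedClass I J) ≤ ENNReal.ofReal (200 * oracleRate N k s) := by
  have hkp : k ≤ p := by simpa [hI] using I.card_le_univ
  have hsm : s ≤ m := by simpa [hJ] using J.card_le_univ
  refine (iInf_le _ ⟨fun Y => keepBlock I J Y, measurable_keepBlock I J⟩).trans ?_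
  refine iSup₂_le fun M hM => ?_
  have hMk : keepBlock I J M = M := by
    ext i j
    by_cases h : M i j = 0
    · simp [keepBlock, h]
    · simp [keepBlock, hM i j h]
  set K : ℝ := ((min k s + 1 : ℕ) : ℝ) with hK
  have hK1 : 1 ≤ K := by rw [hK]; exact_mod_cast Nat.le_add_left 1 _
  have hK0 : 0 < K := by linarith
  have hKn : K ≤ 2 * ((max k s : ℕ) : ℝ) := by
    rw [hK]; exact_mod_cast (by omega : min k s + 1 ≤ 2 * max k s)
  have hlog : Real.log K ≤ 2 * ((max k s : ℕ) : ℝ) :=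
    ((Real.log_le_sub_one_of_pos hK0).trans (by linarith)).trans hKn
  have hL0 := gaugeLip_nonneg N k s
  have hLg : gaugeLip N k s ≤ gaugeOne N k s :=
    hN.lipschitzConst_le (by omega) (by omega)
  have hL2 : gaugeLip N k s ^ 2 ≤ gaugeOne N k s ^ 2 := pow_le_pow_left₀ hL0 hLg 2
  have hn1 : (1 : ℝ) ≤ ((max k s : ℕ) : ℝ) := by exact_mod_cast (by omega : 1 ≤ max k s)
  have hLR : gaugeLip N k s ^ 2 * ((max k s : ℕ) : ℝ) ≤ oracleRate N k s :=
    mul_le_mul_of_nonneg_right hL2 (by linarith)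
  have hl0 := Real.log_nonneg hK1
  have hR := oracleRate_nonneg N k s
  unfold risk
  have hpt : ∀ Z, ENNReal.ofReal (N ((fun Y => keepBlock I J Y) (M + Z) - M) ^ 2)
      ≤ ENNReal.ofReal (128 * oracleRate N k s + 10 * gaugeLip N k s ^ 2 * Real.log K)
        + ENNReal.ofReal (10 * gaugeLip N k s ^ 2 / K) * blockWeight I J Z := by
    intro Z
    simp only [keepBlock_add, hMk, add_sub_cancel_left]
    exact hN.ofReal_keepBlock_sq_le hk hI hJ Z hK1
  refine (lintegral_mono hpt).trans ?_
  rw [lintegral_add_left measurable_const, lintegral_const, measure_univ, mul_one,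
    lintegral_const_mul _ (measurable_blockWeight I J), lintegral_blockWeight, hI, hJ,
    ← ENNReal.ofReal_natCast, ← hK]
  generalize gaugeLip N k s = L at *
  generalize oracleRate N k s = R at *
  rw [← ENNReal.ofReal_mul (by positivity), div_mul_cancel₀ _ hK0.ne',
    ← ENNReal.ofReal_add (by positivity) (by positivity)]
  refine ENNReal.ofReal_le_ofReal ?_
  have h1 : L ^ 2 * Real.log K ≤ L ^ 2 * (2 * ((max k s : ℕ) : ℝ)) :=
    mul_le_mul_of_nonneg_left hlog (sq_nonneg _)
  have h2 : L ^ 2 * 1 ≤ L ^ 2 * ((max k s : ℕ) : ℝ) :=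
    mul_le_mul_of_nonneg_left hn1 (sq_nonneg _)
  linarith

/-! ### Coordinatewise symmetries of a pair of noise matrices -/

theorem measurePreserving_pi_prod {ι : Type*} [Fintype ι] {α : Type*} [MeasurableSpace α]
    (μ : Measure α) [SigmaFinite μ] {T : ι → α × α → α × α}
    (hT : ∀ i, MeasurePreserving (T i) (μ.prod μ) (μ.prod μ)) :
    MeasurePreserving
      (fun z : (ι → α) × (ι → α) =>
        ((fun i => (T i (z.1 i, z.2 i)).1, fun i => (T i (z.1 i, z.2 i)).2) : (ι → α) × (ι → α)))
      ((Measure.pi fun _ => μ).prod (Measure.pi fun _ => μ))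
      ((Measure.pi fun _ => μ).prod (Measure.pi fun _ => μ)) := by
  have h1 := measurePreserving_arrowProdEquivProdArrow α α ι (fun _ => μ) (fun _ => μ)
  have h2 := measurePreserving_pi (fun _ : ι => μ.prod μ) (fun _ => μ.prod μ) hT
  exact (h1.comp h2).comp (h1.symm _)

/-- Apply `T i j` to the pair of `(i, j)` entries of a pair of matrices. -/
def mapEntries {p m : ℕ} (T : Fin p → Fin m → ℝ × ℝ → ℝ × ℝ)
    (z : Matrix (Fin p) (Fin m) ℝ × Matrix (Fin p) (Fin m) ℝ) :
    Matrix (Fin p) (Fin m) ℝ × Matrix (Fin p) (Fin m) ℝ :=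
  (fun i j => (T i j (z.1 i j, z.2 i j)).1, fun i j => (T i j (z.1 i j, z.2 i j)).2)

theorem measurePreserving_mapEntries {p m : ℕ} {T : Fin p → Fin m → ℝ × ℝ → ℝ × ℝ}
    (hT : ∀ i j, MeasurePreserving (T i j) ((gaussianReal 0 1).prod (gaussianReal 0 1))
      ((gaussianReal 0 1).prod (gaussianReal 0 1))) :
    MeasurePreserving (mapEntries T) ((noise p m).prod (noise p m))
      ((noise p m).prod (noise p m)) :=
  measurePreserving_pi_prod (Measure.pi fun _ : Fin m => gaussianReal 0 1)
    fun i => measurePreserving_pi_prod (gaussianReal 0 1) (hT i)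

theorem measurePreserving_swap_block {p m : ℕ} (I : Finset (Fin p)) (J : Finset (Fin m)) :
    MeasurePreserving (mapEntries fun i j => if i ∈ I ∧ j ∈ J then Prod.swap else id)
      ((noise p m).prod (noise p m)) ((noise p m).prod (noise p m)) := by
  refine measurePreserving_mapEntries fun i j => ?_
  split_ifs
  · exact Measure.measurePreserving_swap
  · exact MeasurePreserving.id _

theorem measurePreserving_neg_fst {p m : ℕ} :
    MeasurePreserving (mapEntries (p := p) (m := m) fun _ _ => Prod.map (fun x => -x) id)
      ((noise p m).prod (noise p m)) ((noise p m).prod (noise p m)) := by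
  refine measurePreserving_mapEntries fun i j => ?_
  refine MeasurePreserving.prod ⟨measurable_neg, ?_⟩ (MeasurePreserving.id _)
  rw [gaussianReal_map_neg, neg_zero]

/-! ### Bayes risk for a known support -/

theorem ofReal_sq_add_le {p m : ℕ} (N : Seminorm ℝ (Matrix (Fin p) (Fin m) ℝ))
    (A B D : Matrix (Fin p) (Fin m) ℝ) (h : D = A + B ∨ D = A - B) :
    ENNReal.ofReal (N D ^ 2) ≤ 2 * (ENNReal.ofReal (N A ^ 2) + ENNReal.ofReal (N B ^ 2)) := by
  have h1 : N D ≤ N A + N B := by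
    rcases h with rfl | rfl
    · exact map_add_le_add N A B
    · exact map_sub_le_add N A B
  have h2 : N D ^ 2 ≤ 2 * (N A ^ 2 + N B ^ 2) := by
    have := pow_le_pow_left₀ (apply_nonneg N D) h1 2
    nlinarith [sq_nonneg (N A - N B)]
  refine (ENNReal.ofReal_le_ofReal h2).trans (le_of_eq ?_)
  rw [ENNReal.ofReal_mul (by norm_num), ENNReal.ofReal_add (by positivity) (by positivity)]
  norm_num

theorem measurable_matrix_add {p m : ℕ} {X : Type*} [MeasurableSpace X]
    {f g : X → Matrix (Fin p) (Fin m) ℝ} (hf : Measurable f) (hg : Measurable g) :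
    Measurable fun x => f x + g x :=
  measurable_matrix_of_entries fun a b =>
    ((measurable_matrix_entry a b).comp hf).add ((measurable_matrix_entry a b).comp hg)

theorem measurable_matrix_sub {p m : ℕ} {X : Type*} [MeasurableSpace X]
    {f g : X → Matrix (Fin p) (Fin m) ℝ} (hf : Measurable f) (hg : Measurable g) :
    Measurable fun x => f x - g x :=
  measurable_matrix_of_entries fun a b =>
    ((measurable_matrix_entry a b).comp hf).sub ((measurable_matrix_entry a b).comp hg)

theorem measurable_ofReal_seminorm_sq {p m : ℕ} (N : Seminorm ℝ (Matrix (Fin p) (Fin m) ℝ))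
    {X : Type*} [MeasurableSpace X] {f : X → Matrix (Fin p) (Fin m) ℝ} (hf : Measurable f) :
    Measurable fun x => ENNReal.ofReal (N (f x) ^ 2) :=
  (((measurable_seminorm N).comp hf).pow_const 2).ennreal_ofReal

theorem lintegral_two_mul_add {X : Type*} [MeasurableSpace X] (μ : Measure X) {f g : X → ℝ≥0∞}
    (hf : Measurable f) (hg : Measurable g) :
    ∫⁻ x, 2 * (f x + g x) ∂μ = 2 * (∫⁻ x, f x ∂μ + ∫⁻ x, g x ∂μ) :=
  (lintegral_const_mul 2 (hf.add hg)).trans (congrArg _ (lintegral_add_left hf g))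

/-- The parallelogram-type bound 4‖Z‖² ≤ 2‖Z + X‖² + 2‖Z - X‖² is integrated; by symmetry of X the
two terms on the right have the same mean. -/
theorem lintegral_block_sq_le_sub {p m : ℕ} (N : Seminorm ℝ (Matrix (Fin p) (Fin m) ℝ))
    (I : Finset (Fin p)) (J : Finset (Fin m)) :
    ∫⁻ Z, ENNReal.ofReal (N (keepBlock I J Z) ^ 2) ∂(noise p m)
      ≤ ∫⁻ z, ENNReal.ofReal (N (keepBlock I J z.2 - keepBlock I J z.1) ^ 2)
          ∂((noise p m).prod (noise p m)) := by
  have hm1 : Measurable fun z : Matrix (Fin p) (Fin m) ℝ × Matrix (Fin p) (Fin m) ℝ =>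
      keepBlock I J z.1 := (measurable_keepBlock I J).comp measurable_fst
  have hm2 : Measurable fun z : Matrix (Fin p) (Fin m) ℝ × Matrix (Fin p) (Fin m) ℝ =>
      keepBlock I J z.2 := (measurable_keepBlock I J).comp measurable_snd
  have hms := measurable_ofReal_seminorm_sq N (measurable_matrix_sub hm2 hm1)
  have hma := measurable_ofReal_seminorm_sq N (measurable_matrix_add hm2 hm1)
  have hneg := (measurePreserving_neg_fst (p := p) (m := m)).lintegral_comp hms
  have hfun : ∀ z : Matrix (Fin p) (Fin m) ℝ × Matrix (Fin p) (Fin m) ℝ,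
      keepBlock I J (mapEntries (fun _ _ => Prod.map (fun x => -x) id) z).2
        - keepBlock I J (mapEntries (fun _ _ => Prod.map (fun x => -x) id) z).1
        = keepBlock I J z.2 + keepBlock I J z.1 := by
    intro z
    ext i j
    simp only [keepBlock, mapEntries, Matrix.of_apply, Matrix.sub_apply, Matrix.add_apply,
      Prod.map_fst, Prod.map_snd, id]
    split_ifs <;> ring
  simp_rw [hfun] at hneg
  have hsnd : ∫⁻ Z, ENNReal.ofReal (N (keepBlock I J Z) ^ 2) ∂(noise p m)
      = ∫⁻ z, ENNReal.ofReal (N (keepBlock I J z.2) ^ 2) ∂((noise p m).prod (noise p m)) :=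
    ((measurePreserving_snd (μ := noise p m) (ν := noise p m)).lintegral_comp
      (measurable_ofReal_seminorm_sq N (measurable_keepBlock I J))).symm
  have hpt : ∀ z : Matrix (Fin p) (Fin m) ℝ × Matrix (Fin p) (Fin m) ℝ,
      4 * ENNReal.ofReal (N (keepBlock I J z.2) ^ 2)
        ≤ 2 * (ENNReal.ofReal (N (keepBlock I J z.2 + keepBlock I J z.1) ^ 2)
          + ENNReal.ofReal (N (keepBlock I J z.2 - keepBlock I J z.1) ^ 2)) := by
    intro z
    have := ofReal_sq_add_le N (keepBlock I J z.2 + keepBlock I J z.1)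
      (keepBlock I J z.2 - keepBlock I J z.1) ((2 : ℝ) • keepBlock I J z.2)
      (Or.inl (by rw [two_smul]; abel))
    rwa [map_smul_eq_mul, Real.norm_ofNat, mul_pow, ENNReal.ofReal_mul (by norm_num),
      show ENNReal.ofReal (2 ^ 2) = 4 by norm_num] at this
  have h := lintegral_mono (μ := (noise p m).prod (noise p m)) hpt
  rw [lintegral_const_mul _ (measurable_ofReal_seminorm_sq N hm2),
    lintegral_two_mul_add _ hma hms, hneg, ← two_mul, ← mul_assoc,
    show (2 : ℝ≥0∞) * 2 = 4 by norm_num, ← hsnd] at h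
  exact (ENNReal.mul_le_mul_iff_right (by norm_num) (by norm_num)).1 h

/-- Bayes argument with the prior X = Z'_IJ, where Z' is an independent copy of the noise. The data
are symmetric in X and the noise on the block, so an estimator is as close to one as to the other,
and the triangle inequality bounds their distance. -/
theorem lintegral_block_sq_le_minimaxRisk {p m : ℕ} (N : Seminorm ℝ (Matrix (Fin p) (Fin m) ℝ))
    (I : Finset (Fin p)) (J : Finset (Fin m)) :
    ∫⁻ Z, ENNReal.ofReal (N (keepBlock I J Z) ^ 2) ∂(noise p m)
      ≤ 4 * minimaxRisk N (supportedClass I J) := by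
  unfold minimaxRisk
  rw [ENNReal.mul_iInf_of_ne (by norm_num) (by norm_num)]
  refine le_iInf fun ⟨est, hest⟩ => ?_
  set R := ⨆ M ∈ supportedClass I J, risk N est M with hR
  have hm1 : Measurable fun z : Matrix (Fin p) (Fin m) ℝ × Matrix (Fin p) (Fin m) ℝ =>
      keepBlock I J z.1 := (measurable_keepBlock I J).comp measurable_fst
  have hm2 : Measurable fun z : Matrix (Fin p) (Fin m) ℝ × Matrix (Fin p) (Fin m) ℝ =>
      keepBlock I J z.2 := (measurable_keepBlock I J).comp measurable_snd
  have he : Measurable fun z : Matrix (Fin p) (Fin m) ℝ × Matrix (Fin p) (Fin m) ℝ =>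
      est (keepBlock I J z.1 + z.2) := hest.comp (measurable_matrix_add hm1 measurable_snd)
  have hl1 := measurable_ofReal_seminorm_sq N (measurable_matrix_sub he hm1)
  have hl2 := measurable_ofReal_seminorm_sq N (measurable_matrix_sub he hm2)
  have havg : ∫⁻ z, ENNReal.ofReal (N (est (keepBlock I J z.1 + z.2) - keepBlock I J z.1) ^ 2)
      ∂((noise p m).prod (noise p m)) ≤ R := by
    rw [lintegral_prod _ hl1.aemeasurable]
    calc _ ≤ ∫⁻ _, R ∂(noise p m) := lintegral_mono fun X =>
          le_iSup₂_of_le (keepBlock I J X) (fun i j => keepBlock_support I J X i j) le_rfl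
      _ = R := by rw [lintegral_const, measure_univ, mul_one]
  -- Swapping the entries of the pair inside I × J fixes Y and turns the loss for X into the loss
  -- for Z_IJ.
  have hswap := (measurePreserving_swap_block I J).lintegral_comp hl1
  have hfun1 : ∀ z : Matrix (Fin p) (Fin m) ℝ × Matrix (Fin p) (Fin m) ℝ,
      keepBlock I J (mapEntries (fun i j => if i ∈ I ∧ j ∈ J then Prod.swap else id) z).1
        = keepBlock I J z.2 := by
    intro z
    ext i j
    simp only [keepBlock, mapEntries, Matrix.of_apply]
    split_ifs <;> rfl
  have hfun2 : ∀ z : Matrix (Fin p) (Fin m) ℝ × Matrix (Fin p) (Fin m) ℝ,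
      keepBlock I J z.2 + (mapEntries (fun i j => if i ∈ I ∧ j ∈ J then Prod.swap else id) z).2
        = keepBlock I J z.1 + z.2 := by
    intro z
    ext i j
    rw [Matrix.add_apply, Matrix.add_apply]
    simp only [keepBlock, mapEntries, Matrix.of_apply]
    split_ifs
    · exact add_comm (z.2 i j) (z.1 i j)
    · rfl
  simp_rw [hfun1, hfun2] at hswap
  have hpt : ∀ z : Matrix (Fin p) (Fin m) ℝ × Matrix (Fin p) (Fin m) ℝ,
      ENNReal.ofReal (N (keepBlock I J z.2 - keepBlock I J z.1) ^ 2)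
        ≤ 2 * (ENNReal.ofReal (N (est (keepBlock I J z.1 + z.2) - keepBlock I J z.1) ^ 2)
          + ENNReal.ofReal (N (est (keepBlock I J z.1 + z.2) - keepBlock I J z.2) ^ 2)) :=
    fun z => ofReal_sq_add_le N _ _ _ (Or.inr (by abel))
  calc _ ≤ _ := lintegral_block_sq_le_sub N I J
    _ ≤ _ := lintegral_mono hpt
    _ ≤ 2 * (R + R) := by
        rw [lintegral_two_mul_add _ hl1 hl2, hswap]
        gcongr
    _ = 4 * R := by rw [← two_mul, ← mul_assoc]; norm_num

/-! ### The expected squared norm of a noise block -/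

theorem lintegral_entry_sq {p m : ℕ} (i : Fin p) (j : Fin m) :
    ∫⁻ Z, ENNReal.ofReal (Z i j ^ 2) ∂(noise p m) = 1 := by
  have h1 := (measurePreserving_eval (fun _ : Fin p => stdGauss (Fin m)) i).lintegral_comp
    (f := fun x : Fin m → ℝ => ENNReal.ofReal (x j ^ 2)) (by fun_prop)
  refine h1.trans ?_
  have h2 := integral_stdGauss_affine_sq (ι := Fin m) 0 (Pi.single j 1)
  have h3 := (memLp_stdGauss_eval j).integrable_sq
  rw [← ofReal_integral_eq_lintegral_ofReal h3 (Filter.Eventually.of_forall fun x => sq_nonneg _)]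
  have e : ∀ x : Fin m → ℝ, 0 + ∑ i, (Pi.single j 1 : Fin m → ℝ) i * x i = x j := by
    intro x
    simp [Pi.single_apply]
  simp_rw [e] at h2
  rw [h2]
  simp [Pi.single_apply]

theorem lintegral_sum_keepBlock_sq {p m : ℕ} (I : Finset (Fin p)) (J : Finset (Fin m)) :
    ∫⁻ Z, ENNReal.ofReal (∑ i, ∑ j, keepBlock I J Z i j ^ 2) ∂(noise p m)
      = ((I.card * J.card : ℕ) : ℝ≥0∞) := by
  have e : ∀ Z : Matrix (Fin p) (Fin m) ℝ, ENNReal.ofReal (∑ i, ∑ j, keepBlock I J Z i j ^ 2)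
      = ∑ i ∈ I, ∑ j ∈ J, ENNReal.ofReal (Z i j ^ 2) := by
    intro Z
    have h : ∑ i, ∑ j, keepBlock I J Z i j ^ 2 = ∑ i ∈ I, ∑ j ∈ J, Z i j ^ 2 := by
      have h1 : ∀ i, ∑ j, keepBlock I J Z i j ^ 2 = if i ∈ I then ∑ j ∈ J, Z i j ^ 2 else 0 := by
        intro i
        by_cases hi : i ∈ I <;> simp [keepBlock, hi, ite_pow]
      simp_rw [h1]
      simp
    rw [h]
    refine (ENNReal.ofReal_sum_of_nonneg fun i _ => Finset.sum_nonneg fun j _ =>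
      sq_nonneg (Z i j)).trans ?_
    exact Finset.sum_congr rfl fun i _ => ENNReal.ofReal_sum_of_nonneg fun j _ =>
      sq_nonneg (Z i j)
  simp_rw [e]
  have hm : ∀ i j, Measurable fun Z : Matrix (Fin p) (Fin m) ℝ => ENNReal.ofReal (Z i j ^ 2) :=
    fun i j => ((measurable_matrix_entry i j).pow_const 2).ennreal_ofReal
  rw [lintegral_finsetSum _ fun i _ => Finset.measurable_sum _ fun j _ => hm i j]
  simp_rw [lintegral_finsetSum _ fun j _ => hm _ j, lintegral_entry_sq]
  simp

/-- The Frobenius norm of a block is controlled by its norm and its large singular values. -/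
theorem IsUnitarilyInvariantNorm.gaugeOne_sq_mul_sum_sq_le {p m k s : ℕ} (hk : 1 ≤ k)
    {N : Seminorm ℝ (Matrix (Fin p) (Fin m) ℝ)} (hN : IsUnitarilyInvariantNorm N)
    {I : Finset (Fin p)} {J : Finset (Fin m)} (hI : I.card = k) (hJ : J.card = s)
    (Z : Matrix (Fin p) (Fin m) ℝ) :
    ∃ S : ℝ, 0 ≤ S ∧ ENNReal.ofReal (Real.exp (S / 5)) ≤ blockWeight I J Z ∧
      gaugeOne N k s ^ 2 * ∑ i, ∑ j, keepBlock I J Z i j ^ 2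
        ≤ ((min k s : ℕ) : ℝ) * (gaugeOne N k s ^ 2 * (64 * ((max k s : ℕ) : ℝ) + S) / 148
          + 37 * N (keepBlock I J Z) ^ 2) := by
  obtain ⟨d, x, u, v, hd, hx, hu, hv, huF, hvG, hZ⟩ :=
    exists_svd (keepBlock I J Z) I J (keepBlock_support I J Z)
  have hp : k ≤ p := by simpa [hI] using I.card_le_univ
  have hm : s ≤ m := by simpa [hJ] using J.card_le_univ
  have hexp := exp_le_blockWeight I J Z hd hx hu hv hZ huF hvG (by omega)
  rw [hI, hJ] at hexp hd
  set a : ℝ := 8 * √((max k s : ℕ) : ℝ) with ha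
  have hn0 : (0 : ℝ) ≤ ((max k s : ℕ) : ℝ) := Nat.cast_nonneg _
  have ha2 : a ^ 2 = 64 * ((max k s : ℕ) : ℝ) := by
    rw [ha, mul_pow, Real.sq_sqrt hn0]; norm_num
  have ha0 : 0 ≤ a := by positivity
  set S : ℝ := ∑ i with a ≤ x i, x i ^ 2 with hS
  have hS0 : 0 ≤ S := Finset.sum_nonneg fun i _ => sq_nonneg _
  refine ⟨S, hS0, hexp, ?_⟩
  have hfro : ∑ i, ∑ j, keepBlock I J Z i j ^ 2 = ∑ i, x i ^ 2 := by
    simp only [hZ, pow_two]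
    exact sum_sq_dyadSum x x hu hv
  have hsum := hN.gauge_one_mul_sum_le hd (by omega) (by omega) (fun i => (hx i).le)
  rw [← hN.apply_dyadSum x hu hv, ← hZ] at hsum
  change gaugeOne N k s * ∑ i, x i ≤ ((min k s : ℕ) : ℝ) * N (keepBlock I J Z) at hsum
  -- A singular value is below the threshold a, or its square is one of the summands of S.
  have hmax : ∀ i, x i ≤ √(a ^ 2 + S) := by
    intro i
    refine Real.le_sqrt_of_sq_le ?_
    by_cases h : a ≤ x i
    · have h1 : ∀ j ∈ Finset.univ.filter (fun j => a ≤ x j), 0 ≤ x j ^ 2 := fun _ _ => sq_nonneg _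
      have h2 : x i ^ 2 ≤ S := Finset.single_le_sum h1 (Finset.mem_filter.2 ⟨Finset.mem_univ i, h⟩)
      nlinarith [sq_nonneg a]
    · have := pow_le_pow_left₀ (hx i).le (not_le.1 h).le 2
      linarith
  set b := √(a ^ 2 + S) with hb
  have hb2 : b ^ 2 = 64 * ((max k s : ℕ) : ℝ) + S := by
    rw [hb, Real.sq_sqrt (by positivity), ha2]
  have hb0 : 0 ≤ b := Real.sqrt_nonneg _
  have hτ := gaugeOne_nonneg N k s
  have h1 : ∑ i, x i ^ 2 ≤ b * ∑ i, x i := by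
    rw [Finset.mul_sum]
    exact Finset.sum_le_sum fun i _ => by
      rw [pow_two]; exact mul_le_mul_of_nonneg_right (hmax i) (hx i).le
  rw [hfro, ← hb2]
  have hr0 : (0 : ℝ) ≤ ((min k s : ℕ) : ℝ) := Nat.cast_nonneg _
  clear_value b S a
  generalize gaugeOne N k s = τ at *
  generalize N (keepBlock I J Z) = w at *
  generalize ((min k s : ℕ) : ℝ) = r at *
  -- The last inequality is αβ ≤ α²/148 + 37β², with 148 = 4 · 37 = 2 · 74. Since 64n + S will have
  -- mean at most 74n, the first term uses up half of the Frobenius energy.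
  calc τ ^ 2 * ∑ i, x i ^ 2 ≤ τ ^ 2 * (b * ∑ i, x i) := by gcongr
    _ = τ * b * (τ * ∑ i, x i) := by ring
    _ ≤ τ * b * (r * w) := by gcongr
    _ = r * (τ * b * w) := by ring
    _ ≤ r * (τ ^ 2 * b ^ 2 / 148 + 37 * w ^ 2) := by
        gcongr
        nlinarith [sq_nonneg (τ * b - 74 * w)]

/-- The expected Frobenius energy is ks = (k ∧ s)(k ∨ s), and the mean of S is at most 5 log K + 5 ≤
10 (k ∨ s). -/
theorem IsUnitarilyInvariantNorm.le_lintegral_block_sq {p m k s : ℕ} (hk : 1 ≤ k) (hs : 1 ≤ s)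
    {N : Seminorm ℝ (Matrix (Fin p) (Fin m) ℝ)} (hN : IsUnitarilyInvariantNorm N)
    {I : Finset (Fin p)} {J : Finset (Fin m)} (hI : I.card = k) (hJ : J.card = s) :
    ENNReal.ofReal (oracleRate N k s / 74)
      ≤ ∫⁻ Z, ENNReal.ofReal (N (keepBlock I J Z) ^ 2) ∂(noise p m) := by
  set τ := gaugeOne N k s with hτ
  set n : ℝ := ((max k s : ℕ) : ℝ) with hn
  set r : ℝ := ((min k s : ℕ) : ℝ) with hr
  set K : ℝ := ((min k s + 1 : ℕ) : ℝ) with hK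
  have hK1 : 1 ≤ K := by rw [hK]; exact_mod_cast Nat.le_add_left 1 _
  have hK0 : 0 < K := by linarith
  have hr1 : 1 ≤ r := by rw [hr]; exact_mod_cast (by omega : 1 ≤ min k s)
  have hrn : r ≤ n := by rw [hr, hn]; exact_mod_cast (by omega : min k s ≤ max k s)
  have hKr : K = r + 1 := by rw [hK, hr]; push_cast; ring
  have hlog : Real.log K ≤ r := (Real.log_le_sub_one_of_pos hK0).trans (by linarith)
  have hlog0 := Real.log_nonneg hK1
  have hpt : ∀ Z, ENNReal.ofReal (τ ^ 2) * ENNReal.ofReal (∑ i, ∑ j, keepBlock I J Z i j ^ 2)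
      ≤ ENNReal.ofReal (r * τ ^ 2 * (64 * n + 5 * Real.log K) / 148)
        + ENNReal.ofReal (r * τ ^ 2 / 148 * (5 / K)) * blockWeight I J Z
        + ENNReal.ofReal (37 * r) * ENNReal.ofReal (N (keepBlock I J Z) ^ 2) := by
    intro Z
    obtain ⟨S, hS0, hS, hle⟩ := hN.gaugeOne_sq_mul_sum_sq_le hk hI hJ Z
    have hl := ofReal_le_log_add hK1 hS
    rw [← ENNReal.ofReal_mul (sq_nonneg _)]
    calc _ ≤ _ := ENNReal.ofReal_le_ofReal hle
      _ = ENNReal.ofReal (r * τ ^ 2 * (64 * n) / 148 + r * τ ^ 2 / 148 * S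
          + 37 * r * N (keepBlock I J Z) ^ 2) := by congr 1; ring
      _ = ENNReal.ofReal (r * τ ^ 2 * (64 * n) / 148) + ENNReal.ofReal (r * τ ^ 2 / 148)
          * ENNReal.ofReal S + ENNReal.ofReal (37 * r) * ENNReal.ofReal (N (keepBlock I J Z) ^ 2) := by
        rw [ENNReal.ofReal_add (by positivity) (by positivity),
          ENNReal.ofReal_add (by positivity) (by positivity),
          ENNReal.ofReal_mul (p := r * τ ^ 2 / 148) (by positivity),
          ENNReal.ofReal_mul (p := 37 * r) (by positivity)]
      _ ≤ ENNReal.ofReal (r * τ ^ 2 * (64 * n) / 148) + ENNReal.ofReal (r * τ ^ 2 / 148)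
          * (ENNReal.ofReal (5 * Real.log K) + ENNReal.ofReal (5 / K) * blockWeight I J Z)
          + ENNReal.ofReal (37 * r) * ENNReal.ofReal (N (keepBlock I J Z) ^ 2) := by gcongr
      _ = _ := by
        rw [mul_add, ← add_assoc, ← mul_assoc (ENNReal.ofReal (r * τ ^ 2 / 148)),
          ← ENNReal.ofReal_mul (p := r * τ ^ 2 / 148) (q := 5 * Real.log K) (by positivity),
          ← ENNReal.ofReal_mul (p := r * τ ^ 2 / 148) (q := 5 / K) (by positivity),
          ← ENNReal.ofReal_add (by positivity) (by positivity)]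
        congr 3
        ring
  have hmN := measurable_ofReal_seminorm_sq N (measurable_keepBlock (p := p) (m := m) I J)
  have hms : Measurable fun Z : Matrix (Fin p) (Fin m) ℝ =>
      ENNReal.ofReal (∑ i, ∑ j, keepBlock I J Z i j ^ 2) :=
    (Finset.measurable_sum _ fun i _ => Finset.measurable_sum _ fun j _ =>
      ((measurable_matrix_entry i j).comp (measurable_keepBlock I J)).pow_const 2).ennreal_ofReal
  have h := lintegral_mono (μ := noise p m) hpt
  rw [lintegral_const_mul _ hms, lintegral_sum_keepBlock_sq, lintegral_add_right _
      (hmN.const_mul _), lintegral_add_left measurable_const, lintegral_const, measure_univ,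
    mul_one, lintegral_const_mul _ (measurable_blockWeight I J), lintegral_blockWeight,
    lintegral_const_mul _ hmN, hI, hJ, ← ENNReal.ofReal_natCast, ← ENNReal.ofReal_natCast, ← hK,
    ← ENNReal.ofReal_mul (sq_nonneg _), ← ENNReal.ofReal_mul (by positivity),
    ← ENNReal.ofReal_add (by positivity) (by positivity)] at h
  have hks : ((k * s : ℕ) : ℝ) = r * n := by
    rw [hr, hn, ← Nat.cast_mul, min_mul_max]
  rw [hks] at h
  set Q := ∫⁻ Z, ENNReal.ofReal (N (keepBlock I J Z) ^ 2) ∂(noise p m) with hQ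
  by_cases hQt : Q = ⊤
  · rw [hQt]; exact le_top
  rw [← ENNReal.ofReal_toReal hQt, ← ENNReal.ofReal_mul (by positivity),
    ← ENNReal.ofReal_add (by positivity) (by positivity),
    ENNReal.ofReal_le_ofReal_iff (by positivity)] at h
  rw [← ENNReal.ofReal_toReal hQt]
  refine ENNReal.ofReal_le_ofReal ?_
  have e1 : r * τ ^ 2 / 148 * (5 / K) * K = r * τ ^ 2 / 148 * 5 := by
    field_simp
  rw [e1] at h
  have h2 : r * (τ ^ 2 * n) ≤ r * (τ ^ 2 * (64 * n + 5 * Real.log K) / 148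
      + τ ^ 2 / 148 * 5 + 37 * Q.toReal) := by linarith
  have h3 := le_of_mul_le_mul_left h2 (by linarith)
  have h4 : τ ^ 2 * (64 * n + 5 * Real.log K) ≤ τ ^ 2 * (64 * n + 5 * n) := by gcongr; linarith
  have h5 : τ ^ 2 * 5 ≤ τ ^ 2 * (5 * n) := by gcongr; linarith
  change τ ^ 2 * n / 74 ≤ Q.toReal
  linarith

theorem IsUnitarilyInvariantNorm.le_minimaxRisk_supportedClass {p m k s : ℕ} (hk : 1 ≤ k)
    (hs : 1 ≤ s) {N : Seminorm ℝ (Matrix (Fin p) (Fin m) ℝ)} (hN : IsUnitarilyInvariantNorm N)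
    {I : Finset (Fin p)} {J : Finset (Fin m)} (hI : I.card = k) (hJ : J.card = s) :
    ENNReal.ofReal (oracleRate N k s / 296) ≤ minimaxRisk N (supportedClass I J) := by
  have h := (hN.le_lintegral_block_sq hk hs hI hJ).trans (lintegral_block_sq_le_minimaxRisk N I J)
  rw [show oracleRate N k s / 74 = 4 * (oracleRate N k s / 296) by ring,
    ENNReal.ofReal_mul (by norm_num), ENNReal.ofReal_ofNat] at h
  exact (ENNReal.mul_le_mul_iff_right (by norm_num) (by norm_num)).1 h

/-! ### Flat orthogonal matrices -/

/-- A geometric sum of powers of a k-th root of unity, which is 1 exactly when k divides n. -/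
theorem sum_exp_two_pi_mul {k : ℕ} (hk : k ≠ 0) (n : ℤ) :
    ∑ i : Fin k, Complex.exp (((2 * Real.pi * n * (i : ℕ) / k : ℝ) : ℂ) * Complex.I)
      = if (k : ℤ) ∣ n then (k : ℂ) else 0 := by
  have hk' : (k : ℂ) ≠ 0 := Nat.cast_ne_zero.2 hk
  set ζ : ℂ := Complex.exp (2 * Real.pi * Complex.I * n / k) with hζ
  have hterm : ∀ i : Fin k, Complex.exp (((2 * Real.pi * n * (i : ℕ) / k : ℝ) : ℂ) * Complex.I)
      = ζ ^ (i : ℕ) := by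
    intro i
    rw [hζ, ← Complex.exp_nat_mul]
    congr 1
    push_cast
    ring
  simp_rw [hterm]
  rw [Fin.sum_univ_eq_sum_range (fun i => ζ ^ i) k]
  split_ifs with h
  · obtain ⟨c, rfl⟩ := h
    have h1 : ζ = 1 := by
      rw [hζ, ← Complex.exp_int_mul_two_pi_mul_I c]
      congr 1
      push_cast
      field_simp
    simp [h1]
  · have h1 : ζ ≠ 1 := by
      intro h1
      obtain ⟨c, hc⟩ := Complex.exp_eq_one_iff.1 h1
      have h2 : (2 * Real.pi * Complex.I : ℂ) ≠ 0 := Complex.two_pi_I_ne_zero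
      rw [div_eq_iff hk', mul_comm (c : ℂ), mul_assoc _ (c : ℂ)] at hc
      have h3 := mul_left_cancel₀ h2 hc
      exact h ⟨c, by rw [mul_comm]; exact_mod_cast h3⟩
    have h2 : ζ ^ k = 1 := by
      rw [hζ, ← Complex.exp_nat_mul, ← Complex.exp_int_mul_two_pi_mul_I n]
      congr 1
      field_simp
    rw [geom_sum_eq h1, h2, sub_self, zero_div]

theorem sum_cos_two_pi_mul {k : ℕ} (hk : k ≠ 0) (n : ℤ) :
    ∑ i : Fin k, Real.cos (2 * Real.pi * n * (i : ℕ) / k) = if (k : ℤ) ∣ n then (k : ℝ) else 0 := by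
  have h := congrArg Complex.re (sum_exp_two_pi_mul hk n)
  rw [Complex.re_sum] at h
  simp_rw [Complex.exp_ofReal_mul_I_re] at h
  rw [h]
  split_ifs <;> simp

theorem sum_sin_two_pi_mul {k : ℕ} (hk : k ≠ 0) (n : ℤ) :
    ∑ i : Fin k, Real.sin (2 * Real.pi * n * (i : ℕ) / k) = 0 := by
  have h := congrArg Complex.im (sum_exp_two_pi_mul hk n)
  rw [Complex.im_sum] at h
  simp_rw [Complex.exp_ofReal_mul_I_im] at h
  rw [h]
  split_ifs <;> simp

/-- The entries of the Hartley matrix. -/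
def hartley (k i l : ℕ) : ℝ :=
  (Real.cos (2 * Real.pi * l * i / k) + Real.sin (2 * Real.pi * l * i / k)) / √k

/-- Flatness of the matrix, from (cos + sin)² ≤ 2. -/
theorem hartley_sq_le (k i l : ℕ) : hartley k i l ^ 2 ≤ 2 / k := by
  rw [hartley, div_pow, Real.sq_sqrt (Nat.cast_nonneg _)]
  refine div_le_div_of_nonneg_right ?_ (Nat.cast_nonneg _)
  nlinarith [Real.sin_sq_add_cos_sq (2 * Real.pi * l * i / k),
    sq_nonneg (Real.cos (2 * Real.pi * l * i / k) - Real.sin (2 * Real.pi * l * i / k))]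

/-- (cos α + sin α)(cos β + sin β) = cos(α - β) + sin(α + β). The sines sum to zero, and the cosines
do so unless k divides l - l'. -/
theorem sum_hartley_mul {k l l' : ℕ} (hl : l < k) (hl' : l' < k) :
    ∑ i : Fin k, hartley k i l * hartley k i l' = if l = l' then 1 else 0 := by
  have hk : k ≠ 0 := by omega
  have hk' : (k : ℝ) ≠ 0 := Nat.cast_ne_zero.2 hk
  have hterm : ∀ i : Fin k, hartley k i l * hartley k i l'
      = (Real.cos (2 * Real.pi * ((l - l' : ℤ) : ℝ) * (i : ℕ) / k)
        + Real.sin (2 * Real.pi * ((l + l' : ℤ) : ℝ) * (i : ℕ) / k)) / k := by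
    intro i
    have e1 : 2 * Real.pi * ((l - l' : ℤ) : ℝ) * (i : ℕ) / k
        = 2 * Real.pi * l * i / k - 2 * Real.pi * l' * i / k := by push_cast; ring
    have e2 : 2 * Real.pi * ((l + l' : ℤ) : ℝ) * (i : ℕ) / k
        = 2 * Real.pi * l * i / k + 2 * Real.pi * l' * i / k := by push_cast; ring
    rw [e1, e2, Real.cos_sub, Real.sin_add, hartley, hartley, div_mul_div_comm,
      Real.mul_self_sqrt (Nat.cast_nonneg _)]
    ring
  simp_rw [hterm]
  rw [← Finset.sum_div, Finset.sum_add_distrib, sum_cos_two_pi_mul hk, sum_sin_two_pi_mul hk,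
    add_zero]
  have hiff : (k : ℤ) ∣ (l - l' : ℤ) ↔ l = l' := by
    constructor
    · intro h
      have := Int.eq_zero_of_abs_lt_dvd h (by rw [abs_lt]; omega)
      omega
    · rintro rfl
      simp
  simp only [hiff]
  split_ifs
  · exact div_self hk'
  · exact zero_div _

/-! ### A lower bound for the minimax risk from a packing -/

/-- The square of the likelihood ratio of M is exp(‖M‖²) times that of 2M. -/
theorem lintegral_exp_sq {p m : ℕ} (M : Matrix (Fin p) (Fin m) ℝ) :
    ∫⁻ Z, ENNReal.ofReal
        (Real.exp (∑ i, ∑ j, M i j * Z i j - (∑ i, ∑ j, M i j ^ 2) / 2) ^ 2) ∂(noise p m)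
      = ENNReal.ofReal (Real.exp (∑ i, ∑ j, M i j ^ 2)) := by
  have h := lintegral_noise_shift ((2 : ℝ) • M) (fun _ => 1) measurable_const
  simp only [lintegral_const, measure_univ, mul_one, Matrix.smul_apply, smul_eq_mul] at h
  have e : ∀ Z : Matrix (Fin p) (Fin m) ℝ, ENNReal.ofReal
        (Real.exp (∑ i, ∑ j, M i j * Z i j - (∑ i, ∑ j, M i j ^ 2) / 2) ^ 2)
      = ENNReal.ofReal (Real.exp (∑ i, ∑ j, M i j ^ 2)) * ENNReal.ofReal
        (Real.exp (∑ i, ∑ j, 2 * M i j * Z i j - (∑ i, ∑ j, (2 * M i j) ^ 2) / 2)) := by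
    intro Z
    rw [← ENNReal.ofReal_mul (Real.exp_pos _).le, ← Real.exp_add, ← Real.exp_nat_mul]
    congr 2
    simp only [mul_pow, mul_assoc, ← Finset.mul_sum]
    push_cast
    ring
  simp_rw [e]
  rw [lintegral_const_mul' _ _ ENNReal.ofReal_ne_top, ← h, mul_one]

/-- The likelihood ratio w satisfies w ≤ e^B + e^(-B) w²/4, and its second moment is at most e^B. -/
theorem lintegral_indicator_shift_le {p m : ℕ} (M : Matrix (Fin p) (Fin m) ℝ) {B : ℝ}
    (hB : ∑ i, ∑ j, M i j ^ 2 ≤ B) {E : Set (Matrix (Fin p) (Fin m) ℝ)} (hE : MeasurableSet E) :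
    ∫⁻ Z, E.indicator 1 (M + Z) ∂(noise p m)
      ≤ ENNReal.ofReal (Real.exp B) * ∫⁻ Z, E.indicator 1 Z ∂(noise p m)
        + ENNReal.ofReal (1 / 4) := by
  have hi : Measurable (E.indicator (1 : Matrix (Fin p) (Fin m) ℝ → ℝ≥0∞)) :=
    measurable_one.indicator hE
  rw [lintegral_noise_shift M _ hi]
  have hpt : ∀ Z, ENNReal.ofReal
        (Real.exp (∑ i, ∑ j, M i j * Z i j - (∑ i, ∑ j, M i j ^ 2) / 2)) * E.indicator 1 Z
      ≤ ENNReal.ofReal (Real.exp B) * E.indicator 1 Z + ENNReal.ofReal (Real.exp (-B) / 4)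
        * ENNReal.ofReal
          (Real.exp (∑ i, ∑ j, M i j * Z i j - (∑ i, ∑ j, M i j ^ 2) / 2) ^ 2) := by
    intro Z
    generalize Real.exp (∑ i, ∑ j, M i j * Z i j - (∑ i, ∑ j, M i j ^ 2) / 2) = w
    by_cases h : Z ∈ E
    · simp only [Set.indicator_of_mem h, Pi.one_apply, mul_one]
      rw [← ENNReal.ofReal_mul (by positivity), ← ENNReal.ofReal_add (by positivity)
        (by positivity)]
      refine ENNReal.ofReal_le_ofReal ?_
      have h1 : Real.exp B * Real.exp (-B) = 1 := by rw [← Real.exp_add]; simp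
      have h2 := mul_nonneg (Real.exp_pos (-B)).le (sq_nonneg (w / 2 - Real.exp B))
      have h3 : Real.exp (-B) * (w / 2 - Real.exp B) ^ 2
          = Real.exp (-B) / 4 * w ^ 2 - (Real.exp B * Real.exp (-B)) * w
            + (Real.exp B * Real.exp (-B)) * Real.exp B := by ring
      rw [h3, h1] at h2
      linarith
    · simp [Set.indicator_of_notMem h]
  refine (lintegral_mono hpt).trans ?_
  rw [lintegral_add_left (hi.const_mul _), lintegral_const_mul _ hi,
    lintegral_const_mul' _ _ ENNReal.ofReal_ne_top, lintegral_exp_sq,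
    ← ENNReal.ofReal_mul (by positivity)]
  refine add_le_add_right (ENNReal.ofReal_le_ofReal ?_) _
  have h1 : Real.exp (-B) * Real.exp (∑ i, ∑ j, M i j ^ 2) ≤ 1 := by
    rw [← Real.exp_add]
    exact Real.exp_le_one_iff.2 (by linarith)
  linarith

/-- With E_f the event that the estimate is within δ of M_f, the counting hypothesis bounds the sum
of the null probabilities of the E_f. Changing measure costs a factor e^B and an additive 1/4 per
index, so on average E_f has probability at most 1/2 under M_f. -/
theorem le_minimaxRisk_of_packing {p m : ℕ} {N : Seminorm ℝ (Matrix (Fin p) (Fin m) ℝ)}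
    {Θ : Set (Matrix (Fin p) (Fin m) ℝ)} {ι : Type*} [Fintype ι] [Nonempty ι]
    (M : ι → Matrix (Fin p) (Fin m) ℝ) (hM : ∀ f, M f ∈ Θ) {B δ : ℝ} (hδ : 0 ≤ δ)
    (hB : ∀ f, ∑ i, ∑ j, M f i j ^ 2 ≤ B)
    (hcount : ∀ f, 4 * Real.exp B * (Finset.univ.filter fun g => N (M f - M g) < 2 * δ).card
      ≤ (Fintype.card ι : ℝ)) :
    ENNReal.ofReal (δ ^ 2 / 2) ≤ minimaxRisk N Θ := by
  refine le_iInf fun ⟨est, hest⟩ => ?_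
  set R := ⨆ X ∈ Θ, risk N est X with hR
  change ENNReal.ofReal (δ ^ 2 / 2) ≤ R
  set E : ι → Set (Matrix (Fin p) (Fin m) ℝ) := fun f => {Y | N (est Y - M f) < δ} with hE
  have hEm : ∀ f, MeasurableSet (E f) := fun f =>
    measurableSet_lt ((measurable_seminorm N).comp (measurable_matrix_sub hest measurable_const))
      measurable_const
  have hi : ∀ f, Measurable ((E f).indicator (1 : Matrix (Fin p) (Fin m) ℝ → ℝ≥0∞)) :=
    fun f => measurable_one.indicator (hEm f)
  set c : ℝ := ((Fintype.card ι : ℕ) : ℝ) with hc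
  have hc0 : 0 < c := by rw [hc]; exact_mod_cast Fintype.card_pos
  have hsum0 : ∑ f, ∫⁻ Z, (E f).indicator 1 Z ∂(noise p m)
      ≤ ENNReal.ofReal (c / (4 * Real.exp B)) := by
    rw [← lintegral_finsetSum _ fun f _ => hi f]
    calc _ ≤ ∫⁻ _, ENNReal.ofReal (c / (4 * Real.exp B)) ∂(noise p m) := by
          refine lintegral_mono fun Z => ?_
          classical
          have h1 : ∑ f, (E f).indicator (1 : Matrix (Fin p) (Fin m) ℝ → ℝ≥0∞) Z
              = ((Finset.univ.filter fun f => Z ∈ E f).card : ℝ≥0∞) := by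
            simp [Set.indicator_apply]
          refine h1.le.trans ?_
          rcases (Finset.univ.filter fun f => Z ∈ E f).eq_empty_or_nonempty with h | ⟨f₀, hf₀⟩
          · rw [h]; simp
          · have hsub : (Finset.univ.filter fun f => Z ∈ E f)
                ⊆ Finset.univ.filter fun g => N (M f₀ - M g) < 2 * δ := by
              intro g hg
              have h2 : N (est Z - M f₀) < δ := (Finset.mem_filter.1 hf₀).2
              have h3 : N (est Z - M g) < δ := (Finset.mem_filter.1 hg).2
              refine Finset.mem_filter.2 ⟨Finset.mem_univ _, ?_⟩
              have h4 : M f₀ - M g = (est Z - M g) - (est Z - M f₀) := by abel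
              rw [h4]
              linarith [map_sub_le_add N (est Z - M g) (est Z - M f₀)]
            rw [← ENNReal.ofReal_natCast]
            refine ENNReal.ofReal_le_ofReal ?_
            rw [le_div_iff₀ (by positivity), mul_comm]
            refine le_trans ?_ (hcount f₀)
            have h5 : (((Finset.univ.filter fun f => Z ∈ E f).card : ℕ) : ℝ)
              ≤ ((Finset.univ.filter fun g => N (M f₀ - M g) < 2 * δ).card : ℕ) :=
              Nat.cast_le.2 (Finset.card_le_card hsub)
            exact mul_le_mul_of_nonneg_left h5 (by positivity)
      _ = _ := by rw [lintegral_const, measure_univ, mul_one]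
  have hsum : ∑ f, ∫⁻ Z, (E f).indicator 1 (M f + Z) ∂(noise p m) ≤ ENNReal.ofReal (c / 2) := by
    calc _ ≤ ∑ f, (ENNReal.ofReal (Real.exp B) * ∫⁻ Z, (E f).indicator 1 Z ∂(noise p m)
            + ENNReal.ofReal (1 / 4)) :=
          Finset.sum_le_sum fun f _ => lintegral_indicator_shift_le (M f) (hB f) (hEm f)
      _ = ENNReal.ofReal (Real.exp B) * ∑ f, ∫⁻ Z, (E f).indicator 1 Z ∂(noise p m)
            + ENNReal.ofReal (c / 4) := by
          rw [Finset.sum_add_distrib, ← Finset.mul_sum, Finset.sum_const, nsmul_eq_mul,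
            Finset.card_univ, ← ENNReal.ofReal_natCast, ← ENNReal.ofReal_mul (by positivity)]
          congr 2
          rw [hc]; ring
      _ ≤ ENNReal.ofReal (Real.exp B) * ENNReal.ofReal (c / (4 * Real.exp B))
            + ENNReal.ofReal (c / 4) := by gcongr
      _ = _ := by
          rw [← ENNReal.ofReal_mul (Real.exp_pos _).le,
            ← ENNReal.ofReal_add (by positivity) (by positivity)]
          congr 1
          have := (Real.exp_pos B).ne'
          field_simp
          norm_num
  have hrisk : ∀ f, ENNReal.ofReal (δ ^ 2) ≤ R + ENNReal.ofReal (δ ^ 2)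
      * ∫⁻ Z, (E f).indicator 1 (M f + Z) ∂(noise p m) := by
    intro f
    have hadd : Measurable fun Z : Matrix (Fin p) (Fin m) ℝ => M f + Z :=
      measurable_matrix_add measurable_const measurable_id
    have hif : Measurable fun Z => (E f).indicator (1 : Matrix (Fin p) (Fin m) ℝ → ℝ≥0∞) (M f + Z) :=
      (hi f).comp hadd
    have h1 : risk N est (M f) ≤ R := le_iSup₂_of_le (M f) (hM f) le_rfl
    refine le_trans ?_ (add_le_add_left h1 _)
    unfold risk
    rw [← lintegral_const_mul _ hif, ← lintegral_add_right _ (hif.const_mul _)]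
    calc ENNReal.ofReal (δ ^ 2) = ∫⁻ _, ENNReal.ofReal (δ ^ 2) ∂(noise p m) := by
          rw [lintegral_const, measure_univ, mul_one]
      _ ≤ _ := by
          refine lintegral_mono fun Z => ?_
          by_cases h : M f + Z ∈ E f
          · simp [Set.indicator_of_mem h]
          · simp only [Set.indicator_of_notMem h, mul_zero, add_zero]
            exact ENNReal.ofReal_le_ofReal (pow_le_pow_left₀ hδ (not_lt.1 h) 2)
  by_cases hRt : R = ⊤
  · rw [hRt]; exact le_top
  have hfin := Finset.sum_le_sum (s := Finset.univ) fun f _ => hrisk f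
  rw [Finset.sum_add_distrib, ← Finset.mul_sum, Finset.sum_const, Finset.sum_const,
    Finset.card_univ, nsmul_eq_mul, nsmul_eq_mul, ← ENNReal.ofReal_natCast, ← hc] at hfin
  have hfin2 := hfin.trans (add_le_add_right (mul_le_mul_right hsum _) _)
  rw [← ENNReal.ofReal_toReal hRt, ← ENNReal.ofReal_mul hc0.le, ← ENNReal.ofReal_mul hc0.le,
    ← ENNReal.ofReal_mul (sq_nonneg _), ← ENNReal.ofReal_add (by positivity) (by positivity),
    ENNReal.ofReal_le_ofReal_iff (by positivity)] at hfin2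
  rw [← ENNReal.ofReal_toReal hRt]
  refine ENNReal.ofReal_le_ofReal ?_
  have h6 : c * (δ ^ 2 / 2) ≤ c * R.toReal := by linarith
  exact le_of_mul_le_mul_left h6 hc0

/-! ### Counting functions with many agreements -/

/-- Exponential Markov bound: weight each g by q to the number of agreements with f. The total
factors over coordinates into (2q - 1)^k, and every counted g has weight at least q^(k/4). -/
theorem card_agree_mul_exp_le {k q : ℕ} (hq : 1 ≤ q) (f : Fin k → Fin q) :
    ((Finset.univ.filter fun g : Fin k → Fin q =>
        k ≤ 4 * (Finset.univ.filter fun i => f i = g i).card).card : ℝ)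
      * Real.exp (k * Real.log q / 4) ≤ (2 * q) ^ k := by
  have hq1 : (1 : ℝ) ≤ q := by exact_mod_cast hq
  have hq0 : (0 : ℝ) < q := by linarith
  have hprod : ∑ g : Fin k → Fin q, ∏ i, (if f i = g i then (q : ℝ) else 1) ≤ (2 * q) ^ k := by
    have h1 := (Finset.prod_univ_sum (fun _ : Fin k => (Finset.univ : Finset (Fin q)))
      (fun i j => if f i = j then (q : ℝ) else 1)).symm
    rw [Fintype.piFinset_univ] at h1
    rw [h1]
    calc _ ≤ ∏ _i : Fin k, (2 * q : ℝ) := by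
          refine Finset.prod_le_prod (fun i _ => Finset.sum_nonneg fun j _ => ?_) fun i _ => ?_
          · split_ifs <;> positivity
          · have : ∀ j, (if f i = j then (q : ℝ) else 1) ≤ (if f i = j then (q : ℝ) else 0) + 1 := by
              intro j; split_ifs <;> linarith
            refine (Finset.sum_le_sum fun j _ => this j).trans (le_of_eq ?_)
            rw [Finset.sum_add_distrib]
            simp
            ring
      _ = _ := by simp
  refine le_trans ?_ hprod
  rw [← nsmul_eq_mul, ← Finset.sum_const]
  refine (Finset.sum_le_sum fun g hg => ?_).trans
    (Finset.sum_le_sum_of_subset_of_nonneg (Finset.filter_subset _ _) fun g _ _ =>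
      Finset.prod_nonneg fun i _ => ?_)
  · have h1 : k ≤ 4 * (Finset.univ.filter fun i => f i = g i).card := (Finset.mem_filter.1 hg).2
    rw [Finset.prod_ite, Finset.prod_const, Finset.prod_const_one, mul_one]
    have h2 : (q : ℝ) ^ (Finset.univ.filter fun i => f i = g i).card
        = Real.exp ((Finset.univ.filter fun i => f i = g i).card * Real.log q) := by
      rw [Real.exp_nat_mul, Real.exp_log hq0]
    rw [h2]
    refine Real.exp_le_exp.2 ?_
    have h3 : (k : ℝ) ≤ 4 * (Finset.univ.filter fun i => f i = g i).card := by exact_mod_cast h1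
    have h4 := mul_le_mul_of_nonneg_right h3 (Real.log_nonneg hq1)
    linarith
  · split_ifs <;> positivity

/-- Half of the exponent q^(k/4) is spent on 4 · 2^k ≤ 8^k ≤ q^(k/8); this is where q ≥ 2^24 = 8^8
enters. -/
theorem card_agree_mul_exp_le_card {k q : ℕ} (hk : 1 ≤ k) (hq : 2 ^ 24 ≤ q) (f : Fin k → Fin q) :
    4 * Real.exp (k * Real.log q / 8) * (Finset.univ.filter fun g : Fin k → Fin q =>
        k ≤ 4 * (Finset.univ.filter fun i => f i = g i).card).card
      ≤ (Fintype.card (Fin k → Fin q) : ℝ) := by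
  have h := card_agree_mul_exp_le (by omega) f
  generalize (Finset.univ.filter fun g : Fin k → Fin q =>
        k ≤ 4 * (Finset.univ.filter fun i => f i = g i).card).card = n at *
  have hq1 : (2 : ℝ) ^ 24 ≤ q := by exact_mod_cast hq
  have hq0 : (0 : ℝ) < q := by linarith [show (0 : ℝ) < 2 ^ 24 by norm_num]
  have h8 : (8 : ℝ) ^ k ≤ Real.exp (k * Real.log q / 8) := by
    have h1 : Real.log 8 ≤ Real.log q / 8 := by
      have h2 := Real.log_le_log (by norm_num) hq1
      rw [show (2 : ℝ) ^ 24 = 8 ^ 8 by norm_num, Real.log_pow] at h2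
      push_cast at h2
      linarith
    have h2 : (8 : ℝ) ^ k = Real.exp (k * Real.log 8) := by
      rw [Real.exp_nat_mul, Real.exp_log (by norm_num)]
    rw [h2, mul_div_assoc]
    exact Real.exp_le_exp.2 (mul_le_mul_of_nonneg_left h1 (Nat.cast_nonneg _))
  have h4 : (4 : ℝ) ≤ 4 ^ k := le_self_pow₀ (by norm_num) (by omega)
  have h84 : (8 : ℝ) ^ k = 4 ^ k * 2 ^ k := by rw [← mul_pow]; norm_num
  have he : Real.exp (k * Real.log q / 4)
      = Real.exp (k * Real.log q / 8) * Real.exp (k * Real.log q / 8) := by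
    rw [← Real.exp_add]; congr 1; ring
  rw [he, mul_pow] at h
  set e := Real.exp (k * Real.log q / 8) with hee
  have he0 : 0 < e := Real.exp_pos _
  have hcard : ((Fintype.card (Fin k → Fin q) : ℕ) : ℝ) = (q : ℝ) ^ k := by simp
  rw [hcard]
  have h2k : (0 : ℝ) < 2 ^ k := by positivity
  have key : 4 * e * n * 2 ^ k ≤ (q : ℝ) ^ k * 2 ^ k := by
    calc 4 * e * n * 2 ^ k = e * n * (4 * 2 ^ k) := by ring
      _ ≤ e * n * e := by
          gcongr
          calc (4 : ℝ) * 2 ^ k ≤ 4 ^ k * 2 ^ k := by gcongr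
            _ ≤ e := by rw [← h84]; exact h8
      _ = n * (e * e) := by ring
      _ ≤ 2 ^ k * (q : ℝ) ^ k := h
      _ = _ := mul_comm _ _
  exact le_of_mul_le_mul_right key h2k

/-! ### Duality -/

theorem sum_mul_eq_trace {p m : ℕ} (A B : Matrix (Fin p) (Fin m) ℝ) :
    ∑ a, ∑ b, A a b * B a b = (A.transpose * B).trace := by
  simp only [Matrix.trace, Matrix.diag_apply, Matrix.mul_apply, Matrix.transpose_apply]
  exact Finset.sum_comm

/-- Domination of a dyadic functional by the norm does not depend on the orthonormal families. -/
theorem IsUnitarilyInvariantNorm.sum_mul_dyadSum_le {p m d : ℕ}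
    {N : Seminorm ℝ (Matrix (Fin p) (Fin m) ℝ)} (hN : IsUnitarilyInvariantNorm N) {y : Fin d → ℝ}
    {u₀ u : Fin d → Fin p → ℝ} {v₀ v : Fin d → Fin m → ℝ} (hu₀ : OrthonormalRows u₀)
    (hv₀ : OrthonormalRows v₀) (hu : OrthonormalRows u) (hv : OrthonormalRows v)
    (h : ∀ A, ∑ a, ∑ b, A a b * dyadSum y u₀ v₀ a b ≤ N A) (D : Matrix (Fin p) (Fin m) ℝ) :
    ∑ a, ∑ b, D a b * dyadSum y u v a b ≤ N D := by
  obtain ⟨U₀, hU₀, V₀, hV₀, e₀⟩ := dyadSum_eq_mul hu₀ hv₀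
  obtain ⟨U, hU, V, hV, e⟩ := dyadSum_eq_mul hu hv
  -- The orthogonal factors carry one pair of families to the other. Moving them onto D keeps its
  -- norm, and cyclicity of the trace identifies the two functionals.
  have h1 := h ((U₀ * U.transpose) * D * (V.transpose * V₀))
  rw [hN.invariant _ (mul_mem hU₀ (transpose_mem_orthogonalGroup hU)) _
    (mul_mem (transpose_mem_orthogonalGroup hV) hV₀)] at h1
  refine le_trans (le_of_eq ?_) h1
  rw [sum_mul_eq_trace, sum_mul_eq_trace, e, e₀]
  generalize (rectDiag (pad y) : Matrix (Fin p) (Fin m) ℝ) = P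
  have hU₀' : U₀.transpose * U₀ = 1 := (Matrix.mem_orthogonalGroup_iff' (Fin p) ℝ).1 hU₀
  have hV₀' : V₀ * V₀.transpose = 1 := (Matrix.mem_orthogonalGroup_iff (Fin m) ℝ).1 hV₀
  simp only [Matrix.transpose_mul, Matrix.transpose_transpose]
  calc (D.transpose * (U * P * V)).trace
      = (D.transpose * U * P * V).trace := by simp only [Matrix.mul_assoc]
    _ = (V * (D.transpose * U * P)).trace := Matrix.trace_mul_comm _ _
    _ = (V * (D.transpose * U * P) * (V₀ * V₀.transpose)).trace := by rw [hV₀', Matrix.mul_one]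
    _ = (V * (D.transpose * U * P) * V₀ * V₀.transpose).trace := by
        simp only [Matrix.mul_assoc]
    _ = (V₀.transpose * (V * (D.transpose * U * P) * V₀)).trace := Matrix.trace_mul_comm _ _
    _ = (V₀.transpose * V * D.transpose * U * (1 : Matrix (Fin p) (Fin p) ℝ) * P * V₀).trace := by
        simp only [Matrix.mul_assoc, Matrix.one_mul]
    _ = _ := by
        rw [← hU₀']
        simp only [Matrix.mul_assoc]

/-- Hahn–Banach, extending from the line spanned by x. -/
theorem exists_dominated_functional {E : Type*} [AddCommGroup E] [Module ℝ E] (N : Seminorm ℝ E)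
    {x : E} (hx : x ≠ 0) : ∃ g : E →ₗ[ℝ] ℝ, g x = N x ∧ ∀ y, g y ≤ N y := by
  obtain ⟨g, hg, hl⟩ := exists_extension_of_le_sublinear
    (LinearPMap.mkSpanSingleton x (N x) hx) N
    (fun c hc y => by rw [map_smul_eq_mul, Real.norm_of_nonneg hc.le])
    (fun y z => map_add_le_add N y z) (by
      rintro ⟨y, hy⟩
      obtain ⟨c, rfl⟩ := Submodule.mem_span_singleton.1 hy
      refine (LinearPMap.mkSpanSingleton'_apply x (N x) _ c hy).le.trans ?_
      simp only [smul_eq_mul, map_smul_eq_mul]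
      exact mul_le_mul_of_nonneg_right (le_abs_self c) (apply_nonneg N x))
  refine ⟨g, ?_, hl⟩
  exact (hg ⟨x, Submodule.mem_span_singleton_self x⟩).trans
    (LinearPMap.mkSpanSingleton'_apply_self x (N x) _ _)

theorem linearMap_matrix_apply {p m : ℕ} (g : Matrix (Fin p) (Fin m) ℝ →ₗ[ℝ] ℝ)
    (A : Matrix (Fin p) (Fin m) ℝ) :
    g A = ∑ a, ∑ b, A a b * g (Matrix.single a b 1) := by
  conv_lhs => rw [Matrix.matrix_eq_sum_single A]
  simp only [map_sum]
  refine Finset.sum_congr rfl fun a _ => Finset.sum_congr rfl fun b _ => ?_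
  rw [← smul_eq_mul, ← map_smul, Matrix.smul_single, smul_eq_mul, mul_one]

theorem card_filter_val_lt_le (n r : ℕ) :
    (Finset.univ.filter fun i : Fin n => i.val < r).card ≤ r := by
  have := Finset.card_le_card_of_injOn (s := Finset.univ.filter fun i : Fin n => i.val < r)
    (t := Finset.range r) Fin.val (fun i hi => by simpa using hi) Fin.val_injective.injOn
  simpa using this

/-- A functional of rank at most `r` which is dominated by the norm and whose Hilbert–Schmidt norm is
at least half of the Lipschitz constant of the gauge. -/
theorem IsUnitarilyInvariantNorm.exists_dual {p m r : ℕ}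
    {N : Seminorm ℝ (Matrix (Fin p) (Fin m) ℝ)} (hN : IsUnitarilyInvariantNorm N) (hp : r ≤ p)
    (hm : r ≤ m) :
    ∃ (d : ℕ) (y : Fin d → ℝ), d ≤ r ∧
      lipschitzConst (restrictGauge (gauge N) r) ^ 2 / 4 ≤ ∑ i, y i ^ 2 ∧
      ∀ (u : Fin d → Fin p → ℝ) (v : Fin d → Fin m → ℝ), OrthonormalRows u → OrthonormalRows v →
        ∀ D : Matrix (Fin p) (Fin m) ℝ, ∑ a, ∑ b, D a b * dyadSum y u v a b ≤ N D := by
  set L := lipschitzConst (restrictGauge (gauge N) r) with hL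
  rcases (lipschitzConst_nonneg N r).eq_or_lt with h0 | hpos
  · refine ⟨0, Fin.elim0, Nat.zero_le _, ?_, fun u v _ _ D => ?_⟩
    · rw [← hL] at h0
      simp [← h0]
    · simp [dyadSum]
  rw [← hL] at hpos
  -- Half of the supremum is exceeded somewhere, which avoids showing that it is attained.
  obtain ⟨x, hx0, hx⟩ : ∃ x : Fin r → ℝ, x ≠ 0 ∧ L / 2 * √(∑ i, x i ^ 2) < gaugeSeminorm N r x := by
    by_contra! hcon
    have : L ≤ L / 2 := by
      rw [hL]
      refine Real.iSup_le (fun ⟨x, hx⟩ => ?_) (by rw [← hL]; linarith)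
      refine div_le_of_le_mul₀ (Real.sqrt_nonneg _) (by rw [← hL]; linarith) ?_
      exact hcon x hx
    linarith
  have o1 := orthonormalRows_stdRows hp
  have o2 := orthonormalRows_stdRows hm
  set X : Matrix (Fin p) (Fin m) ℝ := dyadSum x (stdRows r p) (stdRows r m) with hX
  have hNX : N X = gaugeSeminorm N r x := hN.apply_dyadSum x o1 o2
  have hXX : ∑ a, ∑ b, X a b * X a b = ∑ i, x i * x i := sum_sq_dyadSum x x o1 o2
  have hNX0 : 0 < N X := by
    rw [hNX]
    exact lt_of_le_of_lt (by positivity) hx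
  have hXne : X ≠ 0 := by
    intro h
    rw [h, map_zero] at hNX0
    exact lt_irrefl _ hNX0
  obtain ⟨g, hgX, hg⟩ := exists_dominated_functional N hXne
  set F : Finset (Fin p) := Finset.univ.filter fun i => i.val < r with hF
  set G : Finset (Fin m) := Finset.univ.filter fun i => i.val < r with hG
  -- Compressing the functional to the leading r × r corner forces rank at most r. It stays
  -- dominated because compression is a contraction, and its value at X is unchanged because X lives
  -- in that corner.
  set W : Matrix (Fin p) (Fin m) ℝ := keepBlock F G (Matrix.of fun a b => g (Matrix.single a b 1))
    with hW
  have hWA : ∀ A, ∑ a, ∑ b, A a b * W a b = g (keepBlock F G A) := by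
    intro A
    rw [linearMap_matrix_apply]
    refine Finset.sum_congr rfl fun a _ => Finset.sum_congr rfl fun b _ => ?_
    simp only [hW, keepBlock, Matrix.of_apply]
    split_ifs <;> simp
  have hWle : ∀ A, ∑ a, ∑ b, A a b * W a b ≤ N A := by
    intro A
    rw [hWA]
    exact (hg _).trans (hN.keepBlock_le F G A)
  have hXk : keepBlock F G X = X := by
    ext a b
    simp only [keepBlock, Matrix.of_apply]
    split_ifs with h
    · rfl
    · symm
      simp only [hX, dyadSum, Matrix.of_apply, stdRows]
      refine Finset.sum_eq_zero fun i _ => ?_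
      by_contra hne
      apply h
      have h1 : i.val = a.val := by by_contra h1; simp [h1] at hne
      have h2 : i.val = b.val := by by_contra h2; simp [h2] at hne
      exact ⟨Finset.mem_filter.2 ⟨Finset.mem_univ _, by rw [← h1]; exact i.isLt⟩,
        Finset.mem_filter.2 ⟨Finset.mem_univ _, by rw [← h2]; exact i.isLt⟩⟩
  have hWX : ∑ a, ∑ b, X a b * W a b = N X := by rw [hWA, hXk, hgX]
  obtain ⟨d, y, u₀, v₀, hd, -, hu₀, hv₀, -, -, hWd⟩ :=
    exists_svd W F G (keepBlock_support F G _)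
  have hdr : d ≤ r := (hd.trans (min_le_left _ _)).trans (card_filter_val_lt_le p r)
  have hWW : ∑ a, ∑ b, W a b * W a b = ∑ i, y i * y i := by
    rw [hWd]
    exact sum_sq_dyadSum y y hu₀ hv₀
  refine ⟨d, y, hdr, ?_, fun u v hu hv D => hN.sum_mul_dyadSum_le hu₀ hv₀ hu hv
    (fun A => by rw [← hWd]; exact hWle A) D⟩
  -- Cauchy–Schwarz for N X = ⟨X, W⟩: the square of N X is at most ‖x‖² ‖y‖², while N X > (L/2) ‖x‖.
  have hcs := Finset.sum_mul_sq_le_sq_mul_sq (Finset.univ : Finset (Fin p × Fin m))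
    (fun z => X z.1 z.2) (fun z => W z.1 z.2)
  simp only [Fintype.sum_prod_type, pow_two (X _ _), pow_two (W _ _)] at hcs
  rw [hWX, hXX, hWW] at hcs
  simp only [← pow_two] at hcs
  rw [← hNX] at hx
  have hs0 : 0 < ∑ i, x i ^ 2 := by
    obtain ⟨i, hi⟩ := Function.ne_iff.1 hx0
    exact Finset.sum_pos' (fun i _ => sq_nonneg _)
      ⟨i, Finset.mem_univ _, by have : x i ≠ 0 := hi; positivity⟩
  have hsq := pow_le_pow_left₀ (by positivity) hx.le 2
  rw [mul_pow, Real.sq_sqrt hs0.le] at hsq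
  have h2 : (∑ i, x i ^ 2) * (L ^ 2 / 4) ≤ (∑ i, x i ^ 2) * ∑ i, y i ^ 2 := by
    refine le_trans (le_of_eq ?_) (hsq.trans hcs)
    ring
  exact le_of_mul_le_mul_left h2 hs0

/-! ### Packings of the sparse class -/

/-- Orthonormality is asked only of the common right factor, so two different placements of the left
factor can be compared. -/
theorem sum_dyadSum_mul_dyadSum {d p m : ℕ} (x y : Fin d → ℝ) (u u' : Fin d → Fin p → ℝ)
    {v : Fin d → Fin m → ℝ} (hv : OrthonormalRows v) :
    ∑ a, ∑ b, dyadSum x u v a b * dyadSum y u' v a b = ∑ i, x i * y i * ∑ a, u i a * u' i a := by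
  simp only [dyadSum, Matrix.of_apply, Finset.sum_mul_sum]
  have : ∀ a b i j, x i * u i a * v i b * (y j * u' j a * v j b)
      = x i * y j * ((u i a * u' j a) * (v i b * v j b)) := fun a b i j => by ring
  simp_rw [this]
  have h2 : ∑ a, ∑ b, ∑ i, ∑ j, x i * y j * ((u i a * u' j a) * (v i b * v j b))
      = ∑ i, ∑ j, x i * y j * ((∑ a, u i a * u' j a) * (∑ b, v i b * v j b)) := by
    simp_rw [Finset.sum_mul_sum, Finset.mul_sum]
    rw [Finset.sum_congr rfl fun a _ => Finset.sum_comm, Finset.sum_comm]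
    refine Finset.sum_congr rfl fun i _ => ?_
    rw [Finset.sum_congr rfl fun a _ => Finset.sum_comm, Finset.sum_comm]
  rw [h2]
  simp [hv _ _]

/-- The first `d` columns of the Hartley matrix, with the rows placed at the positions `e`. -/
def plantedRows {k p : ℕ} (d : ℕ) (e : Fin k → Fin p) (l : Fin d) (a : Fin p) : ℝ :=
  ∑ i : Fin k, if e i = a then hartley k i l else 0

/-- Rows with different indices never share a position, so only the indices placed identically
contribute. -/
theorem sum_plantedRows_mul {k p d : ℕ} {e e' : Fin k → Fin p} (h : ∀ i j, e i = e' j → i = j)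
    (l l' : Fin d) :
    ∑ a, plantedRows d e l a * plantedRows d e' l' a
      = ∑ i with e i = e' i, hartley k i l * hartley k i l' := by
  simp only [plantedRows, Finset.sum_mul_sum]
  rw [Finset.sum_comm, Finset.sum_filter]
  refine Finset.sum_congr rfl fun i _ => ?_
  rw [Finset.sum_comm, Finset.sum_eq_single i]
  · simp [ite_mul, eq_comm]
  · intro j _ hj
    have : e i ≠ e' j := fun h' => hj (h i j h').symm
    refine Finset.sum_eq_zero fun a _ => ?_
    by_cases h1 : e i = a
    · have h2 : e' j ≠ a := fun h2 => this (h1.trans h2.symm)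
      simp [h2]
    · simp [h1]
  · simp

theorem orthonormalRows_plantedRows {k p d : ℕ} (hd : d ≤ k) {e : Fin k → Fin p}
    (he : Function.Injective e) : OrthonormalRows (plantedRows d e) := by
  intro l l'
  rw [sum_plantedRows_mul (fun i j h => he h)]
  simp only [Finset.filter_true]
  rw [sum_hartley_mul (by omega) (by omega)]
  simp [Fin.ext_iff]

theorem dyadSum_plantedRows_mem_sparseClass {k s p m d : ℕ} (hd : d ≤ s) (e : Fin k → Fin p)
    (y : Fin d → ℝ) : dyadSum y (plantedRows d e) (stdRows d m) ∈ sparseClass p m k s := by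
  constructor
  · have hsub : {i | (dyadSum y (plantedRows d e) (stdRows d m)).row i ≠ 0} ⊆ Set.range e := by
      intro a ha
      by_contra hne
      refine ha (funext fun b => ?_)
      have : ∀ i, e i ≠ a := fun i h => hne ⟨i, h⟩
      simp [dyadSum, plantedRows, this, Matrix.row]
    refine (Set.ncard_le_ncard hsub (Set.finite_range e)).trans ?_
    rw [← Set.image_univ]
    refine (Set.ncard_image_le Set.finite_univ).trans ?_
    simp [Set.ncard_univ]
  · have hsub : {j | (dyadSum y (plantedRows d e) (stdRows d m)).col j ≠ 0}
        ⊆ ((Finset.univ.filter fun j : Fin m => j.val < d : Finset (Fin m)) : Set (Fin m)) := by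
      intro b hb
      by_contra hne
      refine hb (funext fun a => ?_)
      have : ∀ i : Fin d, i.val ≠ b.val := fun i h => hne (by simp [← h])
      simp [dyadSum, stdRows, this, Matrix.col]
    refine (Set.ncard_le_ncard hsub (Finset.finite_toSet _)).trans ?_
    rw [Set.ncard_coe_finset]
    exact (card_filter_val_lt_le m d).trans hd

/-- A family of sparse matrices separated in the norm `N`, with few close pairs. -/
theorem IsUnitarilyInvariantNorm.exists_packing {p m k s r q : ℕ}
    {N : Seminorm ℝ (Matrix (Fin p) (Fin m) ℝ)} (hN : IsUnitarilyInvariantNorm N) (hr : r ≤ k)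
    (hrs : r ≤ s) (hk : 1 ≤ k) (hq : 2 ^ 24 ≤ q) (hkq : k * q ≤ p) (hsm : s ≤ m)
    (hL : 0 < lipschitzConst (restrictGauge (gauge N) r)) :
    ∃ (M : (Fin k → Fin q) → Matrix (Fin p) (Fin m) ℝ) (B δ : ℝ),
      (∀ f, M f ∈ sparseClass p m k s) ∧ 0 ≤ δ ∧ (∀ f, ∑ i, ∑ j, M f i j ^ 2 ≤ B) ∧
      (∀ f, 4 * Real.exp B * (Finset.univ.filter fun g => N (M f - M g) < 2 * δ).card
        ≤ (Fintype.card (Fin k → Fin q) : ℝ)) ∧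
      k * Real.log q * lipschitzConst (restrictGauge (gauge N) r) ^ 2 / 1024 ≤ δ ^ 2 / 2 := by
  have hkp : k ≤ p := by nlinarith
  obtain ⟨d, y, hdr, hy, hdual⟩ := hN.exists_dual (hr.trans hkp) (hrs.trans hsm)
  set L := lipschitzConst (restrictGauge (gauge N) r) with hLd
  set E := ∑ i, y i ^ 2 with hE
  have hE0 : 0 < E := lt_of_lt_of_le (by positivity) hy
  have hq1 : (1 : ℝ) ≤ q := by exact_mod_cast (by omega : 1 ≤ q)
  have hlog := Real.log_nonneg hq1
  -- The energy allowed by the exponent in `card_agree_mul_exp_le_card`; t rescales the functional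
  -- to have exactly this energy.
  set B : ℝ := k * Real.log q / 8 with hB
  have hB0 : 0 ≤ B := by positivity
  set t : ℝ := √(B / E) with ht
  have ht0 : 0 ≤ t := Real.sqrt_nonneg _
  have ht2 : t ^ 2 * E = B := by
    rw [ht, Real.sq_sqrt (by positivity), div_mul_cancel₀ _ hE0.ne']
  -- The first kq rows form k groups of q; the i-th Hartley row is put at position f i of group i.
  set pos : (Fin k → Fin q) → Fin k → Fin p := fun f i =>
    Fin.castLE hkq (finProdFinEquiv (i, f i)) with hpos
  have hposeq : ∀ f g i j, pos f i = pos g j ↔ i = j ∧ f i = g j := by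
    intro f g i j
    simp [hpos, (Fin.castLE_injective hkq).eq_iff]
  have hon : ∀ f, OrthonormalRows (plantedRows d (pos f)) := fun f =>
    orthonormalRows_plantedRows (hdr.trans hr) fun i j h => ((hposeq f f i j).1 h).1
  have hstd := orthonormalRows_stdRows (d := d) (n := m) (hdr.trans (hrs.trans hsm))
  set G : (Fin k → Fin q) → Matrix (Fin p) (Fin m) ℝ := fun f =>
    dyadSum y (plantedRows d (pos f)) (stdRows d m) with hG
  have hGG : ∀ f, ∑ a, ∑ b, G f a b * G f a b = E := by
    intro f
    rw [hE]
    simp only [pow_two]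
    exact sum_sq_dyadSum y y (hon f) hstd
  have hGfg : ∀ f g, ∑ a, ∑ b, G g a b * G f a b
      ≤ 2 / k * (Finset.univ.filter fun i => f i = g i).card * E := by
    intro f g
    rw [show ∑ a, ∑ b, G g a b * G f a b = _ from
      sum_dyadSum_mul_dyadSum y y (plantedRows d (pos g)) (plantedRows d (pos f)) hstd, hE,
      Finset.mul_sum]
    refine Finset.sum_le_sum fun l _ => ?_
    rw [sum_plantedRows_mul fun i j h => ((hposeq g f i j).1 h).1]
    have h1 : (Finset.univ.filter fun i => pos g i = pos f i)
        = Finset.univ.filter fun i => f i = g i := by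
      ext i
      simp [hposeq, eq_comm]
    rw [h1, mul_comm, pow_two]
    refine mul_le_mul_of_nonneg_right ?_ (mul_self_nonneg _)
    calc ∑ i with f i = g i, hartley k i l * hartley k i l
        ≤ ∑ i with f i = g i, (2 / k : ℝ) :=
          Finset.sum_le_sum fun i _ => by rw [← pow_two]; exact hartley_sq_le k i l
      _ = _ := by rw [Finset.sum_const, nsmul_eq_mul, mul_comm]
  -- With at most k/4 agreements, flatness gives ⟨G f, G g⟩ ≤ E/2. Testing M f - M g against the
  -- dominated functional G f then shows separation at least tE/2 = 2δ. Moreover δ²/2 = BE/32, and E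
  -- ≥ L²/4 gives the factor 1/1024.
  refine ⟨fun f => t • G f, B, t * E / 4, fun f => ?_, by positivity, fun f => ?_, fun f => ?_, ?_⟩
  · have e : t • G f = dyadSum (fun i => t * y i) (plantedRows d (pos f)) (stdRows d m) := by
      ext a b
      simp only [hG, dyadSum, Matrix.smul_apply, Matrix.of_apply, smul_eq_mul, Finset.mul_sum]
      exact Finset.sum_congr rfl fun i _ => by ring
    change t • G f ∈ _
    rw [e]
    exact dyadSum_plantedRows_mem_sparseClass (hdr.trans hrs) _ _
  · refine le_of_eq ?_
    simp only [Matrix.smul_apply, smul_eq_mul, mul_pow, ← Finset.mul_sum]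
    rw [← ht2, ← hGG f]
    simp only [pow_two]
  · refine le_trans (mul_le_mul_of_nonneg_left (Nat.cast_le.2 (Finset.card_le_card ?_))
      (by positivity)) (card_agree_mul_exp_le_card hk hq f)
    intro g hg
    refine Finset.mem_filter.2 ⟨Finset.mem_univ _, ?_⟩
    have h1 : N (t • G f - t • G g) < 2 * (t * E / 4) := (Finset.mem_filter.1 hg).2
    have h2 := hdual _ _ (hon f) hstd (t • G f - t • G g)
    have h3 : ∑ a, ∑ b, (t • G f - t • G g) a b
        * dyadSum y (plantedRows d (pos f)) (stdRows d m) a b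
        = t * (E - ∑ a, ∑ b, G g a b * G f a b) := by
      rw [← hGG f, ← Finset.sum_sub_distrib, Finset.mul_sum]
      refine Finset.sum_congr rfl fun a _ => ?_
      rw [← Finset.sum_sub_distrib, Finset.mul_sum]
      refine Finset.sum_congr rfl fun b _ => ?_
      simp only [Matrix.sub_apply, Matrix.smul_apply, smul_eq_mul, hG]
      ring
    rw [h3] at h2
    have h4 := mul_le_mul_of_nonneg_left (hGfg f g) ht0
    by_contra hlt
    have h5 : (4 * (Finset.univ.filter fun i => f i = g i).card : ℝ) ≤ k := by
      exact_mod_cast (not_le.1 hlt).le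
    have hk0 : (0 : ℝ) < k := by exact_mod_cast hk
    have h6 : 2 / k * (Finset.univ.filter fun i => f i = g i).card * E ≤ E / 2 := by
      rw [div_mul_eq_mul_div, div_mul_eq_mul_div, div_le_iff₀ hk0]
      nlinarith
    have h7 := mul_le_mul_of_nonneg_left h6 ht0
    linarith
  · have h1 : (t * E / 4) ^ 2 / 2 = B * E / 32 := by rw [← ht2]; ring
    rw [h1]
    have h2 := mul_le_mul_of_nonneg_left hy hB0
    have h3 : k * Real.log q = 8 * B := by rw [hB]; ring
    rw [h3]
    linarith

theorem IsUnitarilyInvariantNorm.le_minimaxRisk_rows {p m k s r q : ℕ}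
    {N : Seminorm ℝ (Matrix (Fin p) (Fin m) ℝ)} (hN : IsUnitarilyInvariantNorm N) (hr : r ≤ k)
    (hrs : r ≤ s) (hk : 1 ≤ k) (hq : 2 ^ 24 ≤ q) (hkq : k * q ≤ p) (hsm : s ≤ m) :
    ENNReal.ofReal (k * Real.log q * lipschitzConst (restrictGauge (gauge N) r) ^ 2 / 1024)
      ≤ minimaxRisk N (sparseClass p m k s) := by
  rcases (lipschitzConst_nonneg N r).eq_or_lt with h0 | hpos
  · simp [← h0]
  obtain ⟨M, B, δ, hM, hδ, hB, hc, hle⟩ := hN.exists_packing hr hrs hk hq hkq hsm hpos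
  have : Nonempty (Fin k → Fin q) := ⟨fun _ => ⟨0, by omega⟩⟩
  exact (ENNReal.ofReal_le_ofReal hle).trans (le_minimaxRisk_of_packing M hM hδ hB hc)

/-! ### Transposition -/

/-- The norm of the transposed matrix. -/
def transposeSeminorm {p m : ℕ} (N : Seminorm ℝ (Matrix (Fin p) (Fin m) ℝ)) :
    Seminorm ℝ (Matrix (Fin m) (Fin p) ℝ) :=
  N.comp (Matrix.transposeLinearEquiv (Fin m) (Fin p) ℝ ℝ).toLinearMap

theorem transposeSeminorm_apply {p m : ℕ} (N : Seminorm ℝ (Matrix (Fin p) (Fin m) ℝ))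
    (A : Matrix (Fin m) (Fin p) ℝ) : transposeSeminorm N A = N A.transpose := rfl

theorem IsUnitarilyInvariantNorm.transpose {p m : ℕ} {N : Seminorm ℝ (Matrix (Fin p) (Fin m) ℝ)}
    (hN : IsUnitarilyInvariantNorm N) : IsUnitarilyInvariantNorm (transposeSeminorm N) where
  definite A hA := Matrix.transpose_eq_zero.1 (hN.definite _ hA)
  invariant U hU V hV A := by
    rw [transposeSeminorm_apply, transposeSeminorm_apply, Matrix.transpose_mul,
      Matrix.transpose_mul, ← Matrix.mul_assoc]
    exact hN.invariant _ (transpose_mem_orthogonalGroup hV) _ (transpose_mem_orthogonalGroup hU) _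

theorem restrictGauge_transposeSeminorm {p m : ℕ} (N : Seminorm ℝ (Matrix (Fin p) (Fin m) ℝ))
    (r : ℕ) : restrictGauge (gauge (transposeSeminorm N)) r = restrictGauge (gauge N) r := by
  funext x
  simp only [restrictGauge, gauge, transposeSeminorm_apply]
  congr 1
  ext i j
  simp only [rectDiag, Matrix.transpose_apply, Matrix.of_apply]
  by_cases h : i.val = j.val
  · rw [dif_pos h, dif_pos h.symm]
    simp only [h]
  · rw [dif_neg h, dif_neg fun h' => h h'.symm]

theorem transpose_mem_sparseClass {p m k s : ℕ} {M : Matrix (Fin p) (Fin m) ℝ}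
    (hM : M ∈ sparseClass p m k s) : M.transpose ∈ sparseClass m p s k := ⟨hM.2, hM.1⟩

/-- The packing for the transposed norm is transposed back; gauge and Frobenius norm do not change.
-/
theorem IsUnitarilyInvariantNorm.le_minimaxRisk_cols {p m k s r q : ℕ}
    {N : Seminorm ℝ (Matrix (Fin p) (Fin m) ℝ)} (hN : IsUnitarilyInvariantNorm N) (hr : r ≤ k)
    (hrs : r ≤ s) (hs : 1 ≤ s) (hq : 2 ^ 24 ≤ q) (hsq : s * q ≤ m) (hkp : k ≤ p) :
    ENNReal.ofReal (s * Real.log q * lipschitzConst (restrictGauge (gauge N) r) ^ 2 / 1024)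
      ≤ minimaxRisk N (sparseClass p m k s) := by
  rcases (lipschitzConst_nonneg N r).eq_or_lt with h0 | hpos
  · simp [← h0]
  rw [← restrictGauge_transposeSeminorm] at hpos ⊢
  obtain ⟨M, B, δ, hM, hδ, hB, hc, hle⟩ :=
    hN.transpose.exists_packing hrs hr hs hq hsq hkp hpos
  have : Nonempty (Fin s → Fin q) := ⟨fun _ => ⟨0, by omega⟩⟩
  refine (ENNReal.ofReal_le_ofReal hle).trans (le_minimaxRisk_of_packing
    (fun f => (M f).transpose) (fun f => transpose_mem_sparseClass (hM f)) hδ (B := B)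
    (fun f => ?_) hc)
  refine le_trans (le_of_eq ?_) (hB f)
  exact Finset.sum_comm

/-! ### Minimax rates -/

/-- Either the groups are large enough for the packing, and log(ep/k) is comparable to the logarithm
of the integer quotient, or p/k ≤ 2^24 and log(ep/k) ≤ 1 + 24 log 2 < 18. -/
theorem mul_log_le {p k : ℕ} (hk : 1 ≤ k) (hkp : k ≤ p) :
    (2 ^ 24 ≤ p / k ∧ k * Real.log (Real.exp 1 * p / k) ≤ 2 * (k * Real.log ((p / k : ℕ) : ℝ))) ∨
      k * Real.log (Real.exp 1 * p / k) ≤ 18 * k := by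
  have hk0 : (0 : ℝ) < k := by exact_mod_cast hk
  have hp0 : (0 : ℝ) < p := by exact_mod_cast (by omega : 0 < p)
  have hlog2 := Real.log_two_lt_d9
  have hlt : p < k * (p / k + 1) := Nat.lt_mul_div_succ p hk
  have hsplit : Real.log (Real.exp 1 * p / k) = 1 + Real.log (p / k) := by
    rw [mul_div_assoc, Real.log_mul (Real.exp_pos 1).ne' (by positivity), Real.log_exp]
  rw [hsplit]
  set q := p / k with hq
  have hltr : (p : ℝ) / k < q + 1 := by
    rw [div_lt_iff₀ hk0, mul_comm]
    exact_mod_cast hlt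
  have hpk0 : (0 : ℝ) < p / k := by positivity
  rcases le_or_gt (2 ^ 24) q with h | h
  · refine Or.inl ⟨h, ?_⟩
    have hqr : (2 : ℝ) ^ 24 ≤ q := by exact_mod_cast h
    have h1 : Real.log (p / k) ≤ Real.log (2 * q) :=
      Real.log_le_log hpk0 (by linarith [show (1 : ℝ) ≤ 2 ^ 24 by norm_num])
    have hq0 : (0 : ℝ) < q := lt_of_lt_of_le (by norm_num) hqr
    rw [Real.log_mul (by norm_num) hq0.ne'] at h1
    have h2 := Real.log_le_log (by norm_num) hqr
    rw [Real.log_pow] at h2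
    have h3 := Real.log_two_gt_d9
    push_cast at h2
    have h4 : 1 + Real.log (p / k) ≤ 2 * Real.log q := by linarith
    nlinarith
  · right
    have hqr : (q : ℝ) + 1 ≤ 2 ^ 24 := by exact_mod_cast h
    have h1 : Real.log (p / k) ≤ Real.log (2 ^ 24) := Real.log_le_log hpk0 (by linarith)
    rw [Real.log_pow] at h1
    push_cast at h1
    have h4 : 1 + Real.log (p / k) ≤ 18 := by linarith
    nlinarith

theorem supportedClass_subset_sparseClass {p m k s : ℕ} {I : Finset (Fin p)} {J : Finset (Fin m)}
    (hI : I.card = k) (hJ : J.card = s) : supportedClass I J ⊆ sparseClass p m k s := by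
  intro M hM
  constructor
  · rw [← hI, ← Set.ncard_coe_finset]
    refine Set.ncard_le_ncard (fun i hi => ?_) (Finset.finite_toSet _)
    obtain ⟨j, hj⟩ := Function.ne_iff.1 hi
    exact (hM i j hj).1
  · rw [← hJ, ← Set.ncard_coe_finset]
    refine Set.ncard_le_ncard (fun j hj => ?_) (Finset.finite_toSet _)
    obtain ⟨i, hi⟩ := Function.ne_iff.1 hj
    exact (hM i j hi).2

theorem minimaxRisk_mono {p m : ℕ} (N : Seminorm ℝ (Matrix (Fin p) (Fin m) ℝ))
    {Θ Θ' : Set (Matrix (Fin p) (Fin m) ℝ)} (h : Θ ⊆ Θ') : minimaxRisk N Θ ≤ minimaxRisk N Θ' :=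
  iInf_mono fun _ => biSup_mono h

/-- Each half of the entropy comes from a packing (constant 2 · 1024) or is absorbed by the oracle
bound via L ≤ τ(1) (constant 18 · 296 = 5328). The constant 15984 = 3 · 5328 covers the three bounds
together. -/
theorem IsUnitarilyInvariantNorm.le_minimaxRisk_sparseClass {p m k s : ℕ} (hk : 1 ≤ k)
    (hkp : k ≤ p) (hs : 1 ≤ s) (hsm : s ≤ m) {N : Seminorm ℝ (Matrix (Fin p) (Fin m) ℝ)}
    (hN : IsUnitarilyInvariantNorm N) :
    ENNReal.ofReal ((oracleRate N k s + excessRate N k s) / 15984)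
      ≤ minimaxRisk N (sparseClass p m k s) := by
  obtain ⟨I, -, hI⟩ := Finset.exists_subset_card_eq
    (show k ≤ (Finset.univ : Finset (Fin p)).card by simpa)
  obtain ⟨J, -, hJ⟩ := Finset.exists_subset_card_eq
    (show s ≤ (Finset.univ : Finset (Fin m)).card by simpa)
  have h0 := (hN.le_minimaxRisk_supportedClass hk hs hI hJ).trans
    (minimaxRisk_mono N (supportedClass_subset_sparseClass hI hJ))
  have hLg : gaugeLip N k s ≤ gaugeOne N k s :=
    hN.lipschitzConst_le (by omega) (by omega)
  have hL0 := gaugeLip_nonneg N k s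
  have hL2 : gaugeLip N k s ^ 2 ≤ gaugeOne N k s ^ 2 := pow_le_pow_left₀ hL0 hLg 2
  have hkR : gaugeLip N k s ^ 2 * k ≤ oracleRate N k s :=
    mul_le_mul hL2 (by exact_mod_cast le_max_left k s) (Nat.cast_nonneg _) (sq_nonneg _)
  have hsR : gaugeLip N k s ^ 2 * s ≤ oracleRate N k s :=
    mul_le_mul hL2 (by exact_mod_cast le_max_right k s) (Nat.cast_nonneg _) (sq_nonneg _)
  have h1 : ENNReal.ofReal (gaugeLip N k s ^ 2 * (k * Real.log (Real.exp 1 * p / k)) / 5328)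
      ≤ minimaxRisk N (sparseClass p m k s) := by
    rcases mul_log_le hk hkp with ⟨hq, hle⟩ | hle
    · refine le_trans (ENNReal.ofReal_le_ofReal ?_) (hN.le_minimaxRisk_rows (r := min k s)
        (min_le_left _ _) (min_le_right _ _) hk hq (Nat.mul_div_le p k) hsm)
      change _ ≤ k * Real.log ((p / k : ℕ) : ℝ) * gaugeLip N k s ^ 2 / 1024
      have hl : (0 : ℝ) ≤ k * Real.log ((p / k : ℕ) : ℝ) :=
        mul_nonneg (Nat.cast_nonneg _) (Real.log_natCast_nonneg _)
      nlinarith [mul_le_mul_of_nonneg_left hle (sq_nonneg (gaugeLip N k s)),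
        mul_nonneg (sq_nonneg (gaugeLip N k s)) hl]
    · refine le_trans (ENNReal.ofReal_le_ofReal ?_) h0
      nlinarith [mul_le_mul_of_nonneg_left hle (sq_nonneg (gaugeLip N k s))]
  have h2 : ENNReal.ofReal (gaugeLip N k s ^ 2 * (s * Real.log (Real.exp 1 * m / s)) / 5328)
      ≤ minimaxRisk N (sparseClass p m k s) := by
    rcases mul_log_le hs hsm with ⟨hq, hle⟩ | hle
    · refine le_trans (ENNReal.ofReal_le_ofReal ?_) (hN.le_minimaxRisk_cols (r := min k s)
        (min_le_left _ _) (min_le_right _ _) hs hq (Nat.mul_div_le m s) hkp)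
      change _ ≤ s * Real.log ((m / s : ℕ) : ℝ) * gaugeLip N k s ^ 2 / 1024
      have hl : (0 : ℝ) ≤ s * Real.log ((m / s : ℕ) : ℝ) :=
        mul_nonneg (Nat.cast_nonneg _) (Real.log_natCast_nonneg _)
      nlinarith [mul_le_mul_of_nonneg_left hle (sq_nonneg (gaugeLip N k s)),
        mul_nonneg (sq_nonneg (gaugeLip N k s)) hl]
    · refine le_trans (ENNReal.ofReal_le_ofReal ?_) h0
      nlinarith [mul_le_mul_of_nonneg_left hle (sq_nonneg (gaugeLip N k s))]
  by_cases hR : minimaxRisk N (sparseClass p m k s) = ⊤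
  · rw [hR]; exact le_top
  rw [ENNReal.ofReal_le_iff_le_toReal hR] at h0 h1 h2 ⊢
  have hR0 := oracleRate_nonneg N k s
  unfold excessRate supportEntropy
  linarith

/-- Selection with c₁ = γ = 0, where ψ vanishes, already attains the rate, because the excess of the
true block is measured by the noise itself. -/
theorem IsUnitarilyInvariantNorm.minimaxRisk_sparseClass_le {p m k s : ℕ} (hk : 1 ≤ k)
    (hkp : k ≤ p) (hs : 1 ≤ s) (hsm : s ≤ m) {N : Seminorm ℝ (Matrix (Fin p) (Fin m) ℝ)}
    (hN : IsUnitarilyInvariantNorm N) :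
    minimaxRisk N (sparseClass p m k s)
      ≤ ENNReal.ofReal (6400 * (oracleRate N k s + excessRate N k s)) := by
  refine (iInf_le _ ⟨selectionEstimator N k s 0 0, measurable_selectionEstimator N k s 0 0⟩).trans
    (iSup₂_le fun M hM => ?_)
  simpa using hN.risk_selectionEstimator_le hk hkp hs hsm le_rfl le_rfl hM

end SubmatrixDenoising

end

open SubmatrixDenoising in
theorem theorem4p1 :
    (∃ c C : ℝ, 0 < c ∧ 0 < C ∧
      ∀ (p m k s : ℕ), 1 ≤ k → k ≤ p → 1 ≤ s → s ≤ m →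
      ∀ N : Seminorm ℝ (Matrix (Fin p) (Fin m) ℝ), IsUnitarilyInvariantNorm N →
        -- the minimax risk is of the order of the oracle rate plus the excess rate
        (ENNReal.ofReal (c * (oracleRate N k s + excessRate N k s))
            ≤ minimaxRisk N (sparseClass p m k s) ∧
          minimaxRisk N (sparseClass p m k s)
            ≤ ENNReal.ofReal (C * (oracleRate N k s + excessRate N k s))) ∧
        -- the minimax risk for a known support is of the order of the oracle rate
        (∀ (I : Finset (Fin p)) (J : Finset (Fin m)), I.card = k → J.card = s →
          ENNReal.ofReal (c * oracleRate N k s) ≤ minimaxRisk N (supportedClass I J) ∧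
          minimaxRisk N (supportedClass I J) ≤ ENNReal.ofReal (C * oracleRate N k s))) ∧
    -- the upper bound is attained by a subset-selection estimator
    (∀ c₁ γ : ℝ, √(6 + 2 * √(2 * Real.pi)) ≤ c₁ → 4 ≤ γ →
      ∃ C : ℝ, 0 < C ∧
      ∀ (p m k s : ℕ), 1 ≤ k → k ≤ p → 1 ≤ s → s ≤ m →
      ∀ N : Seminorm ℝ (Matrix (Fin p) (Fin m) ℝ), IsUnitarilyInvariantNorm N →
        ∃ est : Matrix (Fin p) (Fin m) ℝ → Matrix (Fin p) (Fin m) ℝ,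
          IsSubsetSelectionEstimator N k s c₁ γ est ∧
          ∀ M ∈ sparseClass p m k s,
            risk N est M ≤ ENNReal.ofReal (C * (oracleRate N k s + excessRate N k s))) := by
  refine ⟨⟨1 / 15984, 6400, by norm_num, by norm_num, fun p m k s hk hkp hs hsm N hN =>
    ⟨⟨?_, hN.minimaxRisk_sparseClass_le hk hkp hs hsm⟩, fun I J hI hJ => ⟨?_, ?_⟩⟩⟩,
    fun c₁ γ hc hγ => ⟨16 * c₁ ^ 2 + 16 * γ + 6400, by positivity,
      fun p m k s hk hkp hs hsm N hN => ⟨selectionEstimator N k s c₁ γ,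
        isSubsetSelectionEstimator_selectionEstimator hkp hsm N c₁ γ, fun M hM =>
        hN.risk_selectionEstimator_le hk hkp hs hsm ((Real.sqrt_nonneg _).trans hc)
          (by linarith) hM⟩⟩⟩
  · rw [one_div_mul_eq_div]
    exact hN.le_minimaxRisk_sparseClass hk hkp hs hsm
  · refine le_trans (ENNReal.ofReal_le_ofReal ?_) (hN.le_minimaxRisk_supportedClass hk hs hI hJ)
    linarith [oracleRate_nonneg N k s]
  · refine (hN.minimaxRisk_supportedClass_le hk hs hI hJ).trans (ENNReal.ofReal_le_ofReal ?_)
    linarith [oracleRate_nonneg N k s]
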